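/- Let $\mathfrak g$ be a finite-dimensional real Lie algebra. An element $x\in\mathfrak g$ is an \emph{Euler element} if $\operatorname{ad}x$ is non-zero and diagonalizable over $\mathbb R$ with $\operatorname{Spec}(\operatorname{ad}x)\subseteq\{-1,0,1\}$. For a subalgebra $\mathfrak s\subseteq\mathfrak g$ let $\operatorname{Inn}_{\mathfrak g}(\mathfrak s)\subseteq\operatorname{Aut}(\mathfrak g)$ be the subgroup generated by $\{e^{\operatorname{ad}x}: x\in\mathfrak s\}$, with the topology inherited from $\mathrm{GL}(\mathfrak g)$, and put $\operatorname{Inn}(\mathfrak g)=\operatorname{Inn}_{\mathfrak g}(\mathfrak g)$. An element $x$ is \emph{symmetric} if $-x\in\operatorname{Inn}(\mathfrak g)x$. Let $h\in\mathfrak g$ be an Euler element whose image in the semisimple quotient $\mathfrak g/\operatorname{rad}(\mathfrak g)$ is non-zero. Then there exists a Lie subalgebra $\mathfrak b\subseteq\mathfrak g$ with $h\in\mathfrak b$ such that (a) $\mathfrak b\cong\mathfrak{sl}_2(\mathbb R)$ if and only if $h$ is symmetric; (b) if $h$ is not symmetric, then $\mathfrak b\cong\mathfrak{gl}_2(\mathbb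 R)$; (c) if $h$ is symmetric, then $\operatorname{Inn}_{\mathfrak g}(\mathfrak b)\cong\mathrm{PSL}_2(\mathbb R)$; (d) if $h$ is not symmetric and $\mathfrak g$ is simple, then $\operatorname{Inn}_{\mathfrak g}([\mathfrak b,\mathfrak b])\cong\mathrm{SL}_2(\mathbb R)$. Here the isomorphisms in (c) and (d) are isomorphisms of topological groups. Moreover, if $h$ is not symmetric, then no Lie subalgebra of $\mathfrak g$ containing $h$ is isomorphic to $\mathfrak{sl}_2(\mathbb R)$. -/

import Mathlib

/-! Euler elements of finite-dimensional real Lie algebras, and groups of inner automorphisms. -/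

-- The commutator bracket on an associative algebra (used here for real 2 x 2 matrices).
attribute [local instance 100] LieRing.ofAssociativeRing

namespace EulerElement

section EndTopology

variable (V : Type*) [AddCommGroup V] [Module ℝ V]

/-- The canonical topology on the endomorphism algebra of a real vector space. For finite
dimensional `V` this is the unique Hausdorff vector space topology, i.e. the one given by any
norm. The unit group `(Module.End ℝ V)ˣ`, that is `GL(V)`, then carries its usual topology. -/
instance endTopology : TopologicalSpace (Module.End ℝ V) :=
  moduleTopology ℝ (Module.End ℝ V)

instance endIsModuleTopology : IsModuleTopology ℝ (Module.End ℝ V) := ⟨rfl⟩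

instance endIsTopologicalRing [FiniteDimensional ℝ V] : IsTopologicalRing (Module.End ℝ V) :=
  IsModuleTopology.isTopologicalRing ℝ (Module.End ℝ V)

end EndTopology

section

variable {g : Type*} [LieRing g] [LieAlgebra ℝ g]

/-- `x` is an Euler element: `ad x` is non-zero, it is diagonalizable (over the reals), and its
spectrum is contained in `{-1, 0, 1}`. -/
def IsEuler (x : g) : Prop :=
  LieAlgebra.ad ℝ g x ≠ 0 ∧
    (⨆ μ : ℝ, Module.End.eigenspace (LieAlgebra.ad ℝ g x) μ) = ⊤ ∧
    spectrum ℝ (LieAlgebra.ad ℝ g x) ⊆ {-1, 0, 1}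

/-- `Inn_g(s)`: the subgroup of `GL(g)` generated by the automorphisms `e^{ad x}`, `x ∈ s`. -/
noncomputable def Inn [FiniteDimensional ℝ g] (s : LieSubalgebra ℝ g) :
    Subgroup (Module.End ℝ g)ˣ :=
  Subgroup.closure {u | ∃ x ∈ s, (u : Module.End ℝ g) = NormedSpace.exp (LieAlgebra.ad ℝ g x)}

/-- `x` is symmetric: `-x` lies in the orbit of `x` under the group `Inn(g) = Inn_g(g)`. -/
def IsSymmetric [FiniteDimensional ℝ g] (x : g) : Prop :=
  ∃ φ ∈ Inn (⊤ : LieSubalgebra ℝ g), (φ : Module.End ℝ g) x = -x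

/-- The commutator algebra `[b, b]` of a subalgebra `b` of `g`, as a subalgebra of `g`. -/
def commutatorSubalgebra (b : LieSubalgebra ℝ g) : LieSubalgebra ℝ g :=
  (LieAlgebra.derivedSeries ℝ b 1).toLieSubalgebra.map b.incl

/-- `b ≅ sl₂(ℝ)` as real Lie algebras. -/
def IsSl2 (b : LieSubalgebra ℝ g) : Prop :=
  Nonempty (b ≃ₗ⁅ℝ⁆ LieAlgebra.SpecialLinear.sl (Fin 2) ℝ)

/-- `b ≅ gl₂(ℝ)` as real Lie algebras. -/
def IsGl2 (b : LieSubalgebra ℝ g) : Prop :=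
  Nonempty (b ≃ₗ⁅ℝ⁆ Matrix (Fin 2) (Fin 2) ℝ)

end

end EulerElement

/-!
Let `h` be an Euler element. The eigenspaces of `ad h` form a three-grading of `g`, and everything
is derived from `sl₂`-triples `(⁅e, f⁆, e, f)` with `e` of degree `1` and `f` of degree `-1`, here
called graded triples.

*Existence.* If `h` is not in the radical, a graded triple exists
(`exists_gradedTriple_of_notMem_radical`). By induction on the dimension one divides by an abelian
ideal, through which graded triples lift, until the Killing form is non-degenerate; then a
Jacobson–Morozov argument applies, in which nilpotency is evident from the grading.

*Symmetric elements.* If `h` is symmetric, there is a graded triple with `⁅e, f⁆ = 2h`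
(`exists_gradedTriple_of_isSymmetric`). Let `φ` in `Inn g` map `h` to `-h`. The products
`exp(ad y) γ exp(ad a)` with `y` of degree `-1`, `a` of degree `1` and `γ` an automorphism fixing
`h` form the big cell, and an analytic function vanishing on the big cell vanishes on `Inn g`
(`eq_zero_of_vanishing`). As `φ` exchanges `g₁` and `g₋₁`, a suitable determinant does not vanish
at `φ`, hence it does not vanish at some point of the big cell, and this says that
`(ad f)² : g₁ → g₋₁` is bijective for some `f` of degree `-1`. For the resulting triple
`z = ⁅e, f⁆ - 2h` is central, and a second density argument shows that an inner automorphism cannot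
move `h` by a non-zero central element, so `z = 0`. Conversely, the rotation by `π` in the subgroup
belonging to an `sl₂`-subalgebra reverses each of its Euler elements
(`isSymmetric_of_mem_sl2`).

*The subalgebra.* In the symmetric case `b` is the span of the triple. Otherwise `h - ⁅e, f⁆ / 2` is
non-zero and commutes with the triple, and adjoining it gives a copy of `gl₂(ℝ)` containing `h`,
with the span of the triple as its commutator algebra.

*The groups.* The grading forces the weights of `ad ⁅e, f⁆` on `g` to lie in `{-2, …, 2}`, so `g` is a
sum of irreducible `sl₂`-modules of dimension at most three. On these `SL₂(ℝ)` acts by explicit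
matrices, trivially, by the standard representation, or by its symmetric square, and the image of
this action is generated by the exponentials of the triple (`WeightData.range_slHom`). If the
two-dimensional module occurs, the matrix entries of the action recover the matrix, so that the
action is a topological embedding of `SL₂(ℝ)`. If it does not occur, the action is an embedding of
`PSL₂(ℝ)`, because the symmetric square is a closed map with kernel the center. For `⁅e, f⁆ = 2h` all
weights are even. If `g` is simple and all weights are even, then `⁅e, f⁆ = 2h`, so `h` is symmetric
(`GradedTriple.P_one_ne_zero`); this settles the non-symmetric case.
-/

set_option linter.unusedSectionVars false

namespace EulerElement

/-! ### Three-gradings -/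

section Grading

variable {g : Type*} [LieRing g] [LieAlgebra ℝ g]

/-- `ad h` satisfies `(ad h)³ = ad h`, i.e. it is diagonalizable with eigenvalues in `{-1, 0, 1}`;
equivalently, the eigenspaces of `ad h` form a three-grading of the Lie algebra. -/
def ThreeGraded (h : g) : Prop := ∀ x : g, ⁅h, ⁅h, ⁅h, x⁆⁆⁆ = ⁅h, x⁆

/-- The projection onto the `1`-eigenspace of `ad h`. -/
noncomputable def projPos (h : g) : Module.End ℝ g :=
  (2⁻¹ : ℝ) • (LieAlgebra.ad ℝ g h ∘ₗ LieAlgebra.ad ℝ g h + LieAlgebra.ad ℝ g h)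

/-- The projection onto the `-1`-eigenspace of `ad h`. -/
noncomputable def projNeg (h : g) : Module.End ℝ g :=
  (2⁻¹ : ℝ) • (LieAlgebra.ad ℝ g h ∘ₗ LieAlgebra.ad ℝ g h - LieAlgebra.ad ℝ g h)

/-- The projection onto the centralizer of `h`. -/
noncomputable def projZero (h : g) : Module.End ℝ g :=
  LinearMap.id - LieAlgebra.ad ℝ g h ∘ₗ LieAlgebra.ad ℝ g h

theorem projPos_apply (h x : g) : projPos h x = (2⁻¹ : ℝ) • (⁅h, ⁅h, x⁆⁆ + ⁅h, x⁆) := rfl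
theorem projNeg_apply (h x : g) : projNeg h x = (2⁻¹ : ℝ) • (⁅h, ⁅h, x⁆⁆ - ⁅h, x⁆) := rfl
theorem projZero_apply (h x : g) : projZero h x = x - ⁅h, ⁅h, x⁆⁆ := rfl

theorem proj_add (h x : g) : projPos h x + projZero h x + projNeg h x = x := by
  rw [projPos_apply, projNeg_apply, projZero_apply]; module

theorem projPos_of_pos {h x : g} (hx : ⁅h, x⁆ = x) : projPos h x = x := by
  rw [projPos_apply, hx, hx]; module

theorem projPos_of_zero {h x : g} (hx : ⁅h, x⁆ = 0) : projPos h x = 0 := by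
  rw [projPos_apply, hx, lie_zero]; module

theorem projPos_of_neg {h x : g} (hx : ⁅h, x⁆ = -x) : projPos h x = 0 := by
  rw [projPos_apply, hx, lie_neg, hx]; module

theorem projNeg_of_pos {h x : g} (hx : ⁅h, x⁆ = x) : projNeg h x = 0 := by
  rw [projNeg_apply, hx, hx]; module

theorem projNeg_of_zero {h x : g} (hx : ⁅h, x⁆ = 0) : projNeg h x = 0 := by
  rw [projNeg_apply, hx, lie_zero]; module

theorem projNeg_of_neg {h x : g} (hx : ⁅h, x⁆ = -x) : projNeg h x = x := by
  rw [projNeg_apply, hx, lie_neg, hx]; module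

theorem projZero_of_pos {h x : g} (hx : ⁅h, x⁆ = x) : projZero h x = 0 := by
  rw [projZero_apply, hx, hx]; module

theorem projZero_of_zero {h x : g} (hx : ⁅h, x⁆ = 0) : projZero h x = x := by
  rw [projZero_apply, hx, lie_zero]; module

theorem projZero_of_neg {h x : g} (hx : ⁅h, x⁆ = -x) : projZero h x = 0 := by
  rw [projZero_apply, hx, lie_neg, hx]; module

namespace ThreeGraded

variable {h : g} (hh : ThreeGraded h)
include hh

theorem neg : ThreeGraded (-h) := fun x => by
  simp only [neg_lie, lie_neg, neg_neg, hh x]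

theorem lie_projPos (x : g) : ⁅h, projPos h x⁆ = projPos h x := by
  rw [projPos_apply, lie_smul, lie_add, hh]; module

theorem lie_projNeg (x : g) : ⁅h, projNeg h x⁆ = -projNeg h x := by
  rw [projNeg_apply, lie_smul, lie_sub, hh]; module

theorem lie_projZero (x : g) : ⁅h, projZero h x⁆ = 0 := by
  rw [projZero_apply, lie_sub, hh, sub_self]

theorem eq_zero_of_two {x : g} (hx : ⁅h, x⁆ = (2 : ℝ) • x) : x = 0 := by
  have := hh x
  simp only [hx, lie_smul] at this
  have h6 : (6 : ℝ) • x = 0 := by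
    linear_combination (norm := module) this
  exact (smul_eq_zero.mp h6).resolve_left (by norm_num)

theorem eq_zero_of_neg_two {x : g} (hx : ⁅h, x⁆ = (-2 : ℝ) • x) : x = 0 :=
  hh.neg.eq_zero_of_two (by rw [neg_lie, hx]; module)

theorem lie_pos_pos {x y : g} (hx : ⁅h, x⁆ = x) (hy : ⁅h, y⁆ = y) : ⁅x, y⁆ = 0 :=
  hh.eq_zero_of_two (by rw [leibniz_lie, hx, hy]; module)

theorem lie_neg_neg {x y : g} (hx : ⁅h, x⁆ = -x) (hy : ⁅h, y⁆ = -y) : ⁅x, y⁆ = 0 :=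
  hh.eq_zero_of_neg_two (by rw [leibniz_lie, hx, hy, neg_lie, lie_neg]; module)

/-- To prove a linear identity it suffices to check it on the three eigenspaces. -/
theorem induction {p : g → Prop} (hadd : ∀ x y, p x → p y → p (x + y))
    (hpos : ∀ x, ⁅h, x⁆ = x → p x) (hzero : ∀ x, ⁅h, x⁆ = 0 → p x)
    (hneg : ∀ x, ⁅h, x⁆ = -x → p x) (x : g) : p x := by
  rw [← proj_add h x]
  exact hadd _ _ (hadd _ _ (hpos _ (hh.lie_projPos x)) (hzero _ (hh.lie_projZero x)))
    (hneg _ (hh.lie_projNeg x))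

end ThreeGraded

theorem lie_pos_zero {h x y : g} (hx : ⁅h, x⁆ = x) (hy : ⁅h, y⁆ = 0) : ⁅h, ⁅x, y⁆⁆ = ⁅x, y⁆ := by
  rw [leibniz_lie, hx, hy, lie_zero, add_zero]

theorem lie_zero_pos {h x y : g} (hx : ⁅h, x⁆ = 0) (hy : ⁅h, y⁆ = y) : ⁅h, ⁅x, y⁆⁆ = ⁅x, y⁆ := by
  rw [leibniz_lie, hx, hy, zero_lie, zero_add]

theorem lie_neg_zero {h x y : g} (hx : ⁅h, x⁆ = -x) (hy : ⁅h, y⁆ = 0) :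
    ⁅h, ⁅x, y⁆⁆ = -⁅x, y⁆ := by
  rw [leibniz_lie, hx, hy, lie_zero, add_zero, neg_lie]

theorem lie_zero_neg {h x y : g} (hx : ⁅h, x⁆ = 0) (hy : ⁅h, y⁆ = -y) :
    ⁅h, ⁅x, y⁆⁆ = -⁅x, y⁆ := by
  rw [leibniz_lie, hx, hy, zero_lie, zero_add, lie_neg]

theorem lie_pos_neg {h x y : g} (hx : ⁅h, x⁆ = x) (hy : ⁅h, y⁆ = -y) : ⁅h, ⁅x, y⁆⁆ = 0 := by
  rw [leibniz_lie, hx, hy, lie_neg, add_neg_cancel]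

theorem lie_neg_pos {h x y : g} (hx : ⁅h, x⁆ = -x) (hy : ⁅h, y⁆ = y) : ⁅h, ⁅x, y⁆⁆ = 0 := by
  rw [leibniz_lie, hx, hy, neg_lie, neg_add_cancel]

theorem lie_zero_zero {h x y : g} (hx : ⁅h, x⁆ = 0) (hy : ⁅h, y⁆ = 0) : ⁅h, ⁅x, y⁆⁆ = 0 := by
  rw [leibniz_lie, hx, hy, zero_lie, lie_zero, add_zero]

/-! ### Graded `sl₂`-triples -/

/-- An `sl₂`-triple `(⁅e, f⁆, e, f)` with `e` and `f` in the eigenspaces of `ad h` for the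
eigenvalues `1` and `-1`. -/
structure GradedTriple (h e f : g) : Prop where
  lie_e : ⁅h, e⁆ = e
  lie_f : ⁅h, f⁆ = -f
  lie_lie_e : ⁅⁅e, f⁆, e⁆ = (2 : ℝ) • e
  lie_lie_f : ⁅⁅e, f⁆, f⁆ = (-2 : ℝ) • f
  ne_zero : e ≠ 0

/-- If `e` has degree `1`, `f` has degree `-1` and `(ad e)² f = -2e`, then a modification of `f`
completes `e` to an `sl₂`-triple with the same semisimple element `⁅e, f⁆`. -/
theorem GradedTriple.complete {h e f : g} (hh : ThreeGraded h) (he : ⁅h, e⁆ = e)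
    (hf : ⁅h, f⁆ = -f) (hef : ⁅⁅e, f⁆, e⁆ = (2 : ℝ) • e) (hne : e ≠ 0) :
    ∃ f' : g, GradedTriple h e f' ∧ ⁅e, f'⁆ = ⁅e, f⁆ := by
  have h0 : ⁅h, ⁅e, f⁆⁆ = 0 := lie_pos_neg he hf
  -- the defect `v` of `f` is annihilated by `e` and `f`, hence by `⁅e, f⁆`
  set v : g := ⁅⁅e, f⁆, f⁆ + (2 : ℝ) • f with hv
  have hv1 : ⁅h, v⁆ = -v := by
    rw [hv, lie_add, lie_smul, lie_zero_neg h0 hf, hf]; module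
  have hev : ⁅e, v⁆ = 0 := by
    have : ⁅e, ⁅e, f⁆⁆ = (-2 : ℝ) • e := by rw [← lie_skew, hef]; module
    rw [hv, lie_add, lie_smul, leibniz_lie e ⁅e, f⁆ f, this, lie_self, smul_lie]; module
  have hfv : ⁅f, v⁆ = 0 := hh.lie_neg_neg hf hv1
  have hhv : ⁅⁅e, f⁆, v⁆ = 0 := by rw [lie_lie, hfv, hev, lie_zero, lie_zero, sub_zero]
  have key : ⁅e, f - (2⁻¹ : ℝ) • v⁆ = ⁅e, f⁆ := by
    rw [lie_sub, lie_smul, hev, smul_zero, sub_zero]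
  refine ⟨f - (2⁻¹ : ℝ) • v, ⟨he, ?_, ?_, ?_, hne⟩, key⟩
  · rw [lie_sub, lie_smul, hf, hv1]; module
  · rw [key, hef]
  · rw [key, lie_sub, lie_smul, hhv, hv]; module

namespace GradedTriple

variable {h e f : g} (t : GradedTriple h e f)
include t

theorem lie_h : ⁅h, ⁅e, f⁆⁆ = 0 := lie_pos_neg t.lie_e t.lie_f

theorem lie_e_lie : ⁅e, ⁅e, f⁆⁆ = (-2 : ℝ) • e := by rw [← lie_skew, t.lie_lie_e]; module

theorem lie_f_lie : ⁅f, ⁅e, f⁆⁆ = (2 : ℝ) • f := by rw [← lie_skew, t.lie_lie_f]; module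

theorem lie_ne_zero : ⁅e, f⁆ ≠ 0 := fun h0 => t.ne_zero (by
  have := t.lie_lie_e
  rw [h0, zero_lie] at this
  exact (smul_eq_zero.mp this.symm).resolve_left (by norm_num))

theorem f_ne_zero : f ≠ 0 := fun h0 => t.lie_ne_zero (by rw [h0, lie_zero])

theorem symm : GradedTriple (-h) f e where
  lie_e := by rw [neg_lie, t.lie_f, neg_neg]
  lie_f := by rw [neg_lie, t.lie_e]
  lie_lie_e := by rw [← lie_skew f e, neg_lie, t.lie_lie_f]; module
  lie_lie_f := by rw [← lie_skew f e, neg_lie, t.lie_lie_e]; module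
  ne_zero := t.f_ne_zero

theorem H_E (x : g) : ⁅⁅e, f⁆, ⁅e, x⁆⁆ = ⁅e, ⁅⁅e, f⁆, x⁆⁆ + (2 : ℝ) • ⁅e, x⁆ := by
  rw [leibniz_lie, t.lie_lie_e, smul_lie, add_comm]

theorem H_F (x : g) : ⁅⁅e, f⁆, ⁅f, x⁆⁆ = ⁅f, ⁅⁅e, f⁆, x⁆⁆ - (2 : ℝ) • ⁅f, x⁆ := by
  rw [leibniz_lie, t.lie_lie_f, smul_lie]; module

end GradedTriple

end Grading

/-! ### Existence of graded `sl₂`-triples -/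

section Existence

/-- If `A³ = 0` and `[A, [A, B]] = 0`, then `A * B` is nilpotent. -/
theorem isNilpotent_mul_of_cube_eq_zero {V : Type*} [AddCommGroup V] [Module ℝ V]
    (A B : Module.End ℝ V) (h3 : A * A * A = 0)
    (hAB : A * A * B - (2 : ℝ) • (A * B * A) + B * A * A = 0) : IsNilpotent (A * B) := by
  have e1 : A * A * B * A = (2 : ℝ) • (A * B * A * A) := by
    have h := congrArg (· * A) hAB
    have h3' : B * A * A * A = 0 := by rw [mul_assoc B, mul_assoc B, h3, mul_zero]
    simp only [add_mul, sub_mul, smul_mul_assoc, zero_mul, h3', add_zero] at h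
    exact sub_eq_zero.mp h
  have e2 : A * B * A * A = 0 := by
    have h := congrArg (A * ·) hAB
    have h3' : A * (A * A * B) = 0 := by rw [← mul_assoc, ← mul_assoc, h3, zero_mul]
    have h4 : A * (A * B * A) = A * A * B * A := by simp only [mul_assoc]
    have h5 : A * (B * A * A) = A * B * A * A := by simp only [mul_assoc]
    simp only [mul_add, mul_sub, mul_smul_comm, mul_zero, h3', h4, h5, e1] at h
    have : (-3 : ℝ) • (A * B * A * A) = 0 := by linear_combination (norm := module) h
    exact (smul_eq_zero.mp this).resolve_left (by norm_num)
  have e3 : A * B * A = (2⁻¹ : ℝ) • (A * A * B + B * A * A) := by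
    linear_combination (norm := module) (-2⁻¹ : ℝ) • hAB
  refine ⟨4, ?_⟩
  have hp : (A * B) ^ 4 = A * B * (A * B * A) * B * (A * B) := by
    simp only [pow_succ, pow_zero, one_mul, mul_assoc]
  have e4 : A * B * (A * A * B) = 0 := by
    rw [show A * B * (A * A * B) = A * B * A * A * B by simp only [mul_assoc], e2, zero_mul]
  have e5 : A * B * (B * A * A) * B * (A * B) = A * B * B * (A * A * B * A) * B := by
    simp only [mul_assoc]
  rw [hp, e3, mul_smul_comm, mul_add, e4, zero_add, smul_mul_assoc, smul_mul_assoc, e5, e1, e2]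
  simp

variable {g : Type*} [LieRing g] [LieAlgebra ℝ g]

theorem ThreeGraded.lie_pos_cube {h e : g} (hh : ThreeGraded h) (he : ⁅h, e⁆ = e) (x : g) :
    ⁅e, ⁅e, ⁅e, x⁆⁆⁆ = 0 := by
  refine hh.induction (p := fun x => ⁅e, ⁅e, ⁅e, x⁆⁆⁆ = 0) ?_ ?_ ?_ ?_ x
  · intro x y hx hy
    simp only [lie_add, hx, hy, add_zero]
  · intro x hx
    rw [hh.lie_pos_pos he hx, lie_zero, lie_zero]
  · intro x hx
    rw [hh.lie_pos_pos he (lie_pos_zero he hx), lie_zero]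
  · intro x hx
    exact hh.lie_pos_pos he (lie_pos_zero he (lie_pos_neg he hx))

/-- In the semisimple case every `e` of degree `1` lies in the range of `(ad e)²`: that range is
the orthogonal complement, for the Killing form, of the kernel of `(ad e)²`, and `e` is orthogonal
to this kernel because `ad e ∘ ad z` is nilpotent for `z` in it. -/
theorem exists_gradedTriple_of_isKilling [FiniteDimensional ℝ g] [LieAlgebra.IsKilling ℝ g]
    {h : g} (hh : ThreeGraded h) (h0 : h ≠ 0) : ∃ e f : g, GradedTriple h e f := by
  have hnd := LieAlgebra.IsKilling.killingForm_nondegenerate ℝ g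
  have hrefl : (killingForm ℝ g).IsRefl := (LieModule.traceForm_isSymm ℝ g g).isRefl
  have hinv : ∀ x y z : g, killingForm ℝ g ⁅x, y⁆ z = killingForm ℝ g x ⁅y, z⁆ :=
    LieModule.traceForm_apply_lie_apply ℝ g g
  have hker : ∀ x : g, (∀ y, killingForm ℝ g x y = 0) → x = 0 := fun x hx => hnd.1 x hx
  -- there is a non-zero element of degree `1`
  obtain ⟨e, he, hne⟩ : ∃ e : g, ⁅h, e⁆ = e ∧ e ≠ 0 := by
    by_contra! hcon
    have hpos : ∀ x, projPos h x = 0 := fun x => hcon _ (hh.lie_projPos x)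
    have hneg : ∀ x : g, ⁅h, x⁆ = -x → x = 0 := by
      intro x hx
      refine hker x fun y => ?_
      have hxy : ∀ y, ⁅h, y⁆ = 0 ∨ ⁅h, y⁆ = -y → killingForm ℝ g x y = 0 := by
        rintro y (hy | hy)
        · have h1 : killingForm ℝ g ⁅x, h⁆ y = 0 := by rw [hinv, hy, map_zero]
          rwa [← lie_skew, hx, neg_neg] at h1
        · have h1 : killingForm ℝ g ⁅x, h⁆ y = -killingForm ℝ g x y := by
            rw [hinv, hy, map_neg]
          rw [← lie_skew, hx, neg_neg] at h1
          linarith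
      rw [← proj_add h y, hpos, zero_add, map_add,
        hxy _ (Or.inl (hh.lie_projZero y)), hxy _ (Or.inr (hh.lie_projNeg y)), add_zero]
    refine h0 (hker h fun y => ?_)
    have hcen : ∀ x : g, ⁅h, x⁆ = 0 := fun x => by
      have h1 := proj_add h x
      rw [hpos, hneg _ (hh.lie_projNeg x), zero_add, add_zero] at h1
      rw [← h1]
      exact hh.lie_projZero x
    have : LieAlgebra.ad ℝ g h = 0 := LinearMap.ext hcen
    rw [killingForm_apply_apply, this, LinearMap.zero_comp, map_zero]
  set A : Module.End ℝ g := LieAlgebra.ad ℝ g e with hA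
  have hA3 : A * A * A = 0 := LinearMap.ext fun x => hh.lie_pos_cube he x
  -- `(ad e)²` is self-adjoint for the Killing form
  have hadj : ∀ x y, killingForm ℝ g ⁅e, ⁅e, x⁆⁆ y = killingForm ℝ g x ⁅e, ⁅e, y⁆⁆ := by
    intro x y
    have hs : ∀ a b, killingForm ℝ g ⁅e, a⁆ b = -killingForm ℝ g a ⁅e, b⁆ := fun a b => by
      rw [← lie_skew, map_neg, LinearMap.neg_apply, hinv]
    rw [hs, hs, neg_neg]
  have horth : ∀ z, ⁅e, ⁅e, z⁆⁆ = 0 → killingForm ℝ g e z = 0 := by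
    intro z hz
    have hcomm : A * A * LieAlgebra.ad ℝ g z - (2 : ℝ) • (A * LieAlgebra.ad ℝ g z * A)
        + LieAlgebra.ad ℝ g z * A * A = 0 := by
      ext x
      have h1 : ⁅⁅e, ⁅e, z⁆⁆, x⁆ = 0 := by rw [hz, zero_lie]
      rw [lie_lie, lie_lie, lie_lie, lie_sub] at h1
      simp only [LinearMap.add_apply, LinearMap.sub_apply, LinearMap.smul_apply,
        Module.End.mul_apply, hA, LieAlgebra.ad_apply, LinearMap.zero_apply]
      linear_combination (norm := module) h1
    have hnil := isNilpotent_mul_of_cube_eq_zero A (LieAlgebra.ad ℝ g z) hA3 hcomm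
    exact (LinearMap.isNilpotent_trace_of_isNilpotent hnil).eq_zero
  have hmem : e ∈ LinearMap.range (A * A) := by
    rw [← LinearMap.BilinForm.orthogonal_orthogonal hnd hrefl (LinearMap.range (A * A)),
      LinearMap.BilinForm.mem_orthogonal_iff]
    intro z hz
    refine hrefl _ _ (horth z (hker _ fun y => ?_))
    rw [hadj]
    rw [LinearMap.BilinForm.mem_orthogonal_iff] at hz
    exact hrefl _ _ (hz _ ⟨y, rfl⟩)
  obtain ⟨w, hw⟩ := hmem
  have hw : ⁅e, ⁅e, w⁆⁆ = e := hw
  have hwn : ⁅e, ⁅e, projNeg h w⁆⁆ = e := by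
    have h1 : ⁅e, projPos h w⁆ = 0 := hh.lie_pos_pos he (hh.lie_projPos w)
    have h2 : ⁅e, ⁅e, projZero h w⁆⁆ = 0 :=
      hh.lie_pos_pos he (lie_pos_zero he (hh.lie_projZero w))
    rw [← proj_add h w, lie_add, lie_add, lie_add, lie_add, h1, h2, lie_zero, zero_add,
      zero_add] at hw
    exact hw
  have hf : ⁅h, (-2 : ℝ) • projNeg h w⁆ = -((-2 : ℝ) • projNeg h w) := by
    rw [lie_smul, hh.lie_projNeg, smul_neg]
  obtain ⟨f, t, -⟩ := GradedTriple.complete hh he hf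
    (by rw [← lie_skew, lie_smul, lie_smul, hwn]; module) hne
  exact ⟨e, f, t⟩

theorem ThreeGraded.quotient {h : g} (hh : ThreeGraded h) (I : LieIdeal ℝ g) :
    ThreeGraded (LieSubmodule.Quotient.mk h : g ⧸ I) := by
  intro x
  obtain ⟨x, rfl⟩ := LieSubmodule.Quotient.surjective_mk' I x
  change ⁅_, ⁅_, ⁅_, LieSubmodule.Quotient.mk x⁆⁆⁆ = ⁅_, LieSubmodule.Quotient.mk x⁆
  simp only [← LieSubmodule.Quotient.mk_bracket, hh x]

theorem quotient_mk_eq_zero_iff (I : LieIdeal ℝ g) (x : g) :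
    (LieSubmodule.Quotient.mk x : g ⧸ I) = 0 ↔ x ∈ I :=
  LieSubmodule.Quotient.mk_eq_zero I

/-- Graded `sl₂`-triples lift through abelian ideals. If `u = ⁅⁅e, f⁆, e⁆ - 2e` is the defect of an
arbitrary lift, then `(ad ⁅e, f⁆)(ad ⁅e, f⁆ - 2) u = 0`, so adding
`a = -(1/2)(ad ⁅e, f⁆ - 1) u` to `e` removes the defect. -/
theorem GradedTriple.lift_of_abelian {h : g} (hh : ThreeGraded h) (I : LieIdeal ℝ g)
    (hI : ∀ x ∈ I, ∀ y ∈ I, ⁅x, y⁆ = 0) {e' f' : g ⧸ I}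
    (t : GradedTriple (LieSubmodule.Quotient.mk h : g ⧸ I) e' f') :
    ∃ e f : g, GradedTriple h e f := by
  obtain ⟨e0, rfl⟩ := LieSubmodule.Quotient.surjective_mk' I e'
  obtain ⟨f0, rfl⟩ := LieSubmodule.Quotient.surjective_mk' I f'
  -- lifts of degree `1` and `-1`
  set e := projPos h e0 with hedef
  set f := projNeg h f0 with hfdef
  have he : ⁅h, e⁆ = e := hh.lie_projPos e0
  have hf : ⁅h, f⁆ = -f := hh.lie_projNeg f0
  have hmke : (LieSubmodule.Quotient.mk' I e0 : g ⧸ I) = LieSubmodule.Quotient.mk e := by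
    have h1 := projPos_of_pos t.lie_e
    rw [← h1]
    rfl
  have hmkf : (LieSubmodule.Quotient.mk' I f0 : g ⧸ I) = LieSubmodule.Quotient.mk f := by
    have h1 := projNeg_of_neg t.lie_f
    rw [← h1]
    rfl
  rw [hmke, hmkf] at t
  set u : g := ⁅⁅e, f⁆, e⁆ - (2 : ℝ) • e with hu
  set v : g := ⁅⁅e, f⁆, f⁆ + (2 : ℝ) • f with hv
  have huI : u ∈ I := by
    rw [← quotient_mk_eq_zero_iff]
    have h1 := t.lie_lie_e
    change (LieSubmodule.Quotient.mk (⁅⁅e, f⁆, e⁆) : g ⧸ I)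
      = LieSubmodule.Quotient.mk ((2 : ℝ) • e) at h1
    rw [← sub_eq_zero] at h1
    exact h1
  have hvI : v ∈ I := by
    rw [← quotient_mk_eq_zero_iff]
    have h1 := t.lie_lie_f
    change (LieSubmodule.Quotient.mk (⁅⁅e, f⁆, f⁆) : g ⧸ I)
      = LieSubmodule.Quotient.mk ((-2 : ℝ) • f) at h1
    rw [← sub_eq_zero] at h1
    rw [hv, show ⁅⁅e, f⁆, f⁆ + (2 : ℝ) • f = ⁅⁅e, f⁆, f⁆ - (-2 : ℝ) • f by module]
    exact h1
  have h0 : ⁅h, ⁅e, f⁆⁆ = 0 := lie_pos_neg he hf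
  have hu1 : ⁅h, u⁆ = u := by rw [hu, lie_sub, lie_smul, lie_zero_pos h0 he, he]
  have hv1 : ⁅h, v⁆ = -v := by rw [hv, lie_add, lie_smul, lie_zero_neg h0 hf, hf]; module
  -- `⁅e, f⁆`, `e` and `f` act on `I` as an `sl₂`-triple
  have hmem : ∀ x : g, ∀ a ∈ I, ⁅x, a⁆ ∈ I := fun x a ha => lie_mem_right ℝ g I x a ha
  have HE : ∀ a ∈ I, ⁅⁅e, f⁆, ⁅e, a⁆⁆ = ⁅e, ⁅⁅e, f⁆, a⁆⁆ + (2 : ℝ) • ⁅e, a⁆ := fun a ha => by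
    rw [leibniz_lie, show ⁅⁅e, f⁆, e⁆ = (2 : ℝ) • e + u by rw [hu]; module, add_lie, smul_lie,
      hI u huI a ha, add_zero, add_comm]
  have HF : ∀ a ∈ I, ⁅⁅e, f⁆, ⁅f, a⁆⁆ = ⁅f, ⁅⁅e, f⁆, a⁆⁆ - (2 : ℝ) • ⁅f, a⁆ := fun a ha => by
    rw [leibniz_lie, show ⁅⁅e, f⁆, f⁆ = (-2 : ℝ) • f + v by rw [hv]; module, add_lie, smul_lie,
      hI v hvI a ha]
    module
  have EF : ∀ a : g, ⁅e, ⁅f, a⁆⁆ = ⁅⁅e, f⁆, a⁆ + ⁅f, ⁅e, a⁆⁆ := leibniz_lie e f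
  have fu : ⁅f, u⁆ = ⁅e, v⁆ := by
    have h1 : ⁅f, ⁅⁅e, f⁆, e⁆⁆ = ⁅e, ⁅⁅e, f⁆, f⁆⁆ := by
      have h2 := lie_lie e f ⁅e, f⁆
      rw [lie_self] at h2
      rw [← lie_skew ⁅e, f⁆ e, ← lie_skew ⁅e, f⁆ f, lie_neg, lie_neg, sub_eq_zero.mp h2.symm]
    rw [hu, hv, lie_sub, lie_add, lie_smul, lie_smul, h1, ← lie_skew f e]
    module
  have Hu1 : ⁅h, ⁅⁅e, f⁆, u⁆⁆ = ⁅⁅e, f⁆, u⁆ := lie_zero_pos h0 hu1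
  have Hv1 : ⁅h, ⁅⁅e, f⁆, v⁆⁆ = -⁅⁅e, f⁆, v⁆ := lie_zero_neg h0 hv1
  have eu : ⁅e, u⁆ = 0 := hh.lie_pos_pos he hu1
  have eHu : ⁅e, ⁅⁅e, f⁆, u⁆⁆ = 0 := hh.lie_pos_pos he Hu1
  have fv : ⁅f, v⁆ = 0 := hh.lie_neg_neg hf hv1
  have Hu : ⁅⁅e, f⁆, u⁆ = ⁅e, ⁅e, v⁆⁆ := by rw [← fu, EF, eu, lie_zero, add_zero]
  have ffu : ⁅f, ⁅f, u⁆⁆ = -⁅⁅e, f⁆, v⁆ := by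
    have h1 := EF v
    rw [fv, lie_zero] at h1
    rw [fu]
    linear_combination (norm := module) -h1
  have l1 : ⁅e, ⁅e, ⁅f, ⁅f, u⁆⁆⁆⁆ = (2 : ℝ) • ⁅⁅e, f⁆, ⁅⁅e, f⁆, u⁆⁆ - (2 : ℝ) • ⁅⁅e, f⁆, u⁆ := by
    have h1 : ⁅e, ⁅f, ⁅f, u⁆⁆⁆ = (2 : ℝ) • ⁅f, ⁅⁅e, f⁆, u⁆⁆ - (2 : ℝ) • ⁅f, u⁆ := by
      rw [EF ⁅f, u⁆, EF u, eu, lie_zero, add_zero, HF u huI]; module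
    rw [h1, lie_sub, lie_smul, lie_smul, EF, EF, eu, eHu, lie_zero, add_zero, add_zero]
  have l2 : ⁅e, ⁅e, ⁅f, ⁅f, u⁆⁆⁆⁆ = (4 : ℝ) • ⁅⁅e, f⁆, u⁆ - ⁅⁅e, f⁆, ⁅⁅e, f⁆, u⁆⁆ := by
    have h1 := HE _ (hmem e v hvI)
    have h2 := HE _ hvI
    have h3 : ⁅e, ⁅e, ⁅⁅e, f⁆, v⁆⁆⁆ = ⁅⁅e, f⁆, ⁅e, ⁅e, v⁆⁆⁆ - (4 : ℝ) • ⁅e, ⁅e, v⁆⁆ := by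
      rw [show ⁅e, ⁅⁅e, f⁆, v⁆⁆ = ⁅⁅e, f⁆, ⁅e, v⁆⁆ - (2 : ℝ) • ⁅e, v⁆ by rw [h2]; module,
        lie_sub, lie_smul]
      linear_combination (norm := module) -h1
    rw [ffu, lie_neg, lie_neg, h3, Hu]
    module
  have HHu : ⁅⁅e, f⁆, ⁅⁅e, f⁆, u⁆⁆ = (2 : ℝ) • ⁅⁅e, f⁆, u⁆ := by
    linear_combination (norm := module) (3⁻¹ : ℝ) • l2 - (3⁻¹ : ℝ) • l1
  set a : g := (-2⁻¹ : ℝ) • (⁅⁅e, f⁆, u⁆ - u) with ha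
  have haI : a ∈ I := Submodule.smul_mem _ _ (Submodule.sub_mem _ (hmem _ u huI) huI)
  have ha1 : ⁅h, a⁆ = a := by rw [ha, lie_smul, lie_sub, Hu1, hu1]
  have hea : ⁅e, a⁆ = 0 := hh.lie_pos_pos he ha1
  have hafe : ⁅⁅a, f⁆, e⁆ = ⁅⁅e, f⁆, a⁆ := by
    have h1 : ⁅a, e⁆ = 0 := by rw [← lie_skew, hea, neg_zero]
    rw [lie_lie, h1, lie_zero, sub_zero, ← lie_skew f e, lie_neg, lie_skew]
  have hafa : ⁅⁅a, f⁆, a⁆ = 0 := hI _ (lie_mem_left ℝ g I a f haI) _ haI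
  have hmain : ⁅⁅e + a, f⁆, e + a⁆ = (2 : ℝ) • (e + a) := by
    have hHa : ⁅⁅e, f⁆, a⁆ = (-2⁻¹ : ℝ) • ⁅⁅e, f⁆, u⁆ := by
      rw [ha, lie_smul, lie_sub, HHu]; module
    rw [add_lie e a f, add_lie, lie_add, lie_add, hafe, hafa, hHa,
      show ⁅⁅e, f⁆, e⁆ = (2 : ℝ) • e + u by rw [hu]; module, ha]
    module
  have hne : e + a ≠ 0 := fun hc => t.ne_zero (by
    rw [quotient_mk_eq_zero_iff, eq_neg_of_add_eq_zero_left hc]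
    exact Submodule.neg_mem _ haI)
  obtain ⟨f1, t1, -⟩ := GradedTriple.complete hh (by rw [lie_add, he, ha1]) hf hmain hne
  exact ⟨_, _, t1⟩

/-- The preimage of the radical of the quotient by an abelian ideal is solvable. -/
theorem mem_radical_of_quotient_mem_radical [FiniteDimensional ℝ g] (I : LieIdeal ℝ g)
    (hI : ∀ x ∈ I, ∀ y ∈ I, ⁅x, y⁆ = 0) {x : g}
    (hx : (LieSubmodule.Quotient.mk x : g ⧸ I) ∈ LieAlgebra.radical ℝ (g ⧸ I)) :
    x ∈ LieAlgebra.radical ℝ g := by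
  set R := LieAlgebra.radical ℝ (g ⧸ I)
  have hsolv : LieAlgebra.IsSolvable R := LieAlgebra.radicalIsSolvable ℝ (g ⧸ I)
  let π : g →ₗ⁅ℝ⁆ g ⧸ I :=
    { (LieSubmodule.Quotient.mk' I : g →ₗ[ℝ] g ⧸ I) with
      map_lie' := fun {x y} => LieSubmodule.Quotient.mk_bracket I x y }
  let J : LieIdeal ℝ g := R.comap π
  have hJ : ∀ k, ∀ y ∈ LieAlgebra.derivedSeriesOfIdeal ℝ g k J,
      π y ∈ LieAlgebra.derivedSeriesOfIdeal ℝ (g ⧸ I) k R := by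
    intro k
    induction k with
    | zero => intro y hy; exact LieIdeal.mem_comap.mp hy
    | succ k ih =>
      have hle : LieAlgebra.derivedSeriesOfIdeal ℝ g (k + 1) J ≤
          (LieAlgebra.derivedSeriesOfIdeal ℝ (g ⧸ I) (k + 1) R).comap π := by
        rw [LieAlgebra.derivedSeriesOfIdeal_succ, LieSubmodule.lie_le_iff]
        intro y hy z hz
        rw [LieIdeal.mem_comap, LieHom.map_lie, LieAlgebra.derivedSeriesOfIdeal_succ]
        exact LieSubmodule.lie_mem_lie (ih y hy) (ih z hz)
      exact fun y hy => LieIdeal.mem_comap.mp (hle hy)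
  obtain ⟨k, hk⟩ := (LieAlgebra.isSolvable_iff ℝ R).mp hsolv
  rw [LieIdeal.derivedSeries_eq_bot_iff] at hk
  have hkI : ∀ y ∈ LieAlgebra.derivedSeriesOfIdeal ℝ g k J, y ∈ I := fun y hy => by
    have h1 := hJ k y hy
    rw [hk, LieSubmodule.mem_bot] at h1
    exact (quotient_mk_eq_zero_iff I y).mp h1
  have hJs : LieAlgebra.IsSolvable J := by
    refine (LieAlgebra.isSolvable_iff ℝ J).mpr ⟨k + 1, ?_⟩
    rw [LieIdeal.derivedSeries_eq_bot_iff, LieAlgebra.derivedSeriesOfIdeal_succ,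
      LieSubmodule.lie_eq_bot_iff]
    exact fun y hy z hz => hI y (hkI y hy) z (hkI z hz)
  exact (LieAlgebra.LieIdeal.solvable_iff_le_radical ℝ g J).mp hJs (LieIdeal.mem_comap.mpr hx)

end Existence

/-- An element with a three-grading that is not in the radical admits a graded `sl₂`-triple, by
induction on the dimension through non-zero abelian ideals. -/
theorem exists_gradedTriple_of_notMem_radical {g : Type*} [LieRing g] [LieAlgebra ℝ g]
    [FiniteDimensional ℝ g] {h : g} (hh : ThreeGraded h) (hr : h ∉ LieAlgebra.radical ℝ g) :
    ∃ e f : g, GradedTriple h e f := by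
  suffices H : ∀ (n : ℕ) (g : Type _) [LieRing g] [LieAlgebra ℝ g] [FiniteDimensional ℝ g] (h : g),
      Module.finrank ℝ g = n → ThreeGraded h → h ∉ LieAlgebra.radical ℝ g →
      ∃ e f : g, GradedTriple h e f from H _ g h rfl hh hr
  intro n
  induction n using Nat.strong_induction_on with
  | _ n ih =>
    intro g _ _ _ h hn hh hr
    by_cases hA : ∀ I : LieIdeal ℝ g, IsLieAbelian I → I = ⊥
    · have := (LieAlgebra.hasTrivialRadical_iff_no_abelian_ideals ℝ g).mpr hA
      exact exists_gradedTriple_of_isKilling hh fun h0 => hr (by rw [h0]; exact zero_mem _)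
    · push Not at hA
      obtain ⟨I, hab, hI⟩ := hA
      have hI' : ∀ x ∈ I, ∀ y ∈ I, ⁅x, y⁆ = 0 := fun x hx y hy =>
        congrArg Subtype.val (hab.trivial ⟨x, hx⟩ ⟨y, hy⟩)
      have hlt : Module.finrank ℝ (g ⧸ I) < n := by
        have h1 := Submodule.finrank_quotient_add_finrank I.toSubmodule
        have h2 : 0 < Module.finrank ℝ I.toSubmodule := by
          have : Nontrivial I := (LieSubmodule.nontrivial_iff_ne_bot ℝ g g).mpr hI
          exact Module.finrank_pos (R := ℝ) (M := I)
        change Module.finrank ℝ (g ⧸ I) + _ = _ at h1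
        omega
      obtain ⟨e, f, t⟩ := ih _ hlt (g ⧸ I) (LieSubmodule.Quotient.mk h) rfl (hh.quotient I)
        (fun hc => hr (mem_radical_of_quotient_mem_radical I hI' hc))
      exact t.lift_of_abelian hh I hI'

/-! ### The exponential of an endomorphism -/

section Exp

variable (V : Type*) [AddCommGroup V] [Module ℝ V] [FiniteDimensional ℝ V]

attribute [local instance] Matrix.linftyOpNormedRing Matrix.linftyOpNormedAlgebra in
/-- A submultiplicative norm on `End V`, obtained by choosing a basis. Its topology is by
construction the canonical topology of `End V`. -/
@[reducible] noncomputable def endNormedRing : NormedRing (Module.End ℝ V) :=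
  let φ := LinearMap.toMatrixAlgEquiv (Module.finBasis ℝ V)
  let N := NormedRing.induced (Module.End ℝ V) _ φ φ.injective
  have hN : endTopology V = N.toPseudoMetricSpace.toUniformSpace.toTopologicalSpace := by
    have : IsModuleTopology ℝ (Matrix (Fin (Module.finrank ℝ V)) (Fin (Module.finrank ℝ V)) ℝ) :=
      isModuleTopologyOfFiniteDimensional
    let ψ : Module.End ℝ V ≃ₜ Matrix (Fin (Module.finrank ℝ V)) (Fin (Module.finrank ℝ V)) ℝ :=
      { φ.toEquiv with
        continuous_toFun := IsModuleTopology.continuous_of_linearMap φ.toLinearMap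
        continuous_invFun := IsModuleTopology.continuous_of_linearMap φ.symm.toLinearMap }
    exact ψ.isInducing.eq_induced
  { N with
    toMetricSpace := N.toMetricSpace.replaceTopology hN
    dist_eq := N.dist_eq
    norm_mul_le := N.norm_mul_le }

attribute [local instance] Matrix.linftyOpNormedRing Matrix.linftyOpNormedAlgebra in
/-- With the norm `endNormedRing`, `End V` is a real normed algebra. -/
@[reducible] noncomputable def endNormedAlgebra :
    letI := endNormedRing V
    NormedAlgebra ℝ (Module.End ℝ V) :=
  letI := endNormedRing V
  let φ := LinearMap.toMatrixAlgEquiv (Module.finBasis ℝ V)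
  { (inferInstance : Algebra ℝ (Module.End ℝ V)) with
    norm_smul_le := fun r x => (NormedAlgebra.induced ℝ (Module.End ℝ V) _ φ).norm_smul_le r x }

attribute [local instance] endNormedRing endNormedAlgebra

instance endT2Space : T2Space (Module.End ℝ V) :=
  inferInstance

instance endComplete : CompleteSpace (Module.End ℝ V) :=
  FiniteDimensional.complete ℝ _

variable {V}

theorem continuous_linearMap_end {W : Type*} [AddCommGroup W] [Module ℝ W] [TopologicalSpace W]
    [ContinuousAdd W] [ContinuousSMul ℝ W] (ℓ : Module.End ℝ V →ₗ[ℝ] W) : Continuous ℓ :=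
  IsModuleTopology.continuous_of_linearMap ℓ

/-- The exponential series, tested on a linear map into a topological vector space. -/
theorem hasSum_map_exp {W : Type*} [AddCommGroup W] [Module ℝ W] [TopologicalSpace W]
    [ContinuousAdd W] [ContinuousSMul ℝ W] (ℓ : Module.End ℝ V →ₗ[ℝ] W) (A : Module.End ℝ V) :
    HasSum (fun n : ℕ => ((n.factorial : ℝ)⁻¹) • ℓ (A ^ n)) (ℓ (NormedSpace.exp A)) := by
  have h := (NormedSpace.exp_series_hasSum_exp' (𝕂 := ℝ) A).map ℓ (continuous_linearMap_end ℓ)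
  simpa [Function.comp_def] using h

theorem exp_add_of_commute {A B : Module.End ℝ V} (h : Commute A B) :
    NormedSpace.exp (A + B) = NormedSpace.exp A * NormedSpace.exp B :=
  letI := NormedAlgebra.restrictScalars ℚ ℝ (Module.End ℝ V)
  NormedSpace.exp_add_of_commute h

theorem exp_mul_exp_neg (A : Module.End ℝ V) :
    NormedSpace.exp A * NormedSpace.exp (-A) = 1 := by
  rw [← exp_add_of_commute (Commute.neg_right (Commute.refl A)), add_neg_cancel,
    NormedSpace.exp_zero]

theorem exp_neg_mul_exp (A : Module.End ℝ V) :
    NormedSpace.exp (-A) * NormedSpace.exp A = 1 := by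
  simpa using exp_mul_exp_neg (-A)

theorem hasSum_exp_apply (ℓ : V →ₗ[ℝ] ℝ) (A : Module.End ℝ V) (v : V) :
    HasSum (fun n : ℕ => ((n.factorial : ℝ)⁻¹) * ℓ ((A ^ n) v)) (ℓ (NormedSpace.exp A v)) :=
  hasSum_map_exp (ℓ ∘ₗ LinearMap.applyₗ v) A

/-- A linear map that intertwines two endomorphisms intertwines their exponentials. -/
theorem map_exp_apply {W : Type*} [AddCommGroup W] [Module ℝ W] [FiniteDimensional ℝ W]
    (T : V →ₗ[ℝ] W) {A : Module.End ℝ V} {B : Module.End ℝ W} (h : ∀ v, T (A v) = B (T v)) (v : V) :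
    T (NormedSpace.exp A v) = NormedSpace.exp B (T v) := by
  refine (Module.forall_dual_apply_eq_zero_iff ℝ _).mp (fun ℓ => ?_) |> sub_eq_zero.mp
  rw [map_sub, sub_eq_zero]
  have h1 := hasSum_exp_apply (ℓ ∘ₗ T) A v
  have h2 := hasSum_exp_apply ℓ B (T v)
  have hn : ∀ n : ℕ, T ((A ^ n) v) = (B ^ n) (T v) := by
    intro n
    induction n with
    | zero => rfl
    | succ n ih => rw [pow_succ', pow_succ', Module.End.mul_apply, Module.End.mul_apply, h, ih]
  simp only [LinearMap.comp_apply, hn] at h1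
  exact h1.unique h2

theorem exp_apply_of_cube {A : Module.End ℝ V} {v : V} (h : A (A (A v)) = 0) :
    NormedSpace.exp A v = v + A v + (2⁻¹ : ℝ) • A (A v) := by
  refine (Module.forall_dual_apply_eq_zero_iff ℝ _).mp (fun ℓ => ?_) |> sub_eq_zero.mp
  rw [map_sub, sub_eq_zero]
  refine (hasSum_exp_apply ℓ A v).unique ?_
  have h2 : ∀ n ∉ Finset.range 3, ((n.factorial : ℝ)⁻¹) * ℓ ((A ^ n) v) = 0 := by
    intro n hn
    obtain ⟨k, rfl⟩ := Nat.exists_eq_add_of_le' (by simpa using hn : 3 ≤ n)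
    have : (A ^ (k + 3)) v = 0 := by
      rw [pow_add, Module.End.mul_apply]
      change (A ^ k) (A (A (A v))) = 0
      rw [h, map_zero]
    rw [this, map_zero, mul_zero]
  have h3 : HasSum (fun n : ℕ => ((n.factorial : ℝ)⁻¹) * ℓ ((A ^ n) v)) _ :=
    hasSum_sum_of_ne_finset_zero h2
  have h4 : ∑ n ∈ Finset.range 3, ((n.factorial : ℝ)⁻¹) * ℓ ((A ^ n) v)
      = ℓ (v + A v + (2⁻¹ : ℝ) • A (A v)) := by
    simp [Finset.sum_range_succ, pow_succ, Nat.factorial]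
  rwa [h4] at h3

theorem exp_apply_of_sq {A : Module.End ℝ V} {v : V} (h : A (A v) = 0) :
    NormedSpace.exp A v = v + A v := by
  rw [exp_apply_of_cube (by rw [h, map_zero]), h, smul_zero, add_zero]

theorem exp_apply_of_eq_zero {A : Module.End ℝ V} {v : V} (h : A v = 0) :
    NormedSpace.exp A v = v := by
  rw [exp_apply_of_sq (by rw [h, map_zero]), h, add_zero]

/-- If `A² v = -π² v`, then `exp (tA)` rotates the span of `v` and `A v`, and `exp A` is the
rotation by `π`. The span is identified with `ℂ` so that `A` becomes multiplication by `π i`. -/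
theorem exp_apply_eq_neg {A : Module.End ℝ V} {v : V} (h : A (A v) = -(Real.pi ^ 2) • v) :
    NormedSpace.exp A v = -v := by
  refine (Module.forall_dual_apply_eq_zero_iff ℝ _).mp (fun ℓ => ?_) |> sub_eq_zero.mp
  rw [map_sub, sub_eq_zero]
  let T : ℂ →ₗ[ℝ] V := Complex.reLm.smulRight v + Complex.imLm.smulRight ((Real.pi⁻¹ : ℝ) • A v)
  have hT : ∀ z : ℂ, T ((Real.pi * Complex.I : ℂ) * z) = A (T z) := by
    intro z
    simp only [T, LinearMap.add_apply, LinearMap.smulRight_apply, Complex.reLm_coe,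
      Complex.imLm_coe, map_add, map_smul, h]
    simp only [Complex.mul_re, Complex.mul_im, Complex.ofReal_re, Complex.ofReal_im,
      Complex.I_re, Complex.I_im]
    have hpi : (Real.pi : ℝ) ≠ 0 := Real.pi_ne_zero
    match_scalars <;> field_simp <;> ring
  have hn : ∀ n : ℕ, T ((Real.pi * Complex.I : ℂ) ^ n) = (A ^ n) v := by
    intro n
    induction n with
    | zero => simp [T]
    | succ n ih => rw [pow_succ', hT, ih, pow_succ', Module.End.mul_apply]
  refine (hasSum_exp_apply ℓ A v).unique ?_
  have h2 := NormedSpace.exp_series_hasSum_exp' (𝕂 := ℝ) (Real.pi * Complex.I : ℂ)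
  rw [← Complex.exp_eq_exp_ℂ, Complex.exp_pi_mul_I] at h2
  have h3 := h2.map (ℓ ∘ₗ T) (LinearMap.continuous_of_finiteDimensional _)
  have h4 : (ℓ ∘ₗ T) (-1) = ℓ (-v) := by simp [T]
  have h5 : (ℓ ∘ₗ T) ∘ (fun n : ℕ => ((n.factorial : ℝ)⁻¹) • (Real.pi * Complex.I : ℂ) ^ n)
      = fun n : ℕ => ((n.factorial : ℝ)⁻¹) * ℓ ((A ^ n) v) := by
    funext n
    rw [Function.comp_apply, map_smul, LinearMap.comp_apply, hn, smul_eq_mul]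
  rwa [h4, h5] at h3

end Exp

/-! ### Inner automorphisms -/

section InnerAutomorphisms

variable {g : Type*} [LieRing g] [LieAlgebra ℝ g] [FiniteDimensional ℝ g]

attribute [local instance] endNormedRing endNormedAlgebra

theorem exp_mulLeft_apply {V : Type*} [AddCommGroup V] [Module ℝ V] [FiniteDimensional ℝ V]
    (A C : Module.End ℝ V) :
    NormedSpace.exp (LinearMap.mulLeft ℝ A) C = NormedSpace.exp A * C := by
  refine (Module.forall_dual_apply_eq_zero_iff ℝ _).mp (fun ℓ => ?_) |> sub_eq_zero.mp
  rw [map_sub, sub_eq_zero]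
  have h1 := hasSum_exp_apply ℓ (LinearMap.mulLeft ℝ A) C
  simp only [LinearMap.pow_mulLeft, LinearMap.mulLeft_apply] at h1
  exact h1.unique (hasSum_map_exp (ℓ ∘ₗ LinearMap.mulRight ℝ C) A)

theorem exp_mulRight_apply {V : Type*} [AddCommGroup V] [Module ℝ V] [FiniteDimensional ℝ V]
    (A C : Module.End ℝ V) :
    NormedSpace.exp (LinearMap.mulRight ℝ A) C = C * NormedSpace.exp A := by
  refine (Module.forall_dual_apply_eq_zero_iff ℝ _).mp (fun ℓ => ?_) |> sub_eq_zero.mp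
  rw [map_sub, sub_eq_zero]
  have h1 := hasSum_exp_apply ℓ (LinearMap.mulRight ℝ A) C
  simp only [LinearMap.pow_mulRight, LinearMap.mulRight_apply] at h1
  exact h1.unique (hasSum_map_exp (ℓ ∘ₗ LinearMap.mulLeft ℝ C) A)

theorem ad_exp_ad_apply (x y : g) :
    LieAlgebra.ad ℝ g (NormedSpace.exp (LieAlgebra.ad ℝ g x) y) =
      NormedSpace.exp (LieAlgebra.ad ℝ g x) * LieAlgebra.ad ℝ g y *
        NormedSpace.exp (-LieAlgebra.ad ℝ g x) := by
  set A := LieAlgebra.ad ℝ g x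
  have h1 := map_exp_apply (LieAlgebra.ad ℝ g : g →ₗ[ℝ] Module.End ℝ g) (A := A)
    (B := LinearMap.mulLeft ℝ A + LinearMap.mulRight ℝ (-A)) (fun v => by
      simp only [A, LinearMap.add_apply, LinearMap.mulLeft_apply, LinearMap.mulRight_apply,
        LieAlgebra.ad_apply, LieHom.coe_toLinearMap, LieHom.map_lie, Ring.lie_def, mul_neg,
        sub_eq_add_neg]) y
  rw [exp_add_of_commute (LinearMap.commute_mulLeft_right _ _), Module.End.mul_apply,
    exp_mulRight_apply, exp_mulLeft_apply] at h1
  rw [mul_assoc]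
  exact h1

theorem exp_ad_mul_ad (x y : g) :
    NormedSpace.exp (LieAlgebra.ad ℝ g x) * LieAlgebra.ad ℝ g y =
      LieAlgebra.ad ℝ g (NormedSpace.exp (LieAlgebra.ad ℝ g x) y) *
        NormedSpace.exp (LieAlgebra.ad ℝ g x) := by
  rw [ad_exp_ad_apply, mul_assoc, exp_neg_mul_exp, mul_one]

/-- The automorphism `e^{ad x}` of a Lie algebra. -/
noncomputable def expAd (x : g) : g ≃ₗ⁅ℝ⁆ g :=
  { (NormedSpace.exp (LieAlgebra.ad ℝ g x) : Module.End ℝ g) with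
    map_lie' := fun {a b} => LinearMap.congr_fun (exp_ad_mul_ad x a) b
    invFun := (NormedSpace.exp (-LieAlgebra.ad ℝ g x) : Module.End ℝ g)
    left_inv := fun a => LinearMap.congr_fun (exp_neg_mul_exp (LieAlgebra.ad ℝ g x)) a
    right_inv := fun a => LinearMap.congr_fun (exp_mul_exp_neg (LieAlgebra.ad ℝ g x)) a }

theorem expAd_apply (x y : g) : expAd x y = NormedSpace.exp (LieAlgebra.ad ℝ g x) y := rfl

/-- The endomorphism underlying a Lie algebra automorphism. -/
def autEnd (γ : g ≃ₗ⁅ℝ⁆ g) : Module.End ℝ g := (γ.toLinearEquiv : g →ₗ[ℝ] g)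

theorem autEnd_apply (γ : g ≃ₗ⁅ℝ⁆ g) (x : g) : autEnd γ x = γ x := rfl

theorem lieEquiv_injective (γ : g ≃ₗ⁅ℝ⁆ g) {x y : g} (h : γ x = γ y) : x = y := γ.injective h

theorem lieEquiv_apply_eq_zero_iff (γ : g ≃ₗ⁅ℝ⁆ g) {x : g} : γ x = 0 ↔ x = 0 :=
  γ.toLinearEquiv.map_eq_zero_iff

theorem autEnd_mul_ad (γ : g ≃ₗ⁅ℝ⁆ g) (x : g) :
    autEnd γ * LieAlgebra.ad ℝ g x = LieAlgebra.ad ℝ g (γ x) * autEnd γ :=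
  LinearMap.ext fun y => LieEquiv.map_lie γ x y

theorem autEnd_mul_exp_ad (γ : g ≃ₗ⁅ℝ⁆ g) (x : g) :
    autEnd γ * NormedSpace.exp (LieAlgebra.ad ℝ g x) =
      NormedSpace.exp (LieAlgebra.ad ℝ g (γ x)) * autEnd γ :=
  LinearMap.ext fun y => map_exp_apply (autEnd γ)
    (fun v => LinearMap.congr_fun (autEnd_mul_ad γ x) v) y

theorem inv_eq_exp_neg {u : (Module.End ℝ g)ˣ} {x : g}
    (hu : (u : Module.End ℝ g) = NormedSpace.exp (LieAlgebra.ad ℝ g x)) :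
    ((u⁻¹ : (Module.End ℝ g)ˣ) : Module.End ℝ g) = NormedSpace.exp (LieAlgebra.ad ℝ g (-x)) := by
  rw [Units.inv_eq_of_mul_eq_one_right]
  rw [hu, map_neg, exp_mul_exp_neg]

/-- The unit `e^{ad x}` of `End g`. -/
noncomputable def expAdUnit (x : g) : (Module.End ℝ g)ˣ where
  val := NormedSpace.exp (LieAlgebra.ad ℝ g x)
  inv := NormedSpace.exp (-LieAlgebra.ad ℝ g x)
  val_inv := exp_mul_exp_neg _
  inv_val := exp_neg_mul_exp _

theorem expAdUnit_mem {s : LieSubalgebra ℝ g} {x : g} (hx : x ∈ s) : expAdUnit x ∈ Inn s :=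
  Subgroup.subset_closure ⟨x, hx, rfl⟩

/-- Every element of `Inn g` acts by a Lie algebra automorphism, which fixes the center. -/
theorem exists_autEnd_of_mem_Inn {s : LieSubalgebra ℝ g} {u : (Module.End ℝ g)ˣ} (hu : u ∈ Inn s) :
    ∃ γ : g ≃ₗ⁅ℝ⁆ g, (u : Module.End ℝ g) = autEnd γ ∧
      ∀ z : g, (∀ x : g, ⁅x, z⁆ = 0) → γ z = z := by
  induction hu using Subgroup.closure_induction with
  | mem u hu =>
    obtain ⟨x, -, hx⟩ := hu
    exact ⟨expAd x, hx, fun z hz => exp_apply_of_eq_zero (hz x)⟩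
  | one => exact ⟨LieEquiv.refl, rfl, fun z _ => rfl⟩
  | mul u v _ _ hu hv =>
    obtain ⟨γ, hγ, hγz⟩ := hu
    obtain ⟨δ, hδ, hδz⟩ := hv
    refine ⟨δ.trans γ, ?_, fun z hz => ?_⟩
    · rw [Units.val_mul, hγ, hδ]; rfl
    · rw [LieEquiv.trans_apply, hδz z hz, hγz z hz]
  | inv u _ hu =>
    obtain ⟨γ, hγ, hγz⟩ := hu
    refine ⟨γ.symm, ?_, fun z hz => ?_⟩
    · rw [Units.inv_eq_of_mul_eq_one_right]
      rw [hγ]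
      exact LinearMap.ext fun x => γ.apply_symm_apply x
    · rw [← hγz z hz, γ.symm_apply_apply, hγz z hz]

/-! ### The big cell -/

/-- The big cell `exp(ad g₋₁) Aut(g)_h exp(ad g₁)` of the automorphism group. -/
def bigCell (h : g) : Set (Module.End ℝ g) :=
  {ψ | ∃ (y a : g) (γ : g ≃ₗ⁅ℝ⁆ g), ⁅h, y⁆ = -y ∧ ⁅h, a⁆ = a ∧ γ h = h ∧
    ψ = NormedSpace.exp (LieAlgebra.ad ℝ g y) * autEnd γ * NormedSpace.exp (LieAlgebra.ad ℝ g a)}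

theorem one_mem_bigCell (h : g) : (1 : Module.End ℝ g) ∈ bigCell h :=
  ⟨0, 0, LieEquiv.refl, by simp, by simp, rfl, by
    rw [map_zero, NormedSpace.exp_zero, one_mul, mul_one]; rfl⟩

theorem commute_ad_of_lie_eq_zero {x y : g} (h : ⁅x, y⁆ = 0) :
    Commute (LieAlgebra.ad ℝ g x) (LieAlgebra.ad ℝ g y) := by
  rw [commute_iff_lie_eq, ← LieHom.map_lie, h, map_zero]

/-- The analytic functions on `End g` that vanish on the big cell. -/
def vanishing (h : g) : Set (Module.End ℝ g → ℝ) :=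
  {P | AnalyticOnNhd ℝ P Set.univ ∧ ∀ ψ ∈ bigCell h, P ψ = 0}

theorem fderiv_eq_zero_of_curve {V : Type*} [AddCommGroup V] [Module ℝ V] [FiniteDimensional ℝ V]
    {P : Module.End ℝ V → ℝ} (M X N : Module.End ℝ V)
    (hP : DifferentiableAt ℝ P (M * N))
    (hc : ∀ t : ℝ, P (M * NormedSpace.exp (t • X) * N) = 0) :
    fderiv ℝ P (M * N) (M * X * N) = 0 := by
  have h1 : HasDerivAt (fun t : ℝ => M * NormedSpace.exp (t • X) * N) (M * X * N) 0 := by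
    have := ((hasDerivAt_exp_smul_const X (0 : ℝ)).const_mul M).mul_const N
    simpa using this
  have h2 : HasFDerivAt P (fderiv ℝ P (M * N)) (M * NormedSpace.exp ((0 : ℝ) • X) * N) := by
    simpa using hP.hasFDerivAt
  have h3 := h2.comp_hasDerivAt (0 : ℝ) h1
  have h4 : P ∘ (fun t : ℝ => M * NormedSpace.exp (t • X) * N) = fun _ => 0 := funext hc
  rw [h4] at h3
  exact h3.unique (hasDerivAt_const _ _)

/-- The analytic functions vanishing on the big cell are stable under the derivations
`P ↦ dP(ψ)(ψ ad x)`. For `x` in one of the three eigenspaces, `M exp(t ad x) N` stays in the big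
cell when `M` is in `exp(ad g₋₁) Aut(g)_h` and `N` in `exp(ad g₁)`; the general case reduces to this
one by moving `ad x` past `N`. -/
theorem fderiv_mem_vanishing {h : g} (hh : ThreeGraded h) {P : Module.End ℝ g → ℝ}
    (hP : P ∈ vanishing h) (x : g) :
    (fun ψ => fderiv ℝ P ψ (ψ * LieAlgebra.ad ℝ g x)) ∈ vanishing h := by
  obtain ⟨han, h0⟩ := hP
  refine ⟨?_, ?_⟩
  · intro ψ _
    have h1 := han.fderiv ψ (Set.mem_univ ψ)
    have h2 : AnalyticAt ℝ (fun ψ => ψ * LieAlgebra.ad ℝ g x) ψ := analyticAt_id.mul analyticAt_const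
    exact ((ContinuousLinearMap.id ℝ (Module.End ℝ g →L[ℝ] ℝ)).analyticAt_bilinear
      (fderiv ℝ P ψ, ψ * LieAlgebra.ad ℝ g x)).comp₂ h1 h2
  · rintro _ ⟨y, a, γ, hy, ha, hγ, rfl⟩
    set M := NormedSpace.exp (LieAlgebra.ad ℝ g y) * autEnd γ with hM
    set N := NormedSpace.exp (LieAlgebra.ad ℝ g a) with hN
    have hdiff : DifferentiableAt ℝ P (M * N) := (han _ (Set.mem_univ _)).differentiableAt
    have hγh : ∀ w : g, ⁅h, γ w⁆ = γ ⁅h, w⁆ := fun w => by rw [LieEquiv.map_lie, hγ]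
    have key : ∀ w : g, ⁅h, w⁆ = w ∨ ⁅h, w⁆ = 0 ∨ ⁅h, w⁆ = -w →
        fderiv ℝ P (M * N) (M * LieAlgebra.ad ℝ g w * N) = 0 := by
      intro w hw
      refine fderiv_eq_zero_of_curve M _ N hdiff fun t => h0 _ ?_
      rw [← map_smul]
      rcases hw with hw | hw | hw
      · refine ⟨y, t • w + a, γ, hy, by rw [lie_add, lie_smul, hw, ha], hγ, ?_⟩
        rw [map_add, exp_add_of_commute, ← mul_assoc]
        exact commute_ad_of_lie_eq_zero (hh.lie_pos_pos (by rw [lie_smul, hw]) ha)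
      · refine ⟨y, a, (expAd (t • w)).trans γ, hy, ha, ?_, ?_⟩
        · rw [LieEquiv.trans_apply, expAd_apply, exp_apply_of_eq_zero, hγ]
          rw [LieAlgebra.ad_apply, ← lie_skew, lie_smul, hw, smul_zero, neg_zero]
        · rw [hM, mul_assoc (NormedSpace.exp (LieAlgebra.ad ℝ g y))]; rfl
      · refine ⟨y + γ (t • w), a, γ, ?_, ha, hγ, ?_⟩
        · rw [lie_add, hγh, lie_smul, hw, hy, smul_neg, map_neg, neg_add]
        · rw [map_add, exp_add_of_commute, hM, mul_assoc _ (autEnd γ), autEnd_mul_exp_ad,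
            ← mul_assoc]
          exact commute_ad_of_lie_eq_zero
            (hh.lie_neg_neg hy (by rw [hγh, lie_smul, hw, smul_neg, map_neg]))
    have hsum : M * N * LieAlgebra.ad ℝ g x = M * LieAlgebra.ad ℝ g (projPos h (N x)) * N
        + M * LieAlgebra.ad ℝ g (projZero h (N x)) * N
        + M * LieAlgebra.ad ℝ g (projNeg h (N x)) * N := by
      rw [← add_mul, ← mul_add, ← add_mul, ← mul_add, ← map_add, ← map_add, proj_add, mul_assoc,
        hN, exp_ad_mul_ad, ← mul_assoc]
    change fderiv ℝ P (M * N) (M * N * LieAlgebra.ad ℝ g x) = 0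
    rw [hsum, map_add, map_add, key _ (Or.inl (hh.lie_projPos _)),
      key _ (Or.inr (Or.inl (hh.lie_projZero _))), key _ (Or.inr (Or.inr (hh.lie_projNeg _))),
      add_zero, add_zero]

/-- The common zeros of the functions vanishing on the big cell are stable under right
multiplication by `e^{ad x}`: along `t ↦ ψ exp(t ad x)` all derivatives at `0` vanish. -/
theorem eval_mul_exp_eq_zero {h : g} (hh : ThreeGraded h) {ψ : Module.End ℝ g}
    (hψ : ∀ P ∈ vanishing h, P ψ = 0) (x : g) {P : Module.End ℝ g → ℝ} (hP : P ∈ vanishing h) :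
    P (ψ * NormedSpace.exp (LieAlgebra.ad ℝ g x)) = 0 := by
  set X := LieAlgebra.ad ℝ g x with hX
  have hcurve : ∀ t : ℝ, HasDerivAt (fun t : ℝ => ψ * NormedSpace.exp (t • X))
      (ψ * NormedSpace.exp (t • X) * X) t := fun t => by
    rw [mul_assoc]
    exact (hasDerivAt_exp_smul_const X t).const_mul ψ
  have hderiv : ∀ n, ∀ Q ∈ vanishing h,
      iteratedDeriv n (fun t : ℝ => Q (ψ * NormedSpace.exp (t • X))) 0 = 0 := by
    intro n
    induction n with
    | zero => intro Q hQ; simpa using hψ Q hQ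
    | succ n ih =>
      intro Q hQ
      have h1 : deriv (fun t : ℝ => Q (ψ * NormedSpace.exp (t • X))) =
          fun t : ℝ => fderiv ℝ Q (ψ * NormedSpace.exp (t • X))
            (ψ * NormedSpace.exp (t • X) * X) := by
        funext t
        exact ((hQ.1 _ (Set.mem_univ _)).differentiableAt.hasFDerivAt.comp_hasDerivAt t
          (hcurve t)).deriv
      rw [iteratedDeriv_succ', h1]
      exact ih _ (fderiv_mem_vanishing hh hQ x)
  have han : AnalyticOnNhd ℝ (fun t : ℝ => P (ψ * NormedSpace.exp (t • X))) Set.univ := by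
    intro t _
    have h1 : AnalyticAt ℝ (fun t : ℝ => t • X) t := analyticAt_id.smul analyticAt_const
    have h2 : AnalyticAt ℝ (fun t : ℝ => NormedSpace.exp (t • X)) t :=
      AnalyticAt.comp (f := fun t : ℝ => t • X) (NormedSpace.exp_analytic (𝕂 := ℝ) (t • X)) h1
    exact (hP.1 _ (Set.mem_univ _)).comp (analyticAt_const.mul h2)
  have hzero : ∀ᶠ t in nhds (0 : ℝ), P (ψ * NormedSpace.exp (t • X)) = 0 := by
    rw [← analyticOrderAt_eq_top, ENat.eq_top_iff_forall_ge]
    intro n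
    exact (natCast_le_analyticOrderAt_iff_iteratedDeriv_eq_zero (han 0 (Set.mem_univ _))).mpr
      fun i _ => hderiv i P hP
  have h1 := han.eqOn_zero_of_preconnected_of_eventuallyEq_zero isPreconnected_univ
    (Set.mem_univ 0) hzero (Set.mem_univ 1)
  simpa using h1

/-- Density of the big cell: an analytic function vanishing on it vanishes on all of `Inn g`. -/
theorem eq_zero_of_vanishing {h : g} (hh : ThreeGraded h) {P : Module.End ℝ g → ℝ}
    (han : AnalyticOnNhd ℝ P Set.univ) (h0 : ∀ ψ ∈ bigCell h, P ψ = 0)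
    {u : (Module.End ℝ g)ˣ} (hu : u ∈ Inn (⊤ : LieSubalgebra ℝ g)) : P u = 0 := by
  suffices H : ∀ P ∈ vanishing h, P u = 0 from H P ⟨han, h0⟩
  induction hu using Subgroup.closure_induction_right with
  | one => exact fun P hP => hP.2 _ (one_mem_bigCell h)
  | mul_right u _ v hv ih =>
    obtain ⟨x, -, hx⟩ := hv
    intro P hP
    rw [Units.val_mul, hx]
    exact eval_mul_exp_eq_zero hh ih x hP
  | mul_inv_cancel u _ v hv ih =>
    obtain ⟨x, -, hx⟩ := hv
    intro P hP
    rw [Units.val_mul, inv_eq_exp_neg hx]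
    exact eval_mul_exp_eq_zero hh ih (-x) hP

/-- The determinant of an affine family of endomorphisms is an analytic function. -/
theorem analyticOnNhd_det {W : Type*} [AddCommGroup W] [Module ℝ W] [FiniteDimensional ℝ W]
    (L : Module.End ℝ g →ₗ[ℝ] Module.End ℝ W) (C : Module.End ℝ W) :
    AnalyticOnNhd ℝ (fun ψ => LinearMap.det (L ψ + C)) Set.univ := by
  classical
  set b := Module.finBasis ℝ W
  have h1 : (fun ψ => LinearMap.det (L ψ + C)) = fun ψ =>
      ∑ σ : Equiv.Perm (Fin (Module.finrank ℝ W)), ((Equiv.Perm.sign σ : ℤ) : ℝ) *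
        ∏ i, (LinearMap.toMatrix b b (L ψ) (σ i) i + LinearMap.toMatrix b b C (σ i) i) := by
    funext ψ
    rw [← LinearMap.det_toMatrix b, Matrix.det_apply', map_add]
    rfl
  rw [h1]
  refine Finset.analyticOnNhd_fun_sum _ fun σ _ => analyticOnNhd_const.mul
    (Finset.analyticOnNhd_fun_prod _ fun i _ => AnalyticOnNhd.add ?_ analyticOnNhd_const)
  let ℓ : Module.End ℝ g →ₗ[ℝ] ℝ :=
    { toFun := fun ψ => LinearMap.toMatrix b b (L ψ) (σ i) i
      map_add' := fun x y => by rw [map_add, map_add]; rfl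
      map_smul' := fun r x => by rw [map_smul, map_smul]; rfl }
  exact (LinearMap.toContinuousLinearMap ℓ).analyticOnNhd _

end InnerAutomorphisms

/-! ### Symmetric three-gradings -/

section Symmetric

theorem injective_iff_det_ne_zero {W : Type*} [AddCommGroup W] [Module ℝ W]
    [FiniteDimensional ℝ W] (T : Module.End ℝ W) :
    Function.Injective T ↔ LinearMap.det T ≠ 0 := by
  rw [← isUnit_iff_ne_zero, ← LinearMap.isUnit_iff_isUnit_det, LinearMap.isUnit_iff_ker_eq_bot,
    LinearMap.ker_eq_bot]

variable {g : Type*} [LieRing g] [LieAlgebra ℝ g] [FiniteDimensional ℝ g]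

attribute [local instance] endNormedRing endNormedAlgebra

/-- If an element of `Inn g` maps `h` to `-h`, then `(ad y)² : g₁ → g₋₁` is bijective for some `y`
of degree `-1`. Otherwise the determinant of `v ↦ φ p₋ ψ v` on `g₁` would vanish for all `ψ` in the
big cell, where it is `det (φ (ad y)² γ / 2)`, hence for all `ψ` in `Inn g`; but for `ψ = φ` it
does not vanish. -/
theorem exists_bijective_sq {h : g} (hh : ThreeGraded h) {φ : (Module.End ℝ g)ˣ}
    (hφ : φ ∈ Inn (⊤ : LieSubalgebra ℝ g)) (hφh : (φ : Module.End ℝ g) h = -h) :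
    ∃ y : g, ⁅h, y⁆ = -y ∧ (∀ x : g, ⁅h, x⁆ = x → ⁅y, ⁅y, x⁆⁆ = 0 → x = 0) ∧
      ∀ w : g, ⁅h, w⁆ = -w → ∃ x : g, ⁅h, x⁆ = x ∧ ⁅y, ⁅y, x⁆⁆ = w := by
  obtain ⟨δ, hδ, -⟩ := exists_autEnd_of_mem_Inn hφ
  have hδh : δ h = -h := by rw [← hφh, hδ]; rfl
  have hδpos : ∀ x : g, ⁅h, x⁆ = x → ⁅h, δ x⁆ = -δ x := fun x hx => by
    rw [← neg_eq_iff_eq_neg.mpr hδh, neg_lie, ← LieEquiv.map_lie, hx]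
  have hδneg : ∀ x : g, ⁅h, x⁆ = -x → ⁅h, δ x⁆ = δ x := fun x hx => by
    rw [← neg_eq_iff_eq_neg.mpr hδh, neg_lie, ← LieEquiv.map_lie, hx, map_neg, neg_neg]
  let L : Module.End ℝ g →ₗ[ℝ] Module.End ℝ g :=
    LinearMap.mulLeft ℝ (autEnd δ * projNeg h) ∘ₗ LinearMap.mulRight ℝ (projPos h)
  have hT : ∀ ψ v, (L ψ + (1 - projPos h)) v =
      δ (projNeg h (ψ (projPos h v))) + (v - projPos h v) := fun ψ v => rfl
  -- the first summand lies in `g₁`, the second one in the kernel of the projection to `g₁`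
  have hproj : ∀ ψ v, projPos h ((L ψ + (1 - projPos h)) v) =
      δ (projNeg h (ψ (projPos h v))) := fun ψ v => by
    rw [hT, map_add, projPos_of_pos (hδneg _ (hh.lie_projNeg _)), map_sub,
      projPos_of_pos (hh.lie_projPos v), sub_self, add_zero]
  have hcell : ∃ ψ ∈ bigCell h, LinearMap.det (L ψ + (1 - projPos h)) ≠ 0 := by
    by_contra! hcon
    have h1 := eq_zero_of_vanishing hh (analyticOnNhd_det L (1 - projPos h)) hcon hφ
    refine (injective_iff_det_ne_zero _).mp ?_ h1
    rw [injective_iff_map_eq_zero]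
    intro v hv
    have h2 : δ (δ (projPos h v)) = 0 := by
      have h3 := hproj φ v
      rw [hv, map_zero, hδ, autEnd_apply,
        projNeg_of_neg (hδpos _ (hh.lie_projPos v))] at h3
      exact h3.symm
    have h4 : projPos h v = 0 := by
      rwa [lieEquiv_apply_eq_zero_iff, lieEquiv_apply_eq_zero_iff] at h2
    rw [hT, h4, map_zero, map_zero, map_zero, zero_add, sub_zero] at hv
    exact hv
  obtain ⟨_, ⟨y, a, γ, hy, ha, hγ, rfl⟩, hdet⟩ := hcell
  have hinj := (injective_iff_det_ne_zero _).mpr hdet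
  have hsurj := LinearMap.surjective_of_injective hinj
  have hγh : ∀ w : g, ⁅h, γ w⁆ = γ ⁅h, w⁆ := fun w => by rw [LieEquiv.map_lie, hγ]
  have hval : ∀ x : g, ⁅h, x⁆ = x → projNeg h ((NormedSpace.exp (LieAlgebra.ad ℝ g y) * autEnd γ *
      NormedSpace.exp (LieAlgebra.ad ℝ g a)) x) = (2⁻¹ : ℝ) • ⁅y, ⁅y, γ x⁆⁆ := by
    intro x hx
    have h1 : NormedSpace.exp (LieAlgebra.ad ℝ g a) x = x :=
      exp_apply_of_eq_zero (hh.lie_pos_pos ha hx)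
    have h2 : ⁅h, γ x⁆ = γ x := by rw [hγh, hx]
    have h3 := lie_neg_pos hy h2
    have h4 := lie_neg_zero hy h3
    rw [Module.End.mul_apply, Module.End.mul_apply, h1, autEnd_apply, exp_apply_of_cube]
    · rw [map_add, map_add, LieAlgebra.ad_apply, LieAlgebra.ad_apply, projNeg_of_pos h2,
        projNeg_of_zero h3, map_smul, projNeg_of_neg h4, zero_add, zero_add]
    · exact hh.lie_neg_neg hy h4
  refine ⟨y, hy, fun x hx hyx => ?_, fun w hw => ?_⟩
  · -- `γ⁻¹ x` lies in the kernel
    have h1 : ⁅h, γ.symm x⁆ = γ.symm x := by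
      apply lieEquiv_injective γ
      rw [← hγh, γ.apply_symm_apply, hx]
    have h2 : γ.symm x = 0 := by
      apply hinj
      rw [map_zero, hT, projPos_of_pos h1, hval _ h1, γ.apply_symm_apply, hyx, smul_zero, map_zero,
        sub_self, add_zero]
    rwa [lieEquiv_apply_eq_zero_iff] at h2
  · obtain ⟨v, hv⟩ := hsurj (δ w)
    refine ⟨(2⁻¹ : ℝ) • γ (projPos h v), ?_, ?_⟩
    · rw [lie_smul, hγh, hh.lie_projPos]
    · apply lieEquiv_injective δ
      have h1 := hproj (NormedSpace.exp (LieAlgebra.ad ℝ g y) * autEnd γ *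
        NormedSpace.exp (LieAlgebra.ad ℝ g a)) v
      rw [hv, projPos_of_pos (hδneg w hw), hval _ (hh.lie_projPos v)] at h1
      rw [lie_smul, lie_smul, h1]

/-- If `(ad f)² : g₁ → g₋₁` is bijective, then `⁅e, f⁆ - 2h` is central. -/
theorem GradedTriple.lie_eq_of_bijective_sq {h e f : g} (hh : ThreeGraded h)
    (t : GradedTriple h e f) (hinj : ∀ x : g, ⁅h, x⁆ = x → ⁅f, ⁅f, x⁆⁆ = 0 → x = 0)
    (hsurj : ∀ w : g, ⁅h, w⁆ = -w → ∃ x : g, ⁅h, x⁆ = x ∧ ⁅f, ⁅f, x⁆⁆ = w) (x : g) :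
    ⁅⁅e, f⁆, x⁆ = (2 : ℝ) • ⁅h, x⁆ := by
  have hpos : ∀ x : g, ⁅h, x⁆ = x → ⁅⁅e, f⁆, x⁆ = (2 : ℝ) • x := by
    intro x hx
    have hex : ⁅e, x⁆ = 0 := hh.lie_pos_pos t.lie_e hx
    have hfff : ⁅f, ⁅f, ⁅f, x⁆⁆⁆ = 0 :=
      hh.lie_neg_neg t.lie_f (lie_neg_zero t.lie_f (lie_neg_pos t.lie_f hx))
    have h1 := t.H_F x
    have h2 := t.H_F ⁅f, x⁆
    have h3 : ⁅e, ⁅f, ⁅f, ⁅f, x⁆⁆⁆⁆ = 0 := by rw [hfff, lie_zero]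
    rw [leibniz_lie e f, leibniz_lie e f, leibniz_lie e f, hex, lie_zero, add_zero, h2, h1] at h3
    simp only [lie_add, lie_sub, lie_smul] at h3
    refine sub_eq_zero.mp (hinj _ ?_ ?_)
    · rw [lie_sub, lie_smul, lie_zero_pos t.lie_h hx, hx]
    · rw [lie_sub, lie_sub, lie_smul, lie_smul]
      linear_combination (norm := module) (3⁻¹ : ℝ) • h3
  have hneg : ∀ x : g, ⁅h, x⁆ = -x → ⁅⁅e, f⁆, x⁆ = (-2 : ℝ) • x := by
    intro w hw
    obtain ⟨x, hx, rfl⟩ := hsurj w hw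
    rw [t.H_F, t.H_F, hpos x hx, lie_sub, lie_smul, lie_smul]
    module
  refine hh.induction (p := fun x => ⁅⁅e, f⁆, x⁆ = (2 : ℝ) • ⁅h, x⁆) ?_ ?_ ?_ ?_ x
  · intro x y hx hy
    rw [lie_add, hx, hy, lie_add, smul_add]
  · intro x hx
    rw [hpos x hx, hx]
  · intro w hw
    have hew := hpos _ (lie_pos_zero t.lie_e hw)
    have hfw := hneg _ (lie_neg_zero t.lie_f hw)
    have hffw : ⁅f, ⁅f, w⁆⁆ = 0 := hh.lie_neg_neg t.lie_f (lie_neg_zero t.lie_f hw)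
    have heew : ⁅e, ⁅e, w⁆⁆ = 0 := hh.lie_pos_pos t.lie_e (lie_pos_zero t.lie_e hw)
    have hefe : ⁅e, ⁅f, ⁅e, w⁆⁆⁆ = (2 : ℝ) • ⁅e, w⁆ := by
      rw [leibniz_lie e f, heew, lie_zero, add_zero, hew]
    have hfH : ⁅f, ⁅⁅e, f⁆, w⁆⁆ = 0 := by
      have h1 := t.H_F w
      rw [hfw] at h1
      linear_combination (norm := module) -h1
    have hffe : ⁅f, ⁅f, ⁅e, w⁆⁆⁆ = (2 : ℝ) • ⁅f, w⁆ := by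
      have h1 := leibniz_lie e f ⁅f, w⁆
      rw [hffw, lie_zero, hfw, leibniz_lie e f, lie_add, hfH, zero_add] at h1
      linear_combination (norm := module) -h1
    -- split `w` into a vector annihilated by `e` and `f` and the vector `⁅f, ⁅e, w⁆⁆ / 2`
    have h1 : ⁅⁅e, f⁆, w - (2⁻¹ : ℝ) • ⁅f, ⁅e, w⁆⁆⁆ = 0 := by
      rw [lie_lie, lie_sub f, lie_sub e w, lie_smul, lie_smul, hffe, hefe]
      rw [show ⁅f, w⁆ - (2⁻¹ : ℝ) • (2 : ℝ) • ⁅f, w⁆ = 0 by module,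
        show ⁅e, w⁆ - (2⁻¹ : ℝ) • (2 : ℝ) • ⁅e, w⁆ = 0 by module, lie_zero, lie_zero, sub_zero]
    have h2 : ⁅⁅e, f⁆, ⁅f, ⁅e, w⁆⁆⁆ = 0 := by
      rw [t.H_F, hew, lie_smul, sub_self]
    rw [lie_sub, lie_smul, h2, smul_zero, sub_zero] at h1
    rw [h1, hw, smul_zero]
  · intro x hx
    rw [hneg x hx, hx]
    module

/-- An element of `Inn g` that moves `h` by a central element fixes `h`. For `ψ` in the big cell,
`ψ = exp(ad y) γ exp(ad a)`, the vector `a + h` of `g₁ + ℝ h` is mapped to `h + y`; this shows that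
a certain endomorphism of `g × ℝ` depending on `ψ` is singular. By density it is singular for all
`ψ` in `Inn g`, in particular for `θ`, where it is regular unless `z = 0`. -/
theorem eq_zero_of_map_eq_sub_central {h z : g} (hh : ThreeGraded h) (hz : ∀ x : g, ⁅x, z⁆ = 0)
    {θ : (Module.End ℝ g)ˣ} (hθ : θ ∈ Inn (⊤ : LieSubalgebra ℝ g))
    (hθh : (θ : Module.End ℝ g) h = h - z) : z = 0 := by
  by_contra hne
  obtain ⟨μ, hμ⟩ : ∃ μ : Module.Dual ℝ g, μ z ≠ 0 := by
    by_contra! hcon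
    exact hne ((Module.forall_dual_apply_eq_zero_iff ℝ z).mp hcon)
  obtain ⟨δ, hδ, -⟩ := exists_autEnd_of_mem_Inn hθ
  have hδh : δ h = h - z := by rw [← hθh, hδ]; rfl
  have hδpos : ∀ x : g, ⁅h, x⁆ = x → ⁅h, δ x⁆ = δ x := fun x hx => by
    have h1 : ⁅z, δ x⁆ = 0 := by rw [← lie_skew, hz, neg_zero]
    rw [← sub_zero ⁅h, δ x⁆, ← h1, ← sub_lie, ← hδh, ← LieEquiv.map_lie, hx]
  let J : g × ℝ →ₗ[ℝ] g := (projPos h).coprod (LinearMap.id.smulRight h)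
  let K : g →ₗ[ℝ] g × ℝ := (projPos h).prod (μ ∘ₗ projZero h)
  let L : Module.End ℝ g →ₗ[ℝ] Module.End ℝ (g × ℝ) :=
    { toFun := fun ψ => K ∘ₗ ψ ∘ₗ J
      map_add' := fun a b => by rw [LinearMap.add_comp, LinearMap.comp_add]
      map_smul' := fun r a => by rw [LinearMap.smul_comp, LinearMap.comp_smul]; rfl }
  let C : Module.End ℝ (g × ℝ) :=
    (LinearMap.id - projPos h).prodMap (-(μ h) • LinearMap.id)
  have hT : ∀ ψ v s, (L ψ + C) (v, s) =
      (projPos h (ψ (projPos h v + s • h)) + (v - projPos h v),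
        μ (projZero h (ψ (projPos h v + s • h))) + -(μ h) * s) := fun ψ v s => rfl
  have hcell : ∀ ψ ∈ bigCell h, LinearMap.det (L ψ + C) = 0 := by
    rintro _ ⟨y, a, γ, hy, ha, hγ, rfl⟩
    by_contra hdet
    have hinj := (injective_iff_det_ne_zero _).mpr hdet
    have hah : ⁅a, h⁆ = -a := by rw [← lie_skew, ha]
    have hyh : ⁅y, h⁆ = y := by rw [← lie_skew, hy, neg_neg]
    have h1 : NormedSpace.exp (LieAlgebra.ad ℝ g a) (a + h) = h := by
      rw [exp_apply_of_sq, LieAlgebra.ad_apply, lie_add, lie_self, hah]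
      · module
      · simp [hah]
    have h2 : NormedSpace.exp (LieAlgebra.ad ℝ g y) h = h + y := by
      rw [exp_apply_of_sq, LieAlgebra.ad_apply, hyh]
      simp [hyh]
    have h3 : ((a, 1) : g × ℝ) = 0 := by
      apply hinj
      rw [map_zero, hT, projPos_of_pos ha, one_smul, Module.End.mul_apply, Module.End.mul_apply, h1,
        autEnd_apply, hγ, h2, map_add, map_add, projPos_of_zero (lie_self h), projPos_of_neg hy,
        projZero_of_zero (lie_self h), projZero_of_neg hy]
      simp
    exact one_ne_zero (congrArg Prod.snd h3)
  have hdet := eq_zero_of_vanishing hh (analyticOnNhd_det L C) hcell hθ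
  refine (injective_iff_det_ne_zero _).mp ?_ hdet
  rw [injective_iff_map_eq_zero]
  rintro ⟨v, s⟩ hv
  have h0 : ⁅h, h - z⁆ = 0 := by rw [lie_sub, hz, lie_self, sub_zero]
  have hp := hδpos _ (hh.lie_projPos v)
  rw [hT, map_add, map_smul, hθh, hδ, autEnd_apply, map_add, map_add, map_smul, map_smul,
    projPos_of_pos hp, projZero_of_pos hp, projPos_of_zero h0, projZero_of_zero h0, smul_zero,
    add_zero, zero_add, Prod.mk_eq_zero, map_smul, map_sub, smul_eq_mul] at hv
  have hs : s = 0 := by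
    have h1 : s * μ z = 0 := by linear_combination -hv.2
    exact (mul_eq_zero.mp h1).resolve_right hμ
  have hv1 : projPos h v = 0 := by
    have h1 := congrArg (projPos h) hv.1
    rw [map_add, map_sub, projPos_of_pos hp, projPos_of_pos (hh.lie_projPos v), sub_self, add_zero,
      map_zero, lieEquiv_apply_eq_zero_iff] at h1
    exact h1
  have hv2 : v = 0 := by simpa [hv1] using hv.1
  rw [hv2, hs]; rfl

/-- The rotation by `π` in the subgroup of `SL₂` generated by `e - f` reverses `⁅e, f⁆`. -/
theorem GradedTriple.exists_rotation {h e f : g} (t : GradedTriple h e f) :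
    ∃ j : g, NormedSpace.exp (LieAlgebra.ad ℝ g j) ⁅e, f⁆ = -⁅e, f⁆ := by
  refine ⟨(Real.pi / 2) • (e - f), exp_apply_eq_neg ?_⟩
  have h1 : ⁅e - f, ⁅e, f⁆⁆ = (-2 : ℝ) • (e + f) := by
    rw [sub_lie, t.lie_e_lie, t.lie_f_lie]; module
  have h2 : ⁅e - f, e + f⁆ = (2 : ℝ) • ⁅e, f⁆ := by
    rw [lie_add, sub_lie, sub_lie, lie_self, lie_self, ← lie_skew f e]; module
  simp only [LieAlgebra.ad_apply, smul_lie, lie_smul, h1, h2]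
  match_scalars
  ring

/-- A non-central symmetric element with a three-grading belongs to an `sl₂`-triple:
`2h = ⁅e, f⁆`. -/
theorem exists_gradedTriple_of_isSymmetric {h : g} (hh : ThreeGraded h) (hs : IsSymmetric h)
    (hne : ∃ x : g, ⁅h, x⁆ ≠ 0) : ∃ e f : g, GradedTriple h e f ∧ ⁅e, f⁆ = (2 : ℝ) • h := by
  obtain ⟨φ, hφ, hφh⟩ := hs
  obtain ⟨f, hf, hinj, hsurj⟩ := exists_bijective_sq hh hφ hφh
  have hf0 : f ≠ 0 := by
    rintro rfl
    obtain ⟨x, hx⟩ := hne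
    apply hx
    have h1 : projPos h x = 0 := hinj _ (hh.lie_projPos x) (by rw [zero_lie])
    have h2 : projNeg h x = 0 := by
      obtain ⟨y, -, hy⟩ := hsurj _ (hh.lie_projNeg x)
      rw [← hy, zero_lie]
    have h3 := proj_add h x
    rw [h1, h2, zero_add, add_zero] at h3
    rw [← h3, hh.lie_projZero]
  obtain ⟨e0, he0, hfe⟩ := hsurj ((-2 : ℝ) • f) (by rw [lie_smul, hf, smul_neg])
  obtain ⟨e, t', -⟩ := GradedTriple.complete hh.neg (e := f) (f := e0) (by rw [neg_lie, hf, neg_neg])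
    (by rw [neg_lie, he0]) (by rw [← lie_skew, hfe]; module) hf0
  have t : GradedTriple h e f := by simpa using t'.symm
  refine ⟨e, f, t, ?_⟩
  -- `z = ⁅e, f⁆ - 2h` is central, and `θ = φ⁻¹ ψ` moves `h` by `z`
  have hz : ∀ x : g, ⁅x, ⁅e, f⁆ - (2 : ℝ) • h⁆ = 0 := fun x => by
    rw [← lie_skew, sub_lie, t.lie_eq_of_bijective_sq hh hinj hsurj, smul_lie, sub_self, neg_zero]
  obtain ⟨j, hj⟩ := t.exists_rotation
  set z := ⁅e, f⁆ - (2 : ℝ) • h with hzdef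
  have hψ := expAdUnit_mem (LieSubalgebra.mem_top j)
  obtain ⟨δ, hδ, hδz⟩ := exists_autEnd_of_mem_Inn hφ
  have hφz : (φ : Module.End ℝ g) z = z := by rw [hδ]; exact hδz z hz
  have hψz : ((expAdUnit j : (Module.End ℝ g)ˣ) : Module.End ℝ g) z = z :=
    exp_apply_of_eq_zero (hz j)
  have hφinv : ∀ x y : g, (φ : Module.End ℝ g) x = y →
      ((φ⁻¹ : (Module.End ℝ g)ˣ) : Module.End ℝ g) y = x := by
    rintro x _ rfl
    rw [← Module.End.mul_apply, Units.inv_mul]; rfl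
  have hh' : h = (2⁻¹ : ℝ) • (⁅e, f⁆ - z) := by rw [hzdef]; module
  have hψh : ((expAdUnit j : (Module.End ℝ g)ˣ) : Module.End ℝ g) h = -h - z := by
    have h1 : ((expAdUnit j : (Module.End ℝ g)ˣ) : Module.End ℝ g) ⁅e, f⁆ = -⁅e, f⁆ := hj
    nth_rewrite 1 [hh']
    rw [map_smul, map_sub, h1, hψz, hzdef]
    module
  have hθh : ((φ⁻¹ * expAdUnit j : (Module.End ℝ g)ˣ) : Module.End ℝ g) h = h - z := by
    rw [Units.val_mul, Module.End.mul_apply, hψh, map_sub, hφinv z z hφz, hφinv h (-h) hφh]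
  have := eq_zero_of_map_eq_sub_central hh hz (mul_mem (inv_mem hφ) hψ) hθh
  exact sub_eq_zero.mp this

end Symmetric

/-! ### Weights of a graded `sl₂`-triple -/

section Weights

/-- Operators `E, F, H` satisfying the `sl₂`-relations, together with idempotents `P k` projecting
onto the weight spaces `ker (H - k)`, where only the weights `-2, …, 2` occur. -/
structure WeightData {A : Type*} [Ring A] [Algebra ℝ A] (E F H : A) (P : ℤ → A) : Prop where
  H_E : H * E = E * H + (2 : ℝ) • E
  H_F : H * F = F * H + (-2 : ℝ) • F
  E_F : E * F = H + F * E
  H_P : ∀ k, H * P k = (k : ℝ) • P k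
  P_H : ∀ k, P k * H = (k : ℝ) • P k
  sum_P : P (-2) + P (-1) + P 0 + P 1 + P 2 = 1

/-- An element annihilated by `X (X² - 1) (X² - 4)` is diagonalizable with eigenvalues in
`{-2, …, 2}`. -/
theorem exists_weight_projections {A : Type*} [Ring A] [Algebra ℝ A] {H : A}
    (h5 : H ^ 5 - (5 : ℝ) • H ^ 3 + (4 : ℝ) • H = 0) :
    ∃ P : ℤ → A, (∀ k, H * P k = (k : ℝ) • P k) ∧ (∀ k, P k * H = (k : ℝ) • P k) ∧
      P (-2) + P (-1) + P 0 + P 1 + P 2 = 1 := by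
  have e5 : H ^ 5 = (5 : ℝ) • H ^ 3 - (4 : ℝ) • H := by linear_combination (norm := module) h5
  have l1 : H * H = H ^ 2 := (sq H).symm
  have l2 : H * H ^ 2 = H ^ 3 := (pow_succ' H 2).symm
  have l3 : H * H ^ 3 = H ^ 4 := (pow_succ' H 3).symm
  have l4 : H * H ^ 4 = H ^ 5 := (pow_succ' H 4).symm
  have r2 : H ^ 2 * H = H ^ 3 := (pow_succ H 2).symm
  have r3 : H ^ 3 * H = H ^ 4 := (pow_succ H 3).symm
  have r4 : H ^ 4 * H = H ^ 5 := (pow_succ H 4).symm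
  -- the Lagrange interpolation polynomials for the nodes `-2, …, 2`
  refine ⟨fun k =>
    if k = 2 then (24⁻¹ : ℝ) • (H ^ 4 + (2 : ℝ) • H ^ 3 - H ^ 2 - (2 : ℝ) • H)
    else if k = 1 then (-6⁻¹ : ℝ) • (H ^ 4 + H ^ 3 - (4 : ℝ) • H ^ 2 - (4 : ℝ) • H)
    else if k = 0 then (4⁻¹ : ℝ) • (H ^ 4 - (5 : ℝ) • H ^ 2 + (4 : ℝ) • 1)
    else if k = -1 then (-6⁻¹ : ℝ) • (H ^ 4 - H ^ 3 - (4 : ℝ) • H ^ 2 + (4 : ℝ) • H)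
    else if k = -2 then (24⁻¹ : ℝ) • (H ^ 4 - (2 : ℝ) • H ^ 3 - H ^ 2 + (2 : ℝ) • H)
    else 0, ?_, ?_, ?_⟩
  · intro k
    dsimp only
    split_ifs with h h h h h
    all_goals
      first
      | subst h
        simp only [mul_smul_comm, mul_add, mul_sub, mul_one, l1, l2, l3, l4, e5]
        push_cast
        module
      | simp
  · intro k
    dsimp only
    split_ifs with h h h h h
    all_goals
      first
      | subst h
        simp only [smul_mul_assoc, add_mul, sub_mul, one_mul, l1, r2, r3, r4, e5]
        push_cast
        module
      | simp
  · norm_num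
    module

namespace WeightData

variable {A : Type*} [Ring A] [Algebra ℝ A] {E F H : A} {P : ℤ → A} (W : WeightData E F H P)
include W

/-- An operator of weight `m` maps the weight space of `k` to that of `k + m`. -/
theorem P_mul_P_eq_zero {X : A} {m : ℝ} (hX : H * X = X * H + m • X) {j k : ℤ}
    (hjk : (j : ℝ) - k - m ≠ 0) : P j * X * P k = 0 := by
  have h1 : P j * (H * X) * P k = (j : ℝ) • (P j * X * P k) := by
    rw [← mul_assoc, W.P_H, smul_mul_assoc, smul_mul_assoc]
  have h2 : P j * (X * H) * P k = (k : ℝ) • (P j * X * P k) := by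
    rw [← mul_assoc, mul_assoc _ H, W.H_P, mul_smul_comm]
  rw [hX, mul_add, add_mul, h2, mul_smul_comm, smul_mul_assoc] at h1
  have h3 : ((j : ℝ) - k - m) • (P j * X * P k) = 0 := by
    linear_combination (norm := module) -h1
  exact (smul_eq_zero.mp h3).resolve_left hjk

theorem weight_one : H * (1 : A) = 1 * H + (0 : ℝ) • 1 := by simp

theorem weight_EE : H * (E * E) = E * E * H + (4 : ℝ) • (E * E) := by
  rw [← mul_assoc, W.H_E, add_mul, mul_assoc E H E, W.H_E, mul_add, mul_smul_comm, smul_mul_assoc,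
    mul_assoc E E H]
  module

theorem weight_FF : H * (F * F) = F * F * H + (-4 : ℝ) • (F * F) := by
  rw [← mul_assoc, W.H_F, add_mul, mul_assoc F H F, W.H_F, mul_add, mul_smul_comm, smul_mul_assoc,
    mul_assoc F F H]
  module

/-- The decomposition of `X * P k` by the weight of its image. -/
theorem expand (X : A) (k : ℤ) : X * P k =
    P (-2) * X * P k + P (-1) * X * P k + P 0 * X * P k + P 1 * X * P k + P 2 * X * P k := by
  rw [← add_mul, ← add_mul, ← add_mul, ← add_mul, ← add_mul, ← add_mul, ← add_mul, ← add_mul,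
    W.sum_P, one_mul]

theorem P_mul_self (k : ℤ) (hk : k = 1 ∨ k = 2) : P k * P k = P k := by
  have h1 := W.expand 1 k
  have h0 : ∀ j : ℤ, (j : ℝ) - k - 0 ≠ 0 → P j * 1 * P k = 0 := fun j hj =>
    W.P_mul_P_eq_zero W.weight_one hj
  rcases hk with rfl | rfl
  · rw [h0 (-2) (by norm_num), h0 (-1) (by norm_num), h0 0 (by norm_num), h0 2 (by norm_num)] at h1
    simpa using h1.symm
  · rw [h0 (-2) (by norm_num), h0 (-1) (by norm_num), h0 0 (by norm_num), h0 1 (by norm_num)] at h1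
    simpa using h1.symm

theorem E_P2 : E * P 2 = 0 := by
  rw [W.expand]; repeat rw [W.P_mul_P_eq_zero W.H_E (by norm_num)]
  simp

theorem E_P1 : E * P 1 = 0 := by
  rw [W.expand]; repeat rw [W.P_mul_P_eq_zero W.H_E (by norm_num)]
  simp

theorem F_Pm2 : F * P (-2) = 0 := by
  rw [W.expand]; repeat rw [W.P_mul_P_eq_zero W.H_F (by norm_num)]
  simp

theorem F_Pm1 : F * P (-1) = 0 := by
  rw [W.expand]; repeat rw [W.P_mul_P_eq_zero W.H_F (by norm_num)]
  simp

theorem FF_P0 : F * F * P 0 = 0 := by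
  rw [W.expand]; repeat rw [W.P_mul_P_eq_zero W.weight_FF (by norm_num)]
  simp

theorem E_P0 : E * P 0 = P 2 * E * P 0 := by
  have h := W.expand E 0
  rwa [W.P_mul_P_eq_zero (j := -2) W.H_E (by norm_num), W.P_mul_P_eq_zero (j := -1) W.H_E (by norm_num),
    W.P_mul_P_eq_zero (j := 0) W.H_E (by norm_num), W.P_mul_P_eq_zero (j := 1) W.H_E (by norm_num),
    zero_add, zero_add, zero_add, zero_add] at h

theorem E_Pm1 : E * P (-1) = P 1 * E * P (-1) := by
  have h := W.expand E (-1)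
  rwa [W.P_mul_P_eq_zero (j := -2) W.H_E (by norm_num), W.P_mul_P_eq_zero (j := -1) W.H_E (by norm_num),
    W.P_mul_P_eq_zero (j := 0) W.H_E (by norm_num), W.P_mul_P_eq_zero (j := 2) W.H_E (by norm_num),
    zero_add, zero_add, zero_add, add_zero] at h

theorem EE_Pm2 : E * E * P (-2) = P 2 * (E * E) * P (-2) := by
  have h := W.expand (E * E) (-2)
  rwa [W.P_mul_P_eq_zero (j := -2) W.weight_EE (by norm_num),
    W.P_mul_P_eq_zero (j := -1) W.weight_EE (by norm_num),
    W.P_mul_P_eq_zero (j := 0) W.weight_EE (by norm_num),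
    W.P_mul_P_eq_zero (j := 1) W.weight_EE (by norm_num),
    zero_add, zero_add, zero_add, zero_add] at h

theorem EF_P1 : E * F * P 1 = P 1 := by
  rw [W.E_F, add_mul, W.H_P, mul_assoc, W.E_P1]; simp

theorem EF_P2 : E * F * P 2 = (2 : ℝ) • P 2 := by
  rw [W.E_F, add_mul, W.H_P, mul_assoc, W.E_P2]; simp

theorem EFF_P2 : E * (F * F) * P 2 = (2 : ℝ) • (F * P 2) := by
  have h1 : E * (F * F) * P 2 = H * F * P 2 + F * (E * F * P 2) := by
    rw [← mul_assoc, W.E_F, add_mul, add_mul, mul_assoc F E F, W.E_F]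
    simp only [mul_assoc, mul_add, add_mul]
  rw [h1, W.EF_P2, W.H_F, add_mul, mul_assoc, W.H_P, mul_smul_comm, mul_smul_comm, smul_mul_assoc]
  push_cast; module

theorem EEFF_P2 : E * E * (F * F) * P 2 = (4 : ℝ) • P 2 := by
  have h1 : E * E * (F * F) * P 2 = E * (E * (F * F) * P 2) := by simp only [mul_assoc]
  rw [h1, W.EFF_P2, mul_smul_comm, ← mul_assoc, W.EF_P2]; module

theorem FE_Pm2 : F * (E * E) * P (-2) = (2 : ℝ) • (E * P (-2)) := by
  have hFE : F * E = E * F - H := by rw [W.E_F]; abel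
  have h1 : F * E * P (-2) = (2 : ℝ) • P (-2) := by
    rw [hFE, sub_mul, mul_assoc, W.F_Pm2, W.H_P]; push_cast; simp
  have h2 : F * (E * E) * P (-2) = E * (F * E * P (-2)) - H * E * P (-2) := by
    rw [← mul_assoc, hFE, sub_mul, sub_mul]
    nth_rewrite 1 [mul_assoc E F E]
    rw [hFE]; simp only [mul_assoc]
  rw [h2, h1, W.H_E, add_mul, mul_assoc, W.H_P, mul_smul_comm, mul_smul_comm, smul_mul_assoc]
  push_cast; module

theorem FFE_P0 : F * F * E * P 0 = (2 : ℝ) • (F * P 0) := by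
  have hFE : F * E = E * F - H := by rw [W.E_F]; abel
  have h0 : H * P 0 = 0 := by rw [W.H_P]; simp
  have h1 : F * F * E * P 0 = E * (F * F * P 0) - H * F * P 0 - F * (H * P 0) := by
    rw [mul_assoc F F E, hFE, mul_sub, ← mul_assoc F E F, hFE]
    simp only [sub_mul, mul_assoc]
  rw [h1, W.FF_P0, h0, W.H_F, add_mul, mul_assoc, h0, smul_mul_assoc]
  simp

/-- The operator `E` in terms of its two- and three-dimensional isotypic parts. -/
theorem E_eq : E = P 1 * E + P 2 * E + (2⁻¹ : ℝ) • (F * P 2 * (E * E)) := by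
  suffices h : ∀ k : ℤ, k = -2 ∨ k = -1 ∨ k = 0 ∨ k = 1 ∨ k = 2 →
      E * P k = (P 1 * E + P 2 * E + (2⁻¹ : ℝ) • (F * P 2 * (E * E))) * P k by
    have hs : ∀ X : A, X = X * P (-2) + X * P (-1) + X * P 0 + X * P 1 + X * P 2 := fun X => by
      rw [← mul_add, ← mul_add, ← mul_add, ← mul_add, W.sum_P, mul_one]
    rw [hs (P 1 * E + P 2 * E + (2⁻¹ : ℝ) • (F * P 2 * (E * E))), ← h _ (by simp), ← h _ (by simp),
      ← h _ (by simp), ← h _ (by simp), ← h _ (by simp), ← hs]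
  intro k hk
  have h1 : F * P 2 * (E * E) * P k = F * (P 2 * (E * E) * P k) := by simp only [mul_assoc]
  rw [add_mul, add_mul, smul_mul_assoc, h1]
  rcases hk with rfl | rfl | rfl | rfl | rfl
  · rw [W.P_mul_P_eq_zero W.H_E (by norm_num), W.P_mul_P_eq_zero W.H_E (by norm_num), ← W.EE_Pm2,
      ← mul_assoc, W.FE_Pm2]
    module
  · rw [← W.E_Pm1, W.P_mul_P_eq_zero W.H_E (by norm_num),
      W.P_mul_P_eq_zero W.weight_EE (by norm_num)]
    simp
  · rw [← W.E_P0, W.P_mul_P_eq_zero W.H_E (by norm_num),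
      W.P_mul_P_eq_zero W.weight_EE (by norm_num)]
    simp
  · rw [W.E_P1, W.P_mul_P_eq_zero W.H_E (by norm_num), W.P_mul_P_eq_zero W.H_E (by norm_num),
      W.P_mul_P_eq_zero W.weight_EE (by norm_num)]
    simp
  · rw [W.E_P2, W.P_mul_P_eq_zero W.H_E (by norm_num), W.P_mul_P_eq_zero W.H_E (by norm_num),
      W.P_mul_P_eq_zero W.weight_EE (by norm_num)]
    simp

/-- The operator `F` in terms of its two- and three-dimensional isotypic parts. -/
theorem F_eq : F = F * P 1 + F * P 2 + (2⁻¹ : ℝ) • (F * F * P 2 * E) := by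
  suffices h : ∀ k : ℤ, k = -2 ∨ k = -1 ∨ k = 0 ∨ k = 1 ∨ k = 2 →
      F * P k = (F * P 1 + F * P 2 + (2⁻¹ : ℝ) • (F * F * P 2 * E)) * P k by
    have hs : ∀ X : A, X = X * P (-2) + X * P (-1) + X * P 0 + X * P 1 + X * P 2 := fun X => by
      rw [← mul_add, ← mul_add, ← mul_add, ← mul_add, W.sum_P, mul_one]
    rw [hs (F * P 1 + F * P 2 + (2⁻¹ : ℝ) • (F * F * P 2 * E)), ← h _ (by simp), ← h _ (by simp),
      ← h _ (by simp), ← h _ (by simp), ← h _ (by simp), ← hs]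
  intro k hk
  have h1 : F * F * P 2 * E * P k = F * F * (P 2 * E * P k) := by simp only [mul_assoc]
  have h0 : ∀ j l : ℤ, (j : ℝ) - l - 0 ≠ 0 → P j * P l = 0 := fun j l hjl => by
    simpa using W.P_mul_P_eq_zero W.weight_one hjl
  rw [add_mul, add_mul, smul_mul_assoc, h1, mul_assoc F, mul_assoc F (P 2)]
  rcases hk with rfl | rfl | rfl | rfl | rfl
  · rw [h0 _ _ (by norm_num), h0 _ _ (by norm_num), W.P_mul_P_eq_zero W.H_E (by norm_num), W.F_Pm2]
    simp
  · rw [h0 _ _ (by norm_num), h0 _ _ (by norm_num), W.P_mul_P_eq_zero W.H_E (by norm_num), W.F_Pm1]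
    simp
  · have h2 : F * F * (E * P 0) = (2 : ℝ) • (F * P 0) := by rw [← mul_assoc, W.FFE_P0]
    rw [h0 _ _ (by norm_num), h0 _ _ (by norm_num), ← W.E_P0, h2, mul_zero]
    module
  · rw [W.P_mul_self 1 (by simp), h0 _ _ (by norm_num), W.P_mul_P_eq_zero W.H_E (by norm_num)]
    simp
  · rw [W.P_mul_self 2 (by simp), h0 _ _ (by norm_num), W.P_mul_P_eq_zero W.H_E (by norm_num)]
    simp

end WeightData

variable {g : Type*} [LieRing g] [LieAlgebra ℝ g]

namespace GradedTriple

variable {h e f : g}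

/-- In degree `1` the weights of `⁅e, f⁆` are `0, 1, 2`. -/
theorem weight_pos (hh : ThreeGraded h) (t : GradedTriple h e f) {x : g} (hx : ⁅h, x⁆ = x) :
    ⁅⁅e, f⁆, ⁅⁅e, f⁆, ⁅⁅e, f⁆, x⁆⁆⁆ = (3 : ℝ) • ⁅⁅e, f⁆, ⁅⁅e, f⁆, x⁆⁆ - (2 : ℝ) • ⁅⁅e, f⁆, x⁆ := by
  have hsq : ∀ y : g, ⁅h, y⁆ = y → ⁅e, ⁅e, ⁅f, ⁅f, y⁆⁆⁆⁆ =
      (2 : ℝ) • ⁅⁅e, f⁆, ⁅⁅e, f⁆, y⁆⁆ - (2 : ℝ) • ⁅⁅e, f⁆, y⁆ := by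
    intro y hy
    have hey : ⁅e, y⁆ = 0 := hh.lie_pos_pos t.lie_e hy
    have heHy : ⁅e, ⁅⁅e, f⁆, y⁆⁆ = 0 := hh.lie_pos_pos t.lie_e (lie_zero_pos t.lie_h hy)
    rw [leibniz_lie e f, t.H_F, leibniz_lie e f y, hey, lie_zero, add_zero, lie_add, lie_sub,
      lie_smul, leibniz_lie e f, leibniz_lie e f y, heHy, hey, lie_zero, add_zero, add_zero]
    module
  have hfff : ⁅f, ⁅f, ⁅f, x⁆⁆⁆ = 0 :=
    hh.lie_neg_neg t.lie_f (lie_neg_zero t.lie_f (lie_neg_pos t.lie_f hx))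
  have hex : ⁅e, x⁆ = 0 := hh.lie_pos_pos t.lie_e hx
  have h3 : ⁅e, ⁅f, ⁅f, ⁅f, x⁆⁆⁆⁆ = 0 := by rw [hfff, lie_zero]
  rw [leibniz_lie e f, leibniz_lie e f, leibniz_lie e f, hex, lie_zero, add_zero, t.H_F, t.H_F] at h3
  simp only [lie_add, lie_sub, lie_smul] at h3
  have h4 : ⁅f, ⁅f, ⁅⁅e, f⁆, x⁆ - (2 : ℝ) • x⁆⁆ = 0 := by
    rw [lie_sub, lie_sub, lie_smul, lie_smul]
    linear_combination (norm := module) (3⁻¹ : ℝ) • h3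
  have h5 := hsq (⁅⁅e, f⁆, x⁆ - (2 : ℝ) • x)
    (by rw [lie_sub, lie_smul, lie_zero_pos t.lie_h hx, hx])
  rw [h4, lie_zero, lie_zero] at h5
  simp only [lie_sub, lie_smul] at h5
  linear_combination (norm := module) (-2⁻¹ : ℝ) • h5

/-- In degree `-1` the weights of `⁅e, f⁆` are `0, -1, -2`. -/
theorem weight_neg (hh : ThreeGraded h) (t : GradedTriple h e f) {x : g} (hx : ⁅h, x⁆ = -x) :
    ⁅⁅e, f⁆, ⁅⁅e, f⁆, ⁅⁅e, f⁆, x⁆⁆⁆ =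
      (-3 : ℝ) • ⁅⁅e, f⁆, ⁅⁅e, f⁆, x⁆⁆ - (2 : ℝ) • ⁅⁅e, f⁆, x⁆ := by
  have h1 := weight_pos hh.neg t.symm (x := x) (by rw [neg_lie, hx, neg_neg])
  rw [← lie_skew f e] at h1
  simp only [neg_lie, lie_neg, neg_neg] at h1
  linear_combination (norm := module) -h1

/-- On the centralizer of `h` the element `⁅e, f⁆` has weights in `{-1, 0, 1}`. With `K = FE` and
`J = EF` this follows from `K² = K(H + 2)`, `J² = J(2 - H)` and `J = K + H`. -/
theorem weight_zero (hh : ThreeGraded h) (t : GradedTriple h e f) {w : g} (hw : ⁅h, w⁆ = 0) :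
    ⁅⁅e, f⁆, ⁅⁅e, f⁆, ⁅⁅e, f⁆, w⁆⁆⁆ = ⁅⁅e, f⁆, w⁆ := by
  have hJ : ∀ w : g, ⁅e, ⁅f, w⁆⁆ = ⁅⁅e, f⁆, w⁆ + ⁅f, ⁅e, w⁆⁆ := leibniz_lie e f
  have hKH : ∀ w : g, ⁅⁅e, f⁆, ⁅f, ⁅e, w⁆⁆⁆ = ⁅f, ⁅e, ⁅⁅e, f⁆, w⁆⁆⁆ := fun w => by
    rw [t.H_F, t.H_E, lie_add, lie_smul]; module
  have hKK : ∀ w : g, ⁅h, w⁆ = 0 → ⁅f, ⁅e, ⁅f, ⁅e, w⁆⁆⁆⁆ =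
      ⁅f, ⁅e, ⁅⁅e, f⁆, w⁆⁆⁆ + (2 : ℝ) • ⁅f, ⁅e, w⁆⁆ := fun w hw => by
    have h1 : ⁅e, ⁅e, w⁆⁆ = 0 := hh.lie_pos_pos t.lie_e (lie_pos_zero t.lie_e hw)
    rw [hJ, h1, lie_zero, add_zero, t.H_E, lie_add, lie_smul]
  have hJJ : ∀ w : g, ⁅h, w⁆ = 0 → ⁅e, ⁅f, ⁅e, ⁅f, w⁆⁆⁆⁆ =
      (2 : ℝ) • ⁅e, ⁅f, w⁆⁆ - ⁅e, ⁅f, ⁅⁅e, f⁆, w⁆⁆⁆ := fun w hw => by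
    have h1 : ⁅f, ⁅f, w⁆⁆ = 0 := hh.lie_neg_neg t.lie_f (lie_neg_zero t.lie_f hw)
    have h2 : ⁅f, ⁅e, ⁅f, w⁆⁆⁆ = (2 : ℝ) • ⁅f, w⁆ - ⁅f, ⁅⁅e, f⁆, w⁆⁆ := by
      have h3 := hJ ⁅f, w⁆
      rw [h1, lie_zero, t.H_F] at h3
      linear_combination (norm := module) -h3
    rw [h2, lie_sub, lie_smul]
  have hv : ∀ w : g, ⁅h, w⁆ = 0 → (2 : ℝ) • ⁅f, ⁅e, ⁅⁅e, f⁆, w⁆⁆⁆ =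
      ⁅⁅e, f⁆, w⁆ - ⁅⁅e, f⁆, ⁅⁅e, f⁆, w⁆⁆ := fun w hw => by
    have h1 := hJJ w hw
    rw [hJ, hJ, hJ, lie_add, lie_add, lie_add, hKK w hw, hKH] at h1
    linear_combination (norm := module) (2⁻¹ : ℝ) • h1
  have hHw : ⁅h, ⁅⁅e, f⁆, w⁆⁆ = 0 := lie_zero_zero t.lie_h hw
  have h1 := hv w hw
  have h2 := hv _ hHw
  have h3 := hKK _ hHw
  have h4 : (2 : ℝ) • ⁅f, ⁅e, ⁅f, ⁅e, ⁅⁅e, f⁆, w⁆⁆⁆⁆⁆ =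
      ⁅f, ⁅e, ⁅⁅e, f⁆, w⁆⁆⁆ - ⁅f, ⁅e, ⁅⁅e, f⁆, ⁅⁅e, f⁆, w⁆⁆⁆⁆ := by
    rw [← lie_smul, ← lie_smul, h1, lie_sub, lie_sub]
  linear_combination (norm := module) h2 + h1 - (2 / 3 : ℝ) • h4 + (4 / 3 : ℝ) • h3

/-- The operators `ad e`, `ad f`, `ad ⁅e, f⁆` of a graded `sl₂`-triple have weights `-2, …, 2`. -/
theorem exists_weightData (hh : ThreeGraded h) (t : GradedTriple h e f) :
    ∃ P : ℤ → Module.End ℝ g, WeightData (LieAlgebra.ad ℝ g e) (LieAlgebra.ad ℝ g f)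
      (LieAlgebra.ad ℝ g ⁅e, f⁆) P := by
  have h5 : (LieAlgebra.ad ℝ g ⁅e, f⁆) ^ 5 - (5 : ℝ) • (LieAlgebra.ad ℝ g ⁅e, f⁆) ^ 3
      + (4 : ℝ) • LieAlgebra.ad ℝ g ⁅e, f⁆ = 0 := by
    ext x
    change ⁅⁅e, f⁆, ⁅⁅e, f⁆, ⁅⁅e, f⁆, ⁅⁅e, f⁆, ⁅⁅e, f⁆, x⁆⁆⁆⁆⁆
      - (5 : ℝ) • ⁅⁅e, f⁆, ⁅⁅e, f⁆, ⁅⁅e, f⁆, x⁆⁆⁆ + (4 : ℝ) • ⁅⁅e, f⁆, x⁆ = 0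
    refine hh.induction (p := fun x => ⁅⁅e, f⁆, ⁅⁅e, f⁆, ⁅⁅e, f⁆, ⁅⁅e, f⁆, ⁅⁅e, f⁆, x⁆⁆⁆⁆⁆
      - (5 : ℝ) • ⁅⁅e, f⁆, ⁅⁅e, f⁆, ⁅⁅e, f⁆, x⁆⁆⁆ + (4 : ℝ) • ⁅⁅e, f⁆, x⁆ = 0) ?_ ?_ ?_ ?_ x
    · intro x y hx hy
      simp only [lie_add]
      linear_combination (norm := module) hx + hy
    · intro x hx
      simp only [weight_pos hh t hx, lie_sub, lie_smul]
      module
    · intro x hx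
      have h1 := weight_zero hh t hx
      simp only [h1]
      module
    · intro x hx
      simp only [weight_neg hh t hx, lie_sub, lie_smul]
      module
  obtain ⟨P, h1, h2, h3⟩ := exists_weight_projections h5
  refine ⟨P, ⟨?_, ?_, ?_, h1, h2, h3⟩⟩
  · ext x
    exact t.H_E x
  · ext x
    refine (t.H_F x).trans ?_
    change _ = ⁅f, ⁅⁅e, f⁆, x⁆⁆ + (-2 : ℝ) • ⁅f, x⁆
    module
  · ext x
    exact leibniz_lie e f x

end GradedTriple

end Weights

/-! ### Representations of `SL₂(ℝ)` by operators of an `sl₂`-triple -/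

section Corner

variable {A : Type*} [Ring A] [Algebra ℝ A] {n m : Type*} [Fintype n] [Fintype m]

/-- The linear map from matrices sending the matrix unit `(i, j)` to `u i * P * w j`. -/
def cornerMap (u w : n → A) (P : A) : Matrix n n ℝ →ₗ[ℝ] A where
  toFun M := ∑ i, ∑ j, M i j • (u i * P * w j)
  map_add' M N := by simp only [Matrix.add_apply, add_smul, Finset.sum_add_distrib]
  map_smul' r M := by
    simp only [Matrix.smul_apply, smul_eq_mul, mul_smul, Finset.smul_sum, RingHom.id_apply]

theorem cornerMap_apply (u w : n → A) (P : A) (M : Matrix n n ℝ) :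
    cornerMap u w P M = ∑ i, ∑ j, M i j • (u i * P * w j) := rfl

theorem cornerMap_mul_cornerMap_of_eq_zero {u w : n → A} {u' w' : m → A} {P P' : A}
    (h : ∀ j i, P * w j * u' i * P' = 0) (M : Matrix n n ℝ) (N : Matrix m m ℝ) :
    cornerMap u w P M * cornerMap u' w' P' N = 0 := by
  simp only [cornerMap_apply, Finset.sum_mul, Finset.mul_sum]
  refine Finset.sum_eq_zero fun i _ => Finset.sum_eq_zero fun j _ =>
    Finset.sum_eq_zero fun k _ => Finset.sum_eq_zero fun l _ => ?_
  have h1 : u k * P * w l * (u' i * P' * w' j) = u k * (P * w l * u' i * P') * w' j := by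
    simp only [mul_assoc]
  rw [smul_mul_smul_comm, h1, h, mul_zero, zero_mul, smul_zero]

/-- The elements `u i * P * w j` multiply like matrix units if `w` is dual to `u`. -/
theorem cornerMap_mul [DecidableEq n] {u w : n → A} {P : A}
    (h : ∀ j i, P * w j * u i * P = if j = i then P else 0) (M N : Matrix n n ℝ) :
    cornerMap u w P M * cornerMap u w P N = cornerMap u w P (M * N) := by
  have h1 : ∀ i j k l, u i * P * w j * (u k * P * w l) = if j = k then u i * P * w l else 0 := by
    intro i j k l
    have h2 : u i * P * w j * (u k * P * w l) = u i * (P * w j * u k * P) * w l := by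
      simp only [mul_assoc]
    rw [h2, h]
    split_ifs <;> simp
  simp only [cornerMap_apply, Finset.sum_mul_sum, smul_mul_smul_comm, h1, smul_ite, smul_zero,
    Matrix.mul_apply, Finset.sum_smul]
  refine Finset.sum_congr rfl fun i _ => ?_
  have h3 : ∀ k, (∑ x, ∑ x_1, if x = k then (M i x * N k x_1) • (u i * P * w x_1) else 0) =
      ∑ x_1, (M i k * N k x_1) • (u i * P * w x_1) := fun k => by
    rw [Finset.sum_comm]
    exact Finset.sum_congr rfl fun l _ => by rw [Finset.sum_ite_eq' Finset.univ k]; simp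
  rw [Finset.sum_congr rfl fun k _ => h3 k, Finset.sum_comm]

/-- The entries of a matrix are recovered from its image. -/
theorem corner_coordinate [DecidableEq n] {u w : n → A} {P : A}
    (h : ∀ j i, P * w j * u i * P = if j = i then P else 0) (M : Matrix n n ℝ) (i j : n) :
    P * w i * cornerMap u w P M * u j * P = M i j • P := by
  have h1 : ∀ k l, P * w i * (u k * P * w l) * u j * P =
      if i = k then (if l = j then P else 0) else 0 := by
    intro k l
    have h2 : P * w i * (u k * P * w l) * u j * P = (P * w i * u k * P) * (w l * u j * P) := by
      simp only [mul_assoc]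
    rw [h2, h]
    split_ifs with h3 h4
    · subst h4; simpa [mul_assoc] using h l l
    · have := h l j
      rw [if_neg h4] at this
      simpa [mul_assoc] using this
    · simp
  simp only [cornerMap_apply, Finset.mul_sum, Finset.sum_mul, mul_smul_comm, smul_mul_assoc, h1]
  simp [Finset.sum_ite_eq, Finset.sum_ite_eq']

end Corner

/-- The symmetric square of a `2 × 2` matrix: its action on `x²`, `2xy`, `y²`. -/
def symSq (M : Matrix (Fin 2) (Fin 2) ℝ) : Matrix (Fin 3) (Fin 3) ℝ :=
  !![M 0 0 ^ 2, 2 * (M 0 0 * M 0 1), M 0 1 ^ 2;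
    M 0 0 * M 1 0, M 0 0 * M 1 1 + M 0 1 * M 1 0, M 0 1 * M 1 1;
    M 1 0 ^ 2, 2 * (M 1 0 * M 1 1), M 1 1 ^ 2]

/-- The derivative of `symSq` at the identity. -/
def symSqDeriv (X : Matrix (Fin 2) (Fin 2) ℝ) : Matrix (Fin 3) (Fin 3) ℝ :=
  !![2 * X 0 0, 2 * X 0 1, 0; X 1 0, X 0 0 + X 1 1, X 0 1; 0, 2 * X 1 0, 2 * X 1 1]

theorem symSq_mul (M N : Matrix (Fin 2) (Fin 2) ℝ) : symSq (M * N) = symSq M * symSq N := by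
  ext i j
  fin_cases i <;> fin_cases j <;>
    simp [symSq, Matrix.mul_apply, Fin.sum_univ_two, Fin.sum_univ_three] <;> ring

theorem continuous_symSq : Continuous symSq := by
  refine continuous_matrix fun i j => ?_
  fin_cases i <;> fin_cases j <;> simp [symSq] <;> fun_prop

theorem symSq_one : symSq 1 = 1 := by
  ext i j
  fin_cases i <;> fin_cases j <;> simp [symSq]

namespace WeightData

section Algebra

variable {A : Type*} [Ring A] [Algebra ℝ A] {E F H : A} {P : ℤ → A}

/-- Basis vectors of the two-dimensional irreducible representation, over the highest weight. -/
def lower₂ (F : A) : Fin 2 → A := ![1, F]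
/-- Dual to `lower₂`: `P 1 * raise₂ E j * lower₂ F i * P 1` is `P 1` if `j = i`, and `0` otherwise. -/
def raise₂ (E : A) : Fin 2 → A := ![1, E]
/-- Basis vectors of the three-dimensional irreducible representation, over the highest weight. -/
noncomputable def lower₃ (F : A) : Fin 3 → A := ![1, F, (2⁻¹ : ℝ) • (F * F)]
/-- Dual to `lower₃`: `P 2 * raise₃ E j * lower₃ F i * P 2` is `P 2` if `j = i`, and `0` otherwise. -/
noncomputable def raise₃ (E : A) : Fin 3 → A := ![1, (2⁻¹ : ℝ) • E, (2⁻¹ : ℝ) • (E * E)]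

/-- The action of `2 × 2` matrices on the sum of the two-dimensional irreducible submodules. -/
noncomputable def rep₂ (E F : A) (P : ℤ → A) : Matrix (Fin 2) (Fin 2) ℝ →ₗ[ℝ] A :=
  cornerMap (lower₂ F) (raise₂ E) (P 1)

/-- The action of `3 × 3` matrices on the sum of the three-dimensional irreducible submodules. -/
noncomputable def rep₃ (E F : A) (P : ℤ → A) : Matrix (Fin 3) (Fin 3) ℝ →ₗ[ℝ] A :=
  cornerMap (lower₃ F) (raise₃ E) (P 2)

theorem weight_mul {X Y : A} {m n : ℝ} (hX : H * X = X * H + m • X) (hY : H * Y = Y * H + n • Y) :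
    H * (X * Y) = X * Y * H + (m + n) • (X * Y) := by
  rw [← mul_assoc, hX, add_mul, mul_assoc, hY, mul_add, mul_smul_comm, smul_mul_assoc, mul_assoc]
  module

theorem weight_smul {X : A} {m : ℝ} (r : ℝ) (hX : H * X = X * H + m • X) :
    H * (r • X) = r • X * H + m • (r • X) := by
  rw [mul_smul_comm, hX, smul_mul_assoc]
  module

variable (W : WeightData E F H P)
include W

theorem weight_lower₂ (i : Fin 2) :
    H * lower₂ F i = lower₂ F i * H + ((-2 * i.val : ℤ) : ℝ) • lower₂ F i := by
  fin_cases i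
  · simp [lower₂]
  · simpa [lower₂] using W.H_F

theorem weight_raise₂ (i : Fin 2) :
    H * raise₂ E i = raise₂ E i * H + ((2 * i.val : ℤ) : ℝ) • raise₂ E i := by
  fin_cases i
  · simp [raise₂]
  · simpa [raise₂] using W.H_E

theorem weight_lower₃ (i : Fin 3) :
    H * lower₃ F i = lower₃ F i * H + ((-2 * i.val : ℤ) : ℝ) • lower₃ F i := by
  fin_cases i
  · simp [lower₃]
  · simpa [lower₃] using W.H_F
  · refine (weight_smul _ W.weight_FF).trans ?_
    simp [lower₃]

theorem weight_raise₃ (i : Fin 3) :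
    H * raise₃ E i = raise₃ E i * H + ((2 * i.val : ℤ) : ℝ) • raise₃ E i := by
  fin_cases i
  · simp [raise₃]
  · refine (weight_smul _ W.H_E).trans ?_
    simp [raise₃]
  · refine (weight_smul _ W.weight_EE).trans ?_
    simp [raise₃]

theorem corner_eq_zero {X Y : A} {m n p q : ℤ} (hX : H * X = X * H + (m : ℝ) • X)
    (hY : H * Y = Y * H + (n : ℝ) • Y) (h : p - q - (m + n) ≠ 0) : P p * X * Y * P q = 0 := by
  rw [mul_assoc (P p)]
  refine W.P_mul_P_eq_zero (weight_mul hX hY) ?_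
  exact_mod_cast h

theorem corner₂ (j i : Fin 2) :
    P 1 * raise₂ E j * lower₂ F i * P 1 = if j = i then P 1 else 0 := by
  split_ifs with h
  · subst h
    fin_cases j
    · simp [raise₂, lower₂, W.P_mul_self 1 (by simp)]
    · simp only [raise₂, lower₂]
      simp only [Fin.mk_one, Matrix.cons_val_one, Matrix.cons_val_fin_one]
      rw [mul_assoc, mul_assoc, ← mul_assoc E, W.EF_P1, W.P_mul_self 1 (by simp)]
  · exact W.corner_eq_zero (W.weight_raise₂ j) (W.weight_lower₂ i) (by omega)

theorem corner₃ (j i : Fin 3) :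
    P 2 * raise₃ E j * lower₃ F i * P 2 = if j = i then P 2 else 0 := by
  split_ifs with h
  · subst h
    have h2 := W.P_mul_self 2 (by simp)
    fin_cases j
    · simp [raise₃, lower₃, h2]
    · change P 2 * ((2⁻¹ : ℝ) • E) * F * P 2 = P 2
      rw [mul_smul_comm, smul_mul_assoc, smul_mul_assoc, mul_assoc, mul_assoc, ← mul_assoc E,
        W.EF_P2, mul_smul_comm, h2, smul_smul]
      norm_num
    · change P 2 * ((2⁻¹ : ℝ) • (E * E)) * ((2⁻¹ : ℝ) • (F * F)) * P 2 = P 2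
      simp only [mul_smul_comm, smul_mul_assoc]
      rw [mul_assoc (P 2), mul_assoc (P 2), W.EEFF_P2, mul_smul_comm, h2]
      module
  · exact W.corner_eq_zero (W.weight_raise₃ j) (W.weight_lower₃ i) (by omega)

theorem rep₂_mul (M N : Matrix (Fin 2) (Fin 2) ℝ) :
    rep₂ E F P M * rep₂ E F P N = rep₂ E F P (M * N) :=
  cornerMap_mul W.corner₂ M N

theorem rep₃_mul (M N : Matrix (Fin 3) (Fin 3) ℝ) :
    rep₃ E F P M * rep₃ E F P N = rep₃ E F P (M * N) :=
  cornerMap_mul W.corner₃ M N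

theorem rep₂_mul_rep₃ (M : Matrix (Fin 2) (Fin 2) ℝ) (N : Matrix (Fin 3) (Fin 3) ℝ) :
    rep₂ E F P M * rep₃ E F P N = 0 :=
  cornerMap_mul_cornerMap_of_eq_zero (fun j i =>
    W.corner_eq_zero (W.weight_raise₂ j) (W.weight_lower₃ i) (by omega)) M N

theorem rep₃_mul_rep₂ (M : Matrix (Fin 3) (Fin 3) ℝ) (N : Matrix (Fin 2) (Fin 2) ℝ) :
    rep₃ E F P M * rep₂ E F P N = 0 :=
  cornerMap_mul_cornerMap_of_eq_zero (fun j i =>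
    W.corner_eq_zero (W.weight_raise₃ j) (W.weight_lower₂ i) (by omega)) M N

/-- The infinitesimal action of a traceless matrix is the corresponding combination of the
operators of the triple. -/
theorem rep_deriv (b c d : ℝ) :
    rep₂ E F P !![d, b; c, -d] + rep₃ E F P (symSqDeriv !![d, b; c, -d]) =
      b • E + c • F + d • H := by
  have hE : rep₂ E F P !![0, 1; 0, 0] + rep₃ E F P (symSqDeriv !![0, 1; 0, 0]) = E := by
    refine Eq.trans ?_ W.E_eq.symm
    simp [rep₂, rep₃, cornerMap_apply, symSqDeriv, Fin.sum_univ_two, Fin.sum_univ_three, lower₂,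
      raise₂, lower₃, raise₃, smul_smul, add_assoc]
  have hF : rep₂ E F P !![0, 0; 1, 0] + rep₃ E F P (symSqDeriv !![0, 0; 1, 0]) = F := by
    refine Eq.trans ?_ W.F_eq.symm
    simp [rep₂, rep₃, cornerMap_apply, symSqDeriv, Fin.sum_univ_two, Fin.sum_univ_three, lower₂,
      raise₂, lower₃, raise₃, smul_smul, add_assoc]
  have hH : rep₂ E F P !![1, 0; 0, -1] + rep₃ E F P (symSqDeriv !![1, 0; 0, -1]) = H := by
    have h1 : H = E * F - F * E := by rw [W.E_F]; abel
    have h2 : E * F - F * E = (rep₂ E F P !![0, 1; 0, 0] + rep₃ E F P (symSqDeriv !![0, 1; 0, 0])) *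
      (rep₂ E F P !![0, 0; 1, 0] + rep₃ E F P (symSqDeriv !![0, 0; 1, 0])) -
      (rep₂ E F P !![0, 0; 1, 0] + rep₃ E F P (symSqDeriv !![0, 0; 1, 0])) *
      (rep₂ E F P !![0, 1; 0, 0] + rep₃ E F P (symSqDeriv !![0, 1; 0, 0])) := by rw [hE, hF]
    rw [h1, h2]
    simp only [add_mul, mul_add, W.rep₂_mul, W.rep₃_mul, W.rep₂_mul_rep₃, W.rep₃_mul_rep₂, add_zero,
      zero_add]
    rw [add_sub_add_comm, ← map_sub, ← map_sub]
    congr 2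
    · ext i j
      fin_cases i <;> fin_cases j <;> simp
    · ext i j
      fin_cases i <;> fin_cases j <;>
        simp [symSqDeriv]
  have hX : !![d, b; c, -d] =
      b • !![0, 1; 0, 0] + c • !![0, 0; 1, 0] + d • (!![1, 0; 0, -1] : Matrix (Fin 2) (Fin 2) ℝ) := by
    ext i j
    fin_cases i <;> fin_cases j <;> simp
  have hX' : symSqDeriv !![d, b; c, -d] = b • symSqDeriv !![0, 1; 0, 0] +
      c • symSqDeriv !![0, 0; 1, 0] + d • symSqDeriv !![1, 0; 0, -1] := by
    ext i j
    fin_cases i <;> fin_cases j <;> simp [symSqDeriv] <;> ring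
  rw [hX', hX]
  simp only [map_add, map_smul]
  linear_combination (norm := module) b • hE + c • hF + d • hH

/-- The action of the multiplicative monoid of `2 × 2` matrices: the identity on the trivial submodules, the standard
action on the two-dimensional ones, and the symmetric square on the three-dimensional ones. -/
noncomputable def action : Matrix (Fin 2) (Fin 2) ℝ →* A where
  toFun M := rep₂ E F P M + rep₃ E F P (symSq M) + (1 - rep₂ E F P 1 - rep₃ E F P 1)
  map_one' := by rw [symSq_one]; abel
  map_mul' M N := by
    rw [symSq_mul]
    simp only [add_mul, mul_add, sub_mul, mul_sub, one_mul, mul_one, W.rep₂_mul, W.rep₃_mul,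
      W.rep₂_mul_rep₃, W.rep₃_mul_rep₂]
    abel

theorem action_apply (M : Matrix (Fin 2) (Fin 2) ℝ) : W.action M =
    rep₂ E F P M + rep₃ E F P (symSq M) + (1 - rep₂ E F P 1 - rep₃ E F P 1) := rfl

end Algebra

end WeightData

/-! ### One-parameter groups -/

section OneParameter

/-- A one-parameter group is determined by its derivative at `0`. -/
theorem eq_exp_of_hasDerivAt {A : Type*} [NormedRing A] [NormedAlgebra ℝ A] [CompleteSpace A]
    {G : ℝ → A} {Y : A} (h0 : G 0 = 1) (hadd : ∀ s t, G (s + t) = G s * G t)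
    (hd : HasDerivAt G Y 0) : G 1 = NormedSpace.exp Y := by
  have hG : ∀ t, HasDerivAt G (G t * Y) t := by
    intro t
    have h1 : HasDerivAt (fun s => G t * G (s - t)) (G t * Y) t := by
      refine HasDerivAt.const_mul (G t) ?_
      have h2 : HasDerivAt G Y (t - t) := by rwa [sub_self]
      exact h2.comp_sub_const t t
    refine h1.congr_of_eventuallyEq (Filter.Eventually.of_forall fun s => ?_)
    change G s = G t * G (s - t)
    rw [← hadd, add_sub_cancel]
  have hK : ∀ t, HasDerivAt (fun t => G t * NormedSpace.exp (t • (-Y))) 0 t := by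
    intro t
    have h1 := (hG t).mul (hasDerivAt_exp_smul_const' (-Y) t)
    refine h1.congr_deriv ?_
    rw [neg_mul, mul_neg, mul_assoc, add_neg_cancel]
  have h1 := is_const_of_deriv_eq_zero (fun t => (hK t).differentiableAt) (fun t => (hK t).deriv) 1 0
  simp only [one_smul, zero_smul, NormedSpace.exp_zero, h0, mul_one] at h1
  let := NormedAlgebra.restrictScalars ℚ ℝ A
  have h2 : NormedSpace.exp (-Y) * NormedSpace.exp Y = 1 := by
    rw [← NormedSpace.exp_add_of_commute (Commute.neg_left (Commute.refl Y)), neg_add_cancel,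
      NormedSpace.exp_zero]
  rw [← mul_one (G 1), ← h2, ← mul_assoc, h1, one_mul]

attribute [local instance] Matrix.linftyOpNormedRing Matrix.linftyOpNormedAlgebra

theorem hasDerivAt_matrix_exp (X : Matrix (Fin 2) (Fin 2) ℝ) (i j : Fin 2) :
    HasDerivAt (fun t : ℝ => NormedSpace.exp (t • X) i j) (X i j) 0 := by
  have h1 := hasDerivAt_exp_smul_const' (𝕂 := ℝ) X 0
  rw [zero_smul, NormedSpace.exp_zero, mul_one] at h1
  exact ((LinearMap.toContinuousLinearMap (Matrix.entryLinearMap ℝ ℝ i j)).hasFDerivAt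
    (x := NormedSpace.exp ((0 : ℝ) • X))).comp_hasDerivAt 0 h1

theorem matrix_exp_add (X : Matrix (Fin 2) (Fin 2) ℝ) (s t : ℝ) :
    NormedSpace.exp ((s + t) • X) = NormedSpace.exp (s • X) * NormedSpace.exp (t • X) := by
  rw [add_smul]
  exact Matrix.exp_add_of_commute _ _ (((Commute.refl X).smul_left s).smul_right t)

/-- The determinant of `exp (tX)` is a one-parameter group with derivative `tr X = 0` at `0`. -/
theorem det_matrix_exp (b c d : ℝ) :
    (NormedSpace.exp !![d, b; c, -d] : Matrix (Fin 2) (Fin 2) ℝ).det = 1 := by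
  set X : Matrix (Fin 2) (Fin 2) ℝ := !![d, b; c, -d] with hX
  have h := eq_exp_of_hasDerivAt (G := fun t : ℝ => (NormedSpace.exp (t • X)).det) (Y := 0)
    (by simp) (fun s t => by rw [matrix_exp_add, Matrix.det_mul]) ?_
  · simpa using h
  · simp only [Matrix.det_fin_two]
    have h1 := ((hasDerivAt_matrix_exp X 0 0).mul (hasDerivAt_matrix_exp X 1 1)).sub
      ((hasDerivAt_matrix_exp X 0 1).mul (hasDerivAt_matrix_exp X 1 0))
    refine h1.congr_deriv ?_
    simp [hX]

theorem hasDerivAt_cornerMap {A : Type*} [NormedRing A] [NormedAlgebra ℝ A] {n : Type*} [Fintype n]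
    (u w : n → A) (P : A) {N : ℝ → Matrix n n ℝ} {N' : Matrix n n ℝ}
    (hN : ∀ i j, HasDerivAt (fun t => N t i j) (N' i j) 0) :
    HasDerivAt (fun t => cornerMap u w P (N t)) (cornerMap u w P N') 0 := by
  simp only [cornerMap_apply]
  exact HasDerivAt.fun_sum fun i _ => HasDerivAt.fun_sum fun j _ => (hN i j).smul_const _

end OneParameter

namespace WeightData

section Normed

variable {A : Type*} [NormedRing A] [NormedAlgebra ℝ A] {E F H : A} {P : ℤ → A}

attribute [local instance] Matrix.linftyOpNormedRing Matrix.linftyOpNormedAlgebra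

/-- Both sides are the values at `1` of one-parameter groups with the same derivative at `0`. -/
theorem action_exp [CompleteSpace A] (W : WeightData E F H P) (b c d : ℝ) :
    W.action (NormedSpace.exp !![d, b; c, -d]) = NormedSpace.exp (b • E + c • F + d • H) := by
  set X : Matrix (Fin 2) (Fin 2) ℝ := !![d, b; c, -d] with hX
  have h := eq_exp_of_hasDerivAt (G := fun t : ℝ => W.action (NormedSpace.exp (t • X)))
    (Y := b • E + c • F + d • H) (by simp)
    (fun s t => by rw [matrix_exp_add, map_mul]) ?_
  · simpa using h
  · simp only [action_apply]
    rw [← W.rep_deriv b c d]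
    refine HasDerivAt.add_const _ (HasDerivAt.add ?_ ?_)
    · exact hasDerivAt_cornerMap _ _ _ (hasDerivAt_matrix_exp X)
    · refine hasDerivAt_cornerMap _ _ _ fun i j => ?_
      have h1 := hasDerivAt_matrix_exp X
      have h0 : NormedSpace.exp ((0 : ℝ) • X) = 1 := by rw [zero_smul, NormedSpace.exp_zero]
      fin_cases i <;> fin_cases j
      · refine ((h1 0 0).pow 2).congr_deriv ?_
        simp [symSqDeriv, hX]
      · refine (((h1 0 0).mul (h1 0 1)).const_mul 2).congr_deriv ?_
        simp [symSqDeriv, hX]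
      · refine ((h1 0 1).pow 2).congr_deriv ?_
        simp [symSqDeriv, hX]
      · refine ((h1 0 0).mul (h1 1 0)).congr_deriv ?_
        simp [symSqDeriv, hX]
      · refine (((h1 0 0).mul (h1 1 1)).add ((h1 0 1).mul (h1 1 0))).congr_deriv ?_
        simp [symSqDeriv, hX]
      · refine ((h1 0 1).mul (h1 1 1)).congr_deriv ?_
        simp [symSqDeriv, hX]
      · refine ((h1 1 0).pow 2).congr_deriv ?_
        simp [symSqDeriv, hX]
      · refine (((h1 1 0).mul (h1 1 1)).const_mul 2).congr_deriv ?_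
        simp [symSqDeriv, hX]
      · refine ((h1 1 1).pow 2).congr_deriv ?_
        simp [symSqDeriv, hX]

theorem continuous_action (W : WeightData E F H P) :
    Continuous fun M : Matrix (Fin 2) (Fin 2) ℝ => W.action M := by
  have h1 : ∀ {n : Type} [Fintype n] (u w : n → A) (Q : A), Continuous (cornerMap u w Q) :=
    fun u w Q => LinearMap.continuous_of_finiteDimensional _
  exact ((h1 _ _ _).add ((h1 _ _ _).comp continuous_symSq)).add continuous_const

/-- The action as a homomorphism from `SL₂(ℝ)` to the unit group. -/
noncomputable def slHom (W : WeightData E F H P) : Matrix.SpecialLinearGroup (Fin 2) ℝ →* Aˣ :=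
  (W.action.comp Matrix.SpecialLinearGroup.coeMonoidHom).toHomUnits

theorem coe_slHom (W : WeightData E F H P) (M : Matrix.SpecialLinearGroup (Fin 2) ℝ) :
    (W.slHom M : A) = W.action (M : Matrix (Fin 2) (Fin 2) ℝ) := rfl

theorem continuous_slHom (W : WeightData E F H P) : Continuous W.slHom := by
  have h1 : Continuous fun M : Matrix.SpecialLinearGroup (Fin 2) ℝ => (W.slHom M : A) :=
    W.continuous_action.comp continuous_subtype_val
  refine Units.continuous_iff.mpr ⟨h1, ?_⟩
  have h2 : Continuous fun M : Matrix.SpecialLinearGroup (Fin 2) ℝ => (W.slHom M⁻¹ : A) :=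
    h1.comp continuous_inv
  simpa only [map_inv] using h2

/-- The image of `SL₂(ℝ)` is generated by the exponentials of the triple. -/
theorem range_slHom [CompleteSpace A] (W : WeightData E F H P) : W.slHom.range =
    Subgroup.closure {u : Aˣ | ∃ b c d : ℝ, (u : A) = NormedSpace.exp (b • E + c • F + d • H)} := by
  apply le_antisymm
  · rintro _ ⟨M, rfl⟩
    refine Matrix.SL2.transvection_induction
      (fun M => W.slHom M ∈ Subgroup.closure _) (fun i j hij r => ?_) (fun M N hM hN => ?_) M
    · -- the exponential of a square-zero matrix is a transvection
      have h1 : ∀ X : Matrix (Fin 2) (Fin 2) ℝ, X * X = 0 → NormedSpace.exp X = 1 + X := by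
        intro X hX
        have h2 := eq_exp_of_hasDerivAt (G := fun t : ℝ => 1 + t • X) (Y := X) (by simp)
          (fun s t => by
            simp only [mul_add, add_mul, smul_mul_smul_comm, hX, one_mul, mul_one]
            module) ?_
        · rw [one_smul] at h2
          exact h2.symm
        · simpa using ((hasDerivAt_id (0 : ℝ)).smul_const X).const_add 1
      have h2 : ∃ b c : ℝ, Matrix.single i j r = !![0, b; c, -0] ∧
          Matrix.single i j r * Matrix.single i j r = 0 := by
        rw [Matrix.single_mul_single_of_ne _ _ _ _ hij.symm]
        fin_cases i <;> fin_cases j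
        · exact absurd rfl hij
        · exact ⟨r, 0, by ext a b; fin_cases a <;> fin_cases b <;> simp, rfl⟩
        · exact ⟨0, r, by ext a b; fin_cases a <;> fin_cases b <;> simp, rfl⟩
        · exact absurd rfl hij
      obtain ⟨b, c, h3, h4⟩ := h2
      refine Subgroup.subset_closure ⟨b, c, 0, ?_⟩
      rw [← W.action_exp, ← h3, h1 _ h4]
      rfl
    · rw [map_mul]
      exact mul_mem hM hN
  · rw [Subgroup.closure_le]
    rintro u ⟨b, c, d, hu⟩
    refine ⟨⟨NormedSpace.exp !![d, b; c, -d], det_matrix_exp b c d⟩, Units.ext ?_⟩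
    rw [hu]
    exact W.action_exp b c d

theorem corner_action₂ (W : WeightData E F H P) (N : Matrix (Fin 2) (Fin 2) ℝ) (i j : Fin 2) :
    P 1 * raise₂ E i * W.action N * lower₂ F j * P 1 = N i j • P 1 := by
  have h1 : P 1 * raise₂ E i = rep₂ E F P (Matrix.single 0 i 1) := by
    fin_cases i <;> simp [rep₂, cornerMap_apply, lower₂, Matrix.single_apply]
  have h2 : P 1 * raise₂ E i * W.action N = P 1 * raise₂ E i * rep₂ E F P N := by
    rw [h1, action_apply]
    simp only [mul_add, mul_sub, mul_one, W.rep₂_mul, W.rep₂_mul_rep₃]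
    abel
  rw [h2]
  exact corner_coordinate W.corner₂ N i j

theorem corner_action₃ (W : WeightData E F H P) (N : Matrix (Fin 2) (Fin 2) ℝ) (i j : Fin 3) :
    P 2 * raise₃ E i * W.action N * lower₃ F j * P 2 = symSq N i j • P 2 := by
  have h1 : P 2 * raise₃ E i = rep₃ E F P (Matrix.single 0 i 1) := by
    fin_cases i <;> simp [rep₃, cornerMap_apply, lower₃, Matrix.single_apply, Fin.sum_univ_three]
  have h2 : P 2 * raise₃ E i * W.action N = P 2 * raise₃ E i * rep₃ E F P (symSq N) := by
    rw [h1, action_apply]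
    simp only [mul_add, mul_sub, mul_one, W.rep₃_mul, W.rep₃_mul_rep₂]
    abel
  rw [h2]
  exact corner_coordinate W.corner₃ (symSq N) i j

/-- If two-dimensional modules occur, the representation of `SL₂(ℝ)` is a topological embedding. -/
theorem isEmbedding_slHom (W : WeightData E F H P) (hP : P 1 ≠ 0) :
    Topology.IsEmbedding W.slHom := by
  obtain ⟨κ, hκ⟩ := SeparatingDual.exists_eq_one (R := ℝ) hP
  let r : Aˣ → Matrix (Fin 2) (Fin 2) ℝ := fun u => Matrix.of fun i j =>
    κ (P 1 * raise₂ E i * u * lower₂ F j * P 1)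
  have hr : Continuous r := by
    refine continuous_matrix fun i j => ?_
    exact κ.continuous.comp (((continuous_const.mul Units.continuous_val).mul continuous_const).mul
      continuous_const)
  refine Topology.IsEmbedding.of_comp W.continuous_slHom hr ?_
  have h4 : r ∘ W.slHom = fun M : Matrix.SpecialLinearGroup (Fin 2) ℝ => M.val := by
    funext M
    ext i j
    change κ (P 1 * raise₂ E i * W.action M.val * lower₂ F j * P 1) = M.val i j
    rw [W.corner_action₂, map_smul, hκ, smul_eq_mul, mul_one]
  rw [h4]
  exact Topology.IsEmbedding.subtypeVal

/-- The representation on the three-dimensional modules recovers the symmetric square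
continuously. -/
theorem exists_continuous_symSq (W : WeightData E F H P) (hP : P 2 ≠ 0) :
    ∃ r : Aˣ → Matrix (Fin 3) (Fin 3) ℝ, Continuous r ∧ ∀ M, r (W.slHom M) = symSq M.val := by
  obtain ⟨κ, hκ⟩ := SeparatingDual.exists_eq_one (R := ℝ) hP
  refine ⟨fun u => Matrix.of fun i j => κ (P 2 * raise₃ E i * u * lower₃ F j * P 2), ?_, ?_⟩
  · refine continuous_matrix fun i j => ?_
    exact κ.continuous.comp (((continuous_const.mul Units.continuous_val).mul continuous_const).mul
      continuous_const)
  · intro M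
    ext i j
    change κ (P 2 * raise₃ E i * W.action M.val * lower₃ F j * P 2) = symSq M.val i j
    rw [W.corner_action₃, map_smul, hκ, smul_eq_mul, mul_one]

end Normed
end WeightData

/-! ### The symmetric square on `SL₂(ℝ)` -/

section SymSq

theorem symSq_eq_one_iff (M : Matrix.SpecialLinearGroup (Fin 2) ℝ) :
    symSq M.val = 1 ↔ M ∈ Subgroup.center (Matrix.SpecialLinearGroup (Fin 2) ℝ) := by
  rw [Matrix.SpecialLinearGroup.mem_center_iff]
  constructor
  · intro h
    have h00 : M.val 0 0 ^ 2 = 1 := by simpa [symSq] using congrFun (congrFun h 0) 0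
    have h02 : M.val 0 1 = 0 := by simpa [symSq] using congrFun (congrFun h 0) 2
    have h20 : M.val 1 0 = 0 := by simpa [symSq] using congrFun (congrFun h 2) 0
    have h11 : M.val 0 0 * M.val 1 1 = 1 := by
      simpa [symSq, h02] using congrFun (congrFun h 1) 1
    refine ⟨M.val 0 0, by simpa using h00, ?_⟩
    have h3 : M.val 1 1 = M.val 0 0 := by
      linear_combination M.val 0 0 * h11 - M.val 1 1 * h00
    ext i j
    fin_cases i <;> fin_cases j <;> simp [h02, h20, h3]
  · rintro ⟨r, hr, hM⟩
    rw [← hM]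
    have hr2 : r * r = 1 := by simpa [sq] using hr
    ext i j
    fin_cases i <;> fin_cases j <;> simp [symSq, hr2, sq]

/-- The symmetric square is a closed map on `SL₂(ℝ)`, since the squares of the entries of a
matrix are entries of its symmetric square. -/
theorem isClosedMap_symSq :
    IsClosedMap fun M : Matrix.SpecialLinearGroup (Fin 2) ℝ => symSq M.val := by
  have hc : Continuous fun M : Matrix.SpecialLinearGroup (Fin 2) ℝ => symSq M.val :=
    continuous_symSq.comp continuous_subtype_val
  have : LocallyCompactSpace (Matrix (Fin 3) (Fin 3) ℝ) :=
    inferInstanceAs (LocallyCompactSpace (Fin 3 → Fin 3 → ℝ))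
  refine IsProperMap.isClosedMap (isProperMap_iff_isCompact_preimage.mpr ⟨hc, fun K hK => ?_⟩)
  obtain ⟨C, hC⟩ : ∃ C : ℝ, ∀ N ∈ K, ∀ i j, N i j ≤ C := by
    have h1 : ∀ i j : Fin 3, ∃ C : ℝ, ∀ N ∈ K, N i j ≤ C := fun i j => by
      obtain ⟨C, hC⟩ := hK.bddAbove_image
        (f := fun N : Matrix (Fin 3) (Fin 3) ℝ => N i j) (by fun_prop)
      exact ⟨C, fun N hN => hC ⟨N, hN, rfl⟩⟩
    choose C hC using h1
    refine ⟨∑ i, ∑ j, |C i j|, fun N hN i j => (hC i j N hN).trans ((le_abs_self _).trans ?_)⟩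
    exact (Finset.single_le_sum (f := fun j => |C i j|) (fun _ _ => abs_nonneg _)
      (Finset.mem_univ j)).trans (Finset.single_le_sum (f := fun i => ∑ j, |C i j|)
        (fun _ _ => Finset.sum_nonneg fun _ _ => abs_nonneg _) (Finset.mem_univ i))
  have hB : IsCompact {M : Matrix (Fin 2) (Fin 2) ℝ | ∀ i j, M i j ∈ Set.Icc (-(C + 1)) (C + 1)} := by
    have := isCompact_univ_pi (X := fun _ : Fin 2 => Fin 2 → ℝ) (s := fun _ =>
      Set.univ.pi fun _ => Set.Icc (-(C + 1)) (C + 1)) fun _ =>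
        isCompact_univ_pi fun _ => isCompact_Icc
    change IsCompact {M : Fin 2 → Fin 2 → ℝ | ∀ i j, M i j ∈ Set.Icc (-(C + 1)) (C + 1)}
    convert this using 1
    ext M
    simp only [Set.mem_ofPred_eq, Set.mem_pi, Set.mem_univ, forall_true_left]
  have hcl : Topology.IsClosedEmbedding
      (fun M : Matrix.SpecialLinearGroup (Fin 2) ℝ => M.val) :=
    Topology.IsClosedEmbedding.subtypeVal (isClosed_eq (by fun_prop) continuous_const)
  refine (hcl.isCompact_preimage hB).of_isClosed_subset (hK.isClosed.preimage hc) fun M hM i j => ?_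
  have hsq : ∀ x : ℝ, x ^ 2 ≤ C → x ∈ Set.Icc (-(C + 1)) (C + 1) := fun x hx =>
    ⟨by nlinarith [sq_nonneg (x + 1), sq_nonneg x], by nlinarith [sq_nonneg (x - 1), sq_nonneg x]⟩
  apply hsq
  fin_cases i <;> fin_cases j
  · exact hC _ hM 0 0
  · exact hC _ hM 0 2
  · exact hC _ hM 2 0
  · exact hC _ hM 2 2

end SymSq

namespace WeightData

variable {A : Type*} [NormedRing A] [NormedAlgebra ℝ A] {E F H : A} {P : ℤ → A}

/-- If only odd-dimensional modules occur, and not only trivial ones, then the kernel of the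
representation of `SL₂(ℝ)` is the center. -/
theorem ker_slHom (W : WeightData E F H P) (h1 : P 1 = 0) (h2 : P 2 ≠ 0) :
    W.slHom.ker = Subgroup.center (Matrix.SpecialLinearGroup (Fin 2) ℝ) := by
  obtain ⟨r, -, hr⟩ := W.exists_continuous_symSq h2
  ext M
  rw [← symSq_eq_one_iff, MonoidHom.mem_ker]
  constructor
  · intro h
    rw [← hr, h, ← map_one W.slHom, hr]
    exact symSq_one
  · intro h
    have h0 : ∀ N, rep₂ E F P N = 0 := fun N => by simp [rep₂, cornerMap_apply, h1]
    refine Units.ext ?_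
    rw [coe_slHom, action_apply, h, h0, h0]
    simp

/-- If only odd-dimensional modules occur, the induced representation of `PSL₂(ℝ)` is a topological
embedding, since its composition with `r` is a closed injection. -/
theorem exists_isEmbedding_psl (W : WeightData E F H P) (h1 : P 1 = 0) (h2 : P 2 ≠ 0) :
    ∃ ψ : Matrix.ProjectiveSpecialLinearGroup (Fin 2) ℝ →* Aˣ,
      Topology.IsEmbedding ψ ∧ ψ.range = W.slHom.range := by
  obtain ⟨r, hrc, hr⟩ := W.exists_continuous_symSq h2
  have hk := W.ker_slHom h1 h2
  let ψ : Matrix.ProjectiveSpecialLinearGroup (Fin 2) ℝ →* Aˣ :=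
    QuotientGroup.lift _ W.slHom hk.ge
  have hψc : Continuous ψ := W.continuous_slHom.quotient_lift _
  have hψi : Function.Injective (r ∘ ψ) := by
    intro x y
    induction x using QuotientGroup.induction_on with | H M => ?_
    induction y using QuotientGroup.induction_on with | H N => ?_
    intro h
    have h3 : symSq M.val = symSq N.val := by
      rw [← hr, ← hr]
      exact h
    refine QuotientGroup.eq.mpr ?_
    rw [← symSq_eq_one_iff]
    change symSq ((M⁻¹).val * N.val) = 1
    rw [symSq_mul, ← h3, ← symSq_mul, ← symSq_one]
    congr 1
    exact congrArg Subtype.val (inv_mul_cancel M)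
  have hψcl : IsClosedMap (r ∘ ψ) := by
    intro C hC
    have h3 := isClosedMap_symSq _ (hC.preimage (continuous_quotient_mk'
      (s := QuotientGroup.leftRel (Subgroup.center (Matrix.SpecialLinearGroup (Fin 2) ℝ)))))
    convert h3 using 1
    ext N
    constructor
    · rintro ⟨x, hx, rfl⟩
      induction x using QuotientGroup.induction_on with | H M => ?_
      exact ⟨M, hx, (hr M).symm⟩
    · rintro ⟨M, hM, rfl⟩
      exact ⟨QuotientGroup.mk M, hM, hr M⟩
  refine ⟨ψ, Topology.IsEmbedding.of_comp hψc hrc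
    (Topology.IsClosedEmbedding.of_continuous_injective_isClosedMap (hrc.comp hψc) hψi
      hψcl).isEmbedding, ?_⟩
  ext u
  constructor
  · rintro ⟨x, rfl⟩
    induction x using QuotientGroup.induction_on with | H M => ?_
    exact ⟨M, rfl⟩
  · rintro ⟨M, rfl⟩
    exact ⟨QuotientGroup.mk M, rfl⟩

end WeightData

/-- A group homomorphism that is a topological embedding is an isomorphism onto its range. -/
theorem nonempty_continuousMulEquiv_of_isEmbedding {G K : Type*} [Group G] [TopologicalSpace G]
    [Group K] [TopologicalSpace K] {ψ : G →* K} (hψ : Topology.IsEmbedding ψ) {S : Subgroup K}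
    (hS : ψ.range = S) : Nonempty (S ≃ₜ* G) := by
  subst hS
  let e := MonoidHom.ofInjective hψ.injective
  refine ⟨ContinuousMulEquiv.symm { e with
    continuous_toFun := hψ.continuous.subtype_mk _
    continuous_invFun := ?_ }⟩
  refine hψ.continuous_iff.mpr ?_
  have h1 : ψ ∘ e.symm = Subtype.val := by
    funext x
    obtain ⟨y, rfl⟩ := e.surjective x
    change ψ (e.symm (e y)) = _
    rw [e.symm_apply_apply]
    rfl
  exact h1 ▸ continuous_subtype_val

/-! ### The groups of inner automorphisms -/

section Groups

variable {g : Type*} [LieRing g] [LieAlgebra ℝ g] [FiniteDimensional ℝ g]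

attribute [local instance] endNormedRing endNormedAlgebra

namespace GradedTriple

variable {h e f : g} {P : ℤ → Module.End ℝ g}

/-- The image of `SL₂(ℝ)` is the group of inner automorphisms of the span of the triple. -/
theorem range_slHom_eq_Inn
    (W : WeightData (LieAlgebra.ad ℝ g e) (LieAlgebra.ad ℝ g f) (LieAlgebra.ad ℝ g ⁅e, f⁆) P)
    {s : LieSubalgebra ℝ g}
    (hs : ∀ x, x ∈ s ↔ ∃ b c d : ℝ, x = b • e + c • f + d • ⁅e, f⁆) :
    W.slHom.range = Inn s := by
  rw [W.range_slHom, Inn]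
  congr 1
  ext u
  constructor
  · rintro ⟨b, c, d, hu⟩
    refine ⟨b • e + c • f + d • ⁅e, f⁆, (hs _).mpr ⟨b, c, d, rfl⟩, ?_⟩
    rw [hu]
    simp only [map_add, map_smul]
  · rintro ⟨x, hx, hu⟩
    obtain ⟨b, c, d, rfl⟩ := (hs x).mp hx
    refine ⟨b, c, d, ?_⟩
    rw [hu]
    simp only [map_add, map_smul]

/-- The weight `2` occurs, since `e` has weight `2`. -/
theorem P_two_ne_zero (t : GradedTriple h e f)
    (W : WeightData (LieAlgebra.ad ℝ g e) (LieAlgebra.ad ℝ g f) (LieAlgebra.ad ℝ g ⁅e, f⁆) P) :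
    P 2 ≠ 0 := by
  intro h2
  have hk : ∀ k : ℤ, ((k : ℝ) - 2) ≠ 0 → P k e = 0 := by
    intro k hk
    have h3 : P k ⁅⁅e, f⁆, e⁆ = (k : ℝ) • P k e := LinearMap.congr_fun (W.P_H k) e
    rw [t.lie_lie_e, map_smul] at h3
    have h4 : ((k : ℝ) - 2) • P k e = 0 := by linear_combination (norm := module) -h3
    exact (smul_eq_zero.mp h4).resolve_left hk
  have h5 : P (-2) e + P (-1) e + P 0 e + P 1 e + P 2 e = e := LinearMap.congr_fun W.sum_P e
  rw [hk _ (by norm_num), hk _ (by norm_num), hk _ (by norm_num), hk _ (by norm_num), h2] at h5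
  exact t.ne_zero (by simpa using h5.symm)

/-- The weights of `2h` are even. -/
theorem P_one_eq_zero (hh : ThreeGraded h) (hef : ⁅e, f⁆ = (2 : ℝ) • h)
    (W : WeightData (LieAlgebra.ad ℝ g e) (LieAlgebra.ad ℝ g f) (LieAlgebra.ad ℝ g ⁅e, f⁆) P) :
    P 1 = 0 := by
  ext x
  have h1 : ∀ y, ⁅⁅e, f⁆, P 1 y⁆ = P 1 y := fun y => by
    simpa using LinearMap.congr_fun (W.H_P 1) y
  have h2 := h1 x
  have h3 := hh (P 1 x)
  rw [hef, smul_lie] at h2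
  have h4 : ⁅h, P 1 x⁆ = (2⁻¹ : ℝ) • P 1 x := by
    linear_combination (norm := module) (2⁻¹ : ℝ) • h2
  rw [h4, lie_smul, lie_smul, h4, lie_smul, h4] at h3
  have h5 : P 1 x = 0 := by linear_combination (norm := module) (-8 / 3 : ℝ) • h3
  simpa using h5

/-- If all weights are even, then `⁅e, f⁆` vanishes on the centralizer of `h`. It follows that
`D = ad (⁅e, f⁆ - 2h)` satisfies `D (D - 2) (D + 2) = 0` and that the centralizer of the image of
`D` in the kernel of `D` is an ideal containing `e`. In a simple algebra this forces `D = 0`. -/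
theorem P_one_ne_zero (hh : ThreeGraded h) (t : GradedTriple h e f) [LieAlgebra.IsSimple ℝ g]
    (hz : ⁅e, f⁆ ≠ (2 : ℝ) • h)
    (W : WeightData (LieAlgebra.ad ℝ g e) (LieAlgebra.ad ℝ g f) (LieAlgebra.ad ℝ g ⁅e, f⁆) P) :
    P 1 ≠ 0 := by
  intro hP
  -- the weight `-1` does not occur either
  have hP' : P (-1) = 0 := by
    have h1 := congrArg (· * P (-1)) W.E_F
    simp only [add_mul, mul_assoc, W.F_Pm1, mul_zero] at h1
    rw [W.E_Pm1, hP, W.H_P] at h1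
    simpa using h1
  have hH : ∀ x : g, ⁅⁅e, f⁆, ⁅⁅e, f⁆, ⁅⁅e, f⁆, x⁆⁆⁆ = (4 : ℝ) • ⁅⁅e, f⁆, x⁆ := by
    intro x
    have h1 : ∀ k : ℤ, ∀ y, ⁅⁅e, f⁆, P k y⁆ = (k : ℝ) • P k y := fun k y =>
      LinearMap.congr_fun (W.H_P k) y
    have h5 : P (-2) x + P (-1) x + P 0 x + P 1 x + P 2 x = x := LinearMap.congr_fun W.sum_P x
    rw [hP, hP'] at h5
    simp only [LinearMap.zero_apply, add_zero] at h5
    rw [← h5]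
    simp only [lie_add, h1, lie_smul]
    push_cast
    module
  have hpos : ∀ x : g, ⁅h, x⁆ = x → ⁅⁅e, f⁆, ⁅⁅e, f⁆, x⁆⁆ = (2 : ℝ) • ⁅⁅e, f⁆, x⁆ := fun x hx => by
    have h1 := weight_pos hh t hx
    rw [hH] at h1
    linear_combination (norm := module) (-3⁻¹ : ℝ) • h1
  have hneg : ∀ x : g, ⁅h, x⁆ = -x → ⁅⁅e, f⁆, ⁅⁅e, f⁆, x⁆⁆ = (-2 : ℝ) • ⁅⁅e, f⁆, x⁆ := fun x hx => by
    have h1 := weight_neg hh t hx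
    rw [hH] at h1
    linear_combination (norm := module) (3⁻¹ : ℝ) • h1
  have hzero : ∀ x : g, ⁅h, x⁆ = 0 → ⁅⁅e, f⁆, x⁆ = 0 := fun x hx => by
    have h1 := weight_zero hh t hx
    rw [hH] at h1
    linear_combination (norm := module) (3⁻¹ : ℝ) • h1
  set z := ⁅e, f⁆ - (2 : ℝ) • h with hzdef
  have hD : ∀ x : g, ⁅z, x⁆ = ⁅⁅e, f⁆, x⁆ - (2 : ℝ) • ⁅h, x⁆ := fun x => by
    rw [hzdef, sub_lie, smul_lie]
  have hDpos : ∀ x : g, ⁅h, x⁆ = x → ⁅h, ⁅z, x⁆⁆ = ⁅z, x⁆ ∧ ⁅z, ⁅z, x⁆⁆ = (-2 : ℝ) • ⁅z, x⁆ := by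
    intro x hx
    have h1 : ⁅h, ⁅⁅e, f⁆, x⁆⁆ = ⁅⁅e, f⁆, x⁆ := lie_zero_pos t.lie_h hx
    simp only [hD, hx, lie_sub, lie_smul, h1, hpos x hx]
    exact ⟨trivial, by module⟩
  have hDneg : ∀ x : g, ⁅h, x⁆ = -x → ⁅h, ⁅z, x⁆⁆ = -⁅z, x⁆ ∧ ⁅z, ⁅z, x⁆⁆ = (2 : ℝ) • ⁅z, x⁆ := by
    intro x hx
    have h1 : ⁅h, ⁅⁅e, f⁆, x⁆⁆ = -⁅⁅e, f⁆, x⁆ := lie_zero_neg t.lie_h hx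
    simp only [hD, hx, lie_sub, lie_smul, lie_neg, h1, hneg x hx]
    exact ⟨by module, by module⟩
  have hDzero : ∀ x : g, ⁅h, x⁆ = 0 → ⁅z, x⁆ = 0 := by
    intro x hx
    rw [hD, hx, hzero x hx]
    simp
  have hDe : ⁅z, e⁆ = 0 := by
    rw [hD, t.lie_e, t.lie_lie_e, sub_self]
  -- `g` is the sum of the kernel and the range of `D`, because `D³ = 4D`
  have hDD : ∀ y : g, ∃ y₀ y₁ : g, ⁅z, y₀⁆ = 0 ∧ y = y₀ + ⁅z, y₁⁆ := by
    intro y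
    have h3 : ∀ y : g, ⁅z, ⁅z, ⁅z, y⁆⁆⁆ = (4 : ℝ) • ⁅z, y⁆ := by
      intro y
      refine hh.induction (p := fun y => ⁅z, ⁅z, ⁅z, y⁆⁆⁆ = (4 : ℝ) • ⁅z, y⁆) ?_ ?_ ?_ ?_ y
      · intro x y hx hy
        simp only [lie_add, hx, hy, smul_add]
      · intro x hx
        simp only [(hDpos x hx).2, lie_smul]
        module
      · intro x hx
        simp only [hDzero x hx, lie_zero, smul_zero]
      · intro x hx
        simp only [(hDneg x hx).2, lie_smul]
        module
    refine ⟨y - (4⁻¹ : ℝ) • ⁅z, ⁅z, y⁆⁆, (4⁻¹ : ℝ) • ⁅z, y⁆, ?_, ?_⟩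
    · rw [lie_sub, lie_smul, h3]
      module
    · rw [lie_smul]
      module
  let K : LieIdeal ℝ g :=
    { carrier := {x | ⁅z, x⁆ = 0 ∧ ∀ y : g, ⁅⁅z, y⁆, x⁆ = 0}
      add_mem' := by
        rintro a b ⟨ha, ha'⟩ ⟨hb, hb'⟩
        exact ⟨by rw [lie_add, ha, hb, add_zero], fun y => by rw [lie_add, ha', hb', add_zero]⟩
      zero_mem' := ⟨lie_zero _, fun y => lie_zero _⟩
      smul_mem' := by
        rintro c x ⟨hx, hx'⟩
        exact ⟨by rw [lie_smul, hx, smul_zero], fun y => by rw [lie_smul, hx', smul_zero]⟩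
      lie_mem := by
        rintro y x ⟨hx, hx'⟩
        obtain ⟨y₀, y₁, hy₀, rfl⟩ := hDD y
        change ⁅z, ⁅y₀ + ⁅z, y₁⁆, x⁆⁆ = 0 ∧ ∀ w : g, ⁅⁅z, w⁆, ⁅y₀ + ⁅z, y₁⁆, x⁆⁆ = 0
        rw [add_lie, hx', add_zero]
        refine ⟨by rw [leibniz_lie, hy₀, hx]; simp, fun w => ?_⟩
        have h1 : ⁅⁅z, w⁆, y₀⁆ = ⁅z, ⁅w, y₀⁆⁆ := by rw [leibniz_lie z w y₀, hy₀]; simp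
        rw [leibniz_lie, hx', h1, hx']
        simp }
  -- in degree `-1` the range of `D` consists of vectors of weight `0`, and their brackets with `e`
  -- have degree `0` and weight `2`, so they vanish
  have heK : e ∈ K := by
    refine ⟨hDe, fun y => ?_⟩
    refine hh.induction (p := fun y => ⁅⁅z, y⁆, e⁆ = 0) ?_ ?_ ?_ ?_ y
    · intro x y hx hy
      rw [lie_add, add_lie, hx, hy, add_zero]
    · intro x hx
      exact hh.lie_pos_pos (hDpos x hx).1 t.lie_e
    · intro x hx
      rw [hDzero x hx, zero_lie]
    · intro x hx
      obtain ⟨h1, h2⟩ := hDneg x hx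
      set v := ⁅z, x⁆
      have h3 : ⁅⁅e, f⁆, v⁆ = 0 := by
        rw [hD, h1] at h2
        linear_combination (norm := module) h2
      have h4 := hzero _ (lie_neg_pos h1 t.lie_e)
      rw [leibniz_lie, h3, zero_lie, zero_add, t.lie_lie_e, lie_smul] at h4
      exact (smul_eq_zero.mp h4).resolve_left two_ne_zero
  rcases LieAlgebra.IsSimple.eq_bot_or_eq_top (R := ℝ) K with hK | hK
  · rw [hK, LieSubmodule.mem_bot] at heK
    exact t.ne_zero heK
  · have hzc : z ∈ LieAlgebra.center ℝ g := by
      rw [LieModule.mem_maxTrivSubmodule]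
      intro x
      have hx : x ∈ K := hK ▸ LieSubmodule.mem_top x
      rw [← lie_skew, hx.1, neg_zero]
    rcases LieAlgebra.IsSimple.eq_bot_or_eq_top (R := ℝ) (LieAlgebra.center ℝ g) with hC | hC
    · rw [hC, LieSubmodule.mem_bot] at hzc
      exact hz (sub_eq_zero.mp hzc)
    · exact LieAlgebra.IsSimple.non_abelian (R := ℝ) (L := g)
        ((LieAlgebra.isLieAbelian_iff_center_eq_top ℝ g).mpr hC)

end GradedTriple

end Groups

/-! ### Subalgebras isomorphic to `sl₂(ℝ)` and `gl₂(ℝ)` -/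

section Subalgebras

variable {g : Type*} [LieRing g] [LieAlgebra ℝ g]

/-- The homomorphism `gl₂(ℝ) → g` given by an `sl₂`-triple and an element `z` commuting with it,
the value at the matrix `1/2`. -/
noncomputable def glHom {h e f : g} (t : GradedTriple h e f) (z : g) (hze : ⁅z, e⁆ = 0) (hzf : ⁅z, f⁆ = 0) :
    Matrix (Fin 2) (Fin 2) ℝ →ₗ⁅ℝ⁆ g where
  toFun M := M 0 1 • e + M 1 0 • f + ((M 0 0 - M 1 1) / 2) • ⁅e, f⁆ + (M 0 0 + M 1 1) • z
  map_add' M N := by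
    simp only [Matrix.add_apply]
    module
  map_smul' r M := by
    simp only [Matrix.smul_apply, smul_eq_mul, RingHom.id_apply]
    module
  map_lie' {M N} := by
    have hez : ⁅e, z⁆ = 0 := by rw [← lie_skew, hze, neg_zero]
    have hfz : ⁅f, z⁆ = 0 := by rw [← lie_skew, hzf, neg_zero]
    have hHz : ⁅⁅e, f⁆, z⁆ = 0 := by rw [lie_lie, hez, hfz]; simp
    have hzH : ⁅z, ⁅e, f⁆⁆ = 0 := by rw [← lie_skew, hHz, neg_zero]
    have hfe : ⁅f, e⁆ = -⁅e, f⁆ := (lie_skew f e).symm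
    simp only [add_lie, lie_add, smul_lie, lie_smul, lie_self, hez, hfz, hze, hzf, hHz, hzH, hfe,
      t.lie_lie_e, t.lie_lie_f, t.lie_e_lie, t.lie_f_lie, Ring.lie_def, Matrix.sub_apply,
      Matrix.mul_apply, Fin.sum_univ_two]
    module

section

variable {h e f z : g} (t : GradedTriple h e f) (hze : ⁅z, e⁆ = 0) (hzf : ⁅z, f⁆ = 0)

theorem glHom_apply (M : Matrix (Fin 2) (Fin 2) ℝ) : glHom t z hze hzf M =
    M 0 1 • e + M 1 0 • f + ((M 0 0 - M 1 1) / 2) • ⁅e, f⁆ + (M 0 0 + M 1 1) • z := rfl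

/-- The components of degree `1`, `-1` and `0` of an element of the kernel vanish separately, and the
last one can be bracketed with `e`. -/
theorem glHom_apply_eq_zero (hhz : ⁅h, z⁆ = 0) {M : Matrix (Fin 2) (Fin 2) ℝ}
    (hM : glHom t z hze hzf M = 0) :
    M 0 1 = 0 ∧ M 1 0 = 0 ∧ M 0 0 = M 1 1 ∧ (M 0 0 + M 1 1) • z = 0 := by
  rw [glHom_apply] at hM
  have h1 : ⁅h, M 0 1 • e + M 1 0 • f + ((M 0 0 - M 1 1) / 2) • ⁅e, f⁆ + (M 0 0 + M 1 1) • z⁆ = 0 := by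
    rw [hM, lie_zero]
  simp only [lie_add, lie_smul, t.lie_e, t.lie_f, t.lie_h, hhz] at h1
  have h2 : ⁅h, M 0 1 • e + M 1 0 • -f⁆ = 0 := by
    have h3 : M 0 1 • e + M 1 0 • -f = 0 := by linear_combination (norm := module) h1
    rw [h3, lie_zero]
  simp only [lie_add, lie_smul, lie_neg, t.lie_e, t.lie_f, neg_neg] at h2
  have h3 : M 0 1 • e = 0 := by
    linear_combination (norm := module) (2⁻¹ : ℝ) • h1 + (2⁻¹ : ℝ) • h2
  have h4 : M 1 0 • f = 0 := by
    linear_combination (norm := module) h2 - h3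
  have h5 : ⁅((M 0 0 - M 1 1) / 2) • ⁅e, f⁆ + (M 0 0 + M 1 1) • z, e⁆ = 0 := by
    rw [h3, h4, zero_add, zero_add] at hM
    rw [hM, zero_lie]
  rw [add_lie, smul_lie, smul_lie, hze, t.lie_lie_e, smul_zero, add_zero, smul_smul] at h5
  have h6 : M 0 0 = M 1 1 := by
    have := (smul_eq_zero.mp h5).resolve_right t.ne_zero
    linarith
  refine ⟨(smul_eq_zero.mp h3).resolve_right t.ne_zero,
    (smul_eq_zero.mp h4).resolve_right t.f_ne_zero, h6, ?_⟩
  rw [h3, h4, h6, sub_self] at hM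
  rw [h6]
  simpa using hM

theorem mem_commutatorSubalgebra_range_glHom (x : g) :
    x ∈ commutatorSubalgebra (glHom t z hze hzf).range ↔
      ∃ b c d : ℝ, x = b • e + c • f + d • ⁅e, f⁆ := by
  set B := (glHom t z hze hzf).range with hB
  have hder : ((LieAlgebra.derivedSeries ℝ B 1 : LieIdeal ℝ B) : Submodule ℝ B) =
      Submodule.span ℝ {m | ∃ x ∈ (⊤ : LieIdeal ℝ B), ∃ y ∈ (⊤ : LieIdeal ℝ B), ⁅x, y⁆ = m} := by
    rw [← LieSubmodule.lieIdeal_oper_eq_linear_span']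
    rfl
  have hmem : x ∈ commutatorSubalgebra B ↔
      ∃ y ∈ ((LieAlgebra.derivedSeries ℝ B 1 : LieIdeal ℝ B) : Submodule ℝ B), (y : g) = x := by
    rw [commutatorSubalgebra, LieSubalgebra.mem_map]
    rfl
  rw [hmem, hder]
  constructor
  · clear hmem
    rintro ⟨y, hy, rfl⟩
    induction hy using Submodule.span_induction with
    | mem y hy =>
      obtain ⟨⟨_, M, rfl⟩, -, ⟨_, N, rfl⟩, -, rfl⟩ := hy
      refine ⟨⁅M, N⁆ 0 1, ⁅M, N⁆ 1 0, (⁅M, N⁆ 0 0 - ⁅M, N⁆ 1 1) / 2, ?_⟩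
      change ⁅glHom t z hze hzf M, glHom t z hze hzf N⁆ = _
      rw [← LieHom.map_lie, glHom_apply]
      have htr : ⁅M, N⁆ 0 0 + ⁅M, N⁆ 1 1 = 0 := by
        simp only [Ring.lie_def, Matrix.sub_apply, Matrix.mul_apply, Fin.sum_univ_two]
        ring
      rw [htr, zero_smul, add_zero]
    | zero => exact ⟨0, 0, 0, by simp⟩
    | add y w _ _ hy hw =>
      obtain ⟨b, c, d, h1⟩ := hy
      obtain ⟨b', c', d', h2⟩ := hw
      refine ⟨b + b', c + c', d + d', ?_⟩
      change (y : g) + (w : g) = _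
      rw [h1, h2]
      module
    | smul r y _ hy =>
      obtain ⟨b, c, d, h1⟩ := hy
      refine ⟨r * b, r * c, r * d, ?_⟩
      change r • (y : g) = _
      rw [h1]
      module
  · rintro ⟨b, c, d, rfl⟩
    have hbr : ∀ M N : Matrix (Fin 2) (Fin 2) ℝ,
        ∃ y ∈ Submodule.span ℝ {m | ∃ x ∈ (⊤ : LieIdeal ℝ B), ∃ y ∈ (⊤ : LieIdeal ℝ B), ⁅x, y⁆ = m},
          (y : g) = glHom t z hze hzf ⁅M, N⁆ := fun M N =>
      ⟨⁅⟨_, M, rfl⟩, ⟨_, N, rfl⟩⁆, Submodule.subset_span ⟨_, LieSubmodule.mem_top _, _,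
        LieSubmodule.mem_top _, rfl⟩, (LieHom.map_lie _ M N).symm⟩
    obtain ⟨y₁, hy₁, h1⟩ := hbr !![2⁻¹, 0; 0, -2⁻¹] !![0, 1; 0, 0]
    obtain ⟨y₂, hy₂, h2⟩ := hbr !![2⁻¹, 0; 0, -2⁻¹] !![0, 0; -1, 0]
    obtain ⟨y₃, hy₃, h3⟩ := hbr !![0, 1; 0, 0] !![0, 0; 1, 0]
    refine ⟨b • y₁ + c • y₂ + d • y₃, add_mem (add_mem (Submodule.smul_mem _ _ hy₁)
      (Submodule.smul_mem _ _ hy₂)) (Submodule.smul_mem _ _ hy₃), ?_⟩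
    change b • (y₁ : g) + c • (y₂ : g) + d • (y₃ : g) = _
    rw [h1, h2, h3]
    simp only [glHom_apply, Ring.lie_def, Matrix.mul_fin_two]
    simp
    norm_num

end

/-- The homomorphism `sl₂(ℝ) → g` given by an `sl₂`-triple. -/
noncomputable def slLieHom {h e f : g} (t : GradedTriple h e f) :
    LieAlgebra.SpecialLinear.sl (Fin 2) ℝ →ₗ⁅ℝ⁆ g :=
  (glHom t 0 (zero_lie e) (zero_lie f)).comp (LieAlgebra.SpecialLinear.sl (Fin 2) ℝ).incl

theorem trace_sl (M : LieAlgebra.SpecialLinear.sl (Fin 2) ℝ) : M.val 0 0 + M.val 1 1 = 0 := by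
  have h := M.property
  rw [← Matrix.trace_fin_two]
  exact h

theorem slLieHom_injective {h e f : g} (t : GradedTriple h e f) :
    Function.Injective (slLieHom t) := by
  rw [← LieHom.coe_toLinearMap, injective_iff_map_eq_zero]
  intro M hM
  obtain ⟨h1, h2, h3, -⟩ := glHom_apply_eq_zero t (zero_lie e) (zero_lie f) (lie_zero h) hM
  have h4 := trace_sl M
  have h3' : M.val 0 0 = M.val 1 1 := h3
  have h5 : M.val 1 1 = 0 := by linarith
  refine Subtype.ext ?_
  ext i j
  fin_cases i <;> fin_cases j
  · exact h3'.trans h5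
  · exact h1
  · exact h2
  · exact h5

theorem mem_range_slLieHom {h e f : g} (t : GradedTriple h e f) (x : g) :
    x ∈ (slLieHom t).range ↔ ∃ b c d : ℝ, x = b • e + c • f + d • ⁅e, f⁆ := by
  constructor
  · rintro ⟨M, rfl⟩
    refine ⟨M.val 0 1, M.val 1 0, (M.val 0 0 - M.val 1 1) / 2, ?_⟩
    change glHom t 0 (zero_lie e) (zero_lie f) M.val = _
    rw [glHom_apply, smul_zero, add_zero]
  · rintro ⟨b, c, d, rfl⟩
    have htr : !![d, b; c, -d] ∈ LieAlgebra.SpecialLinear.sl (Fin 2) ℝ := by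
      change Matrix.trace (!![d, b; c, -d] : Matrix (Fin 2) (Fin 2) ℝ) = 0
      simp [Matrix.trace_fin_two]
    refine ⟨⟨!![d, b; c, -d], htr⟩, ?_⟩
    change glHom t 0 (zero_lie e) (zero_lie f) !![d, b; c, -d] = _
    rw [glHom_apply, smul_zero, add_zero]
    simp

end Subalgebras

/-! ### Euler elements -/

section Final

variable {g : Type*} [LieRing g] [LieAlgebra ℝ g]

theorem IsEuler.threeGraded [FiniteDimensional ℝ g] {h : g} (hE : IsEuler h) : ThreeGraded h := by
  obtain ⟨-, htop, hspec⟩ := hE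
  intro x
  have hx : x ∈ ⨆ μ : ℝ, Module.End.eigenspace (LieAlgebra.ad ℝ g h) μ := htop ▸ Submodule.mem_top
  induction hx using Submodule.iSup_induction' with
  | mem μ x hx =>
    by_cases h0 : x = 0
    · simp [h0]
    · have hμ := hspec (Module.End.HasEigenvalue.mem_spectrum
        (Module.End.hasEigenvalue_of_hasEigenvector ⟨hx, h0⟩))
      have h1 : ⁅h, x⁆ = μ • x := Module.End.mem_eigenspace_iff.mp hx
      simp only [h1, lie_smul]
      rcases hμ with rfl | rfl | rfl <;> module
  | zero => simp
  | add x y _ _ hx hy => simp only [lie_add, hx, hy]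

theorem IsEuler.exists_lie_ne_zero {h : g} (hE : IsEuler h) : ∃ x : g, ⁅h, x⁆ ≠ 0 := by
  by_contra! hc
  exact hE.1 (LinearMap.ext hc)

theorem isSymmetric_of_exp_apply_eq_neg [FiniteDimensional ℝ g] {h j : g}
    (hj : NormedSpace.exp (LieAlgebra.ad ℝ g j) h = -h) : IsSymmetric h :=
  ⟨expAdUnit j, expAdUnit_mem (LieSubalgebra.mem_top j), hj⟩

/-- For a traceless real matrix `X` with determinant `-1/4` there is a traceless `J` with
`J² = -π²/4` that anticommutes with `X`. With `Z = diag(1, -1)`, `S` the exchange matrix, `K = ZS` and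
`X = a Z + s S + t K`, a multiple of `a t Z + s t S + (a² + s²) K` is such a `J`. -/
theorem exists_rotation_matrix {a b c : ℝ} (hdet : a ^ 2 + b * c = 4⁻¹) :
    ∃ p q r : ℝ, ∀ X J : Matrix (Fin 2) (Fin 2) ℝ, X = !![a, b; c, -a] → J = !![p, q; r, -p] →
      ⁅J, ⁅J, X⁆⁆ = -(Real.pi ^ 2) • X := by
  -- the square of the symmetric part of `X` is the scalar `κ`, and `J` has determinant `ρ² κ / 4`
  obtain ⟨κ, hκ⟩ : ∃ κ : ℝ, κ = a ^ 2 + ((b + c) / 2) ^ 2 := ⟨_, rfl⟩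
  have hκ0 : 0 < κ := by nlinarith [sq_nonneg ((b - c) / 2)]
  obtain ⟨ρ, hρ⟩ : ∃ ρ : ℝ, ρ ^ 2 * κ = Real.pi ^ 2 := by
    refine ⟨Real.pi / √κ, ?_⟩
    rw [div_pow, Real.sq_sqrt hκ0.le]
    field_simp
  refine ⟨ρ * (a * ((b - c) / 2)), ρ * ((b + c) / 2 * ((b - c) / 2) + κ),
    ρ * ((b + c) / 2 * ((b - c) / 2) - κ), fun X J hX hJ => ?_⟩
  have hJJ : J * J = -(4⁻¹ * Real.pi ^ 2) • (1 : Matrix (Fin 2) (Fin 2) ℝ) := by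
    have h1 : (a * ((b - c) / 2)) ^ 2 + ((b + c) / 2 * ((b - c) / 2) + κ) *
        ((b + c) / 2 * ((b - c) / 2) - κ) = - (4⁻¹ * κ) := by
      have h2 : 4⁻¹ = κ - ((b - c) / 2) ^ 2 := by rw [hκ, ← hdet]; ring
      rw [h2]
      linear_combination -((b - c) / 2) ^ 2 * hκ
    rw [hJ]
    ext i j
    fin_cases i <;> fin_cases j <;> simp
    · linear_combination ρ ^ 2 * h1 - 4⁻¹ * hρ
    · ring
    · ring
    · linear_combination ρ ^ 2 * h1 - 4⁻¹ * hρ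
  have hJX : J * X = -(X * J) := by
    have h1 : a * (a * ((b - c) / 2)) * 2 + ((b + c) / 2 * ((b - c) / 2) + κ) * c +
        ((b + c) / 2 * ((b - c) / 2) - κ) * b = 0 := by
      rw [hκ]; ring
    rw [hJ, hX]
    ext i j
    fin_cases i <;> fin_cases j <;> simp
    · linear_combination ρ * h1
    · ring
    · ring
    · linear_combination ρ * h1
  have hXJJ : X * J * J = -(4⁻¹ * Real.pi ^ 2) • X := by
    rw [mul_assoc, hJJ, mul_smul_comm, mul_one]
  have hJJX : J * (J * X) = -(4⁻¹ * Real.pi ^ 2) • X := by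
    rw [← mul_assoc, hJJ, smul_mul_assoc, one_mul]
  have hJXJ : J * (X * J) = -(-(4⁻¹ * Real.pi ^ 2) • X) := by
    rw [← mul_assoc, hJX, neg_mul, hXJJ]
  rw [Ring.lie_def, Ring.lie_def, hJX, mul_sub, sub_mul, mul_neg, neg_mul, hJXJ, hXJJ]
  module

/-- In `sl₂(ℝ)` an element with a three-grading is turned into its negative by an inner
automorphism. -/
theorem exists_rotation_sl {X : LieAlgebra.SpecialLinear.sl (Fin 2) ℝ} (hX0 : X ≠ 0)
    (hX : ThreeGraded X) :
    ∃ J : LieAlgebra.SpecialLinear.sl (Fin 2) ℝ, ⁅J, ⁅J, X⁆⁆ = -(Real.pi ^ 2) • X := by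
  obtain ⟨a, ha⟩ : ∃ a, X.val 0 0 = a := ⟨_, rfl⟩
  obtain ⟨b, hb⟩ : ∃ b, X.val 0 1 = b := ⟨_, rfl⟩
  obtain ⟨c, hc⟩ : ∃ c, X.val 1 0 = c := ⟨_, rfl⟩
  have hd : X.val 1 1 = -a := by linarith [trace_sl X]
  have hXm : X.val = !![a, b; c, -a] := by
    ext i j
    fin_cases i <;> fin_cases j
    exacts [ha, hb, hc, hd]
  have htr : ∀ p q r : ℝ, !![p, q; r, -p] ∈ LieAlgebra.SpecialLinear.sl (Fin 2) ℝ := by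
    intro p q r
    change Matrix.trace (!![p, q; r, -p] : Matrix (Fin 2) (Fin 2) ℝ) = 0
    simp [Matrix.trace_fin_two]
  have hlie : ∀ p q r : ℝ, ⁅(!![a, b; c, -a] : Matrix (Fin 2) (Fin 2) ℝ), !![p, q; r, -p]⁆ =
      !![b * r - q * c, 2 * (a * q - b * p); 2 * (c * p - a * r), -(b * r - q * c)] := by
    intro p q r
    rw [Ring.lie_def]
    ext i j
    fin_cases i <;> fin_cases j <;> simp <;> ring
  have h3 : ∀ p q r : ℝ, ⁅X.val, ⁅X.val, ⁅X.val, !![p, q; r, -p]⁆⁆⁆ = ⁅X.val, !![p, q; r, -p]⁆ :=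
    fun p q r => congrArg Subtype.val (hX ⟨_, htr p q r⟩)
  -- compare entries for the two elementary nilpotent matrices
  have hE := h3 0 1 0
  have hF := h3 0 0 1
  rw [hXm, hlie, hlie, hlie] at hE hF
  have h00 := congrFun (congrFun hE 0) 0
  have h01 := congrFun (congrFun hE 0) 1
  have h00' := congrFun (congrFun hF 0) 0
  simp at h00 h01 h00'
  have hdet : a ^ 2 + b * c = 4⁻¹ := by
    by_contra hne
    have hne' : 4 * (a ^ 2 + b * c) - 1 ≠ 0 := fun h0 => hne (by linarith)
    have hc0 : c = 0 := by
      have h1 : (4 * (a ^ 2 + b * c) - 1) * c = 0 := by linear_combination -h00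
      exact (mul_eq_zero.mp h1).resolve_left hne'
    have hb0 : b = 0 := by
      have h1 : (4 * (a ^ 2 + b * c) - 1) * b = 0 := by linear_combination h00'
      exact (mul_eq_zero.mp h1).resolve_left hne'
    have ha0 : a = 0 := by
      subst hc0 hb0
      have h1 : (4 * (a ^ 2 + 0 * 0) - 1) * a = 0 := by linear_combination h01
      exact (mul_eq_zero.mp h1).resolve_left hne'
    apply hX0
    refine Subtype.ext ?_
    rw [hXm, ha0, hb0, hc0]
    ext i j
    fin_cases i <;> fin_cases j <;> simp
  obtain ⟨p, q, r, h⟩ := exists_rotation_matrix hdet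
  exact ⟨⟨_, htr p q r⟩, Subtype.ext (h _ _ hXm rfl)⟩

/-- An Euler element lying in a subalgebra isomorphic to `sl₂(ℝ)` is symmetric. -/
theorem isSymmetric_of_mem_sl2 [FiniteDimensional ℝ g] {h : g} (hE : IsEuler h)
    {c : LieSubalgebra ℝ g} (hc : h ∈ c) (hsl : IsSl2 c) : IsSymmetric h := by
  obtain ⟨φ⟩ := hsl
  have hlie : ∀ x y : c, φ ⁅x, y⁆ = ⁅φ x, φ y⁆ := φ.map_lie
  have hsurj : ∀ y, ∃ x : c, φ x = y := φ.surjective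
  have hX0 : φ ⟨h, hc⟩ ≠ 0 := by
    intro h0
    have h1 : (⟨h, hc⟩ : c) = 0 := φ.injective (h0.trans φ.map_zero.symm)
    obtain ⟨x, hx⟩ := hE.exists_lie_ne_zero
    have h2 : h = 0 := congrArg Subtype.val h1
    exact hx (by rw [h2, zero_lie])
  have hX : ThreeGraded (φ ⟨h, hc⟩) := by
    intro y
    obtain ⟨x, rfl⟩ := hsurj y
    rw [← hlie, ← hlie, ← hlie]
    congr 1
    exact Subtype.ext (hE.threeGraded x)
  obtain ⟨J, hJ⟩ := exists_rotation_sl hX0 hX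
  obtain ⟨j, rfl⟩ := hsurj J
  rw [← hlie, ← hlie, ← map_smul] at hJ
  have h3 : ⁅(j : g), ⁅(j : g), h⁆⁆ = -(Real.pi ^ 2) • h := congrArg Subtype.val (φ.injective hJ)
  exact isSymmetric_of_exp_apply_eq_neg (exp_apply_eq_neg h3)

end Final

end EulerElement

theorem mainTheorem3 {g : Type*} [LieRing g] [LieAlgebra ℝ g] [FiniteDimensional ℝ g]
    (h : g) (hE : EulerElement.IsEuler h)
    (hss : (LieSubmodule.Quotient.mk h : g ⧸ LieAlgebra.radical ℝ g) ≠ 0) :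
    (∃ b : LieSubalgebra ℝ g, h ∈ b ∧
      (EulerElement.IsSl2 b ↔ EulerElement.IsSymmetric h) ∧
      (¬ EulerElement.IsSymmetric h → EulerElement.IsGl2 b) ∧
      (EulerElement.IsSymmetric h →
        Nonempty (EulerElement.Inn b ≃ₜ* Matrix.ProjectiveSpecialLinearGroup (Fin 2) ℝ)) ∧
      (¬ EulerElement.IsSymmetric h → LieAlgebra.IsSimple ℝ g →
        Nonempty (EulerElement.Inn (EulerElement.commutatorSubalgebra b) ≃ₜ*
          Matrix.SpecialLinearGroup (Fin 2) ℝ))) ∧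
    (∀ c : LieSubalgebra ℝ g, h ∈ c → EulerElement.IsSl2 c → EulerElement.IsSymmetric h) := by
  have hlast : ∀ c : LieSubalgebra ℝ g, h ∈ c → EulerElement.IsSl2 c →
      EulerElement.IsSymmetric h := fun c hc hsl => EulerElement.isSymmetric_of_mem_sl2 hE hc hsl
  refine ⟨?_, hlast⟩
  have hh := hE.threeGraded
  -- any norm on `End g` will do, the topology being the canonical one
  let := EulerElement.endNormedRing g
  let := EulerElement.endNormedAlgebra g
  by_cases hs : EulerElement.IsSymmetric h
  · obtain ⟨e, f, t, hef⟩ :=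
      EulerElement.exists_gradedTriple_of_isSymmetric hh hs hE.exists_lie_ne_zero
    obtain ⟨P, W⟩ := t.exists_weightData hh
    refine ⟨(EulerElement.slLieHom t).range, ?_, ⟨fun _ => hs, fun _ => ?_⟩, fun hn => absurd hs hn,
      fun _ => ?_, fun hn => absurd hs hn⟩
    · exact (EulerElement.mem_range_slLieHom t h).mpr ⟨0, 0, 2⁻¹, by rw [hef]; module⟩
    · exact ⟨(LieEquiv.ofInjective _ (EulerElement.slLieHom_injective t)).symm⟩
    · obtain ⟨ψ, hψ, hr⟩ := W.exists_isEmbedding_psl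
        (EulerElement.GradedTriple.P_one_eq_zero hh hef W) (t.P_two_ne_zero W)
      exact EulerElement.nonempty_continuousMulEquiv_of_isEmbedding hψ
        (hr.trans (EulerElement.GradedTriple.range_slHom_eq_Inn W
          (EulerElement.mem_range_slLieHom t)))
  · obtain ⟨e, f, t⟩ := EulerElement.exists_gradedTriple_of_notMem_radical hh
      (fun hr => hss ((EulerElement.quotient_mk_eq_zero_iff _ _).mpr hr))
    obtain ⟨P, W⟩ := t.exists_weightData hh
    -- otherwise the rotation of the triple would make `h` symmetric
    have hne : ⁅e, f⁆ ≠ (2 : ℝ) • h := by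
      intro hef
      obtain ⟨j, hj⟩ := t.exists_rotation
      refine hs (EulerElement.isSymmetric_of_exp_apply_eq_neg (j := j) ?_)
      have h1 : h = (2⁻¹ : ℝ) • ⁅e, f⁆ := by rw [hef]; module
      rw [h1, map_smul, hj, smul_neg]
    have hze : ⁅h - (2⁻¹ : ℝ) • ⁅e, f⁆, e⁆ = 0 := by
      rw [sub_lie, smul_lie, t.lie_e, t.lie_lie_e]; module
    have hzf : ⁅h - (2⁻¹ : ℝ) • ⁅e, f⁆, f⁆ = 0 := by
      rw [sub_lie, smul_lie, t.lie_f, t.lie_lie_f]; module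
    have hhz : ⁅h, h - (2⁻¹ : ℝ) • ⁅e, f⁆⁆ = 0 := by
      rw [lie_sub, lie_smul, t.lie_h, lie_self]; simp
    have hz : h - (2⁻¹ : ℝ) • ⁅e, f⁆ ≠ 0 := fun h0 => hne
      (by linear_combination (norm := module) (-2 : ℝ) • h0)
    have hinj : Function.Injective (EulerElement.glHom t _ hze hzf) := by
      rw [← LieHom.coe_toLinearMap, injective_iff_map_eq_zero]
      intro M hM
      obtain ⟨h1, h2, h3, h4⟩ := EulerElement.glHom_apply_eq_zero t hze hzf hhz hM
      have h5 := (smul_eq_zero.mp h4).resolve_right hz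
      have h6 : M 1 1 = 0 := by linarith
      ext i j
      fin_cases i <;> fin_cases j
      exacts [h3.trans h6, h1, h2, h6]
    have hmem : h ∈ (EulerElement.glHom t _ hze hzf).range := by
      refine ⟨!![1, 0; 0, 0], ?_⟩
      refine (EulerElement.glHom_apply t hze hzf _).trans ?_
      simp
    refine ⟨(EulerElement.glHom t _ hze hzf).range, hmem,
      ⟨hlast _ hmem, fun hs' => absurd hs' hs⟩, fun _ => ?_, fun hs' => absurd hs' hs,
      fun _ hsimple => ?_⟩
    · exact ⟨(LieEquiv.ofInjective _ hinj).symm⟩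
    · exact EulerElement.nonempty_continuousMulEquiv_of_isEmbedding
        (W.isEmbedding_slHom (t.P_one_ne_zero hh hne W))
        (EulerElement.GradedTriple.range_slHom_eq_Inn W
          (EulerElement.mem_commutatorSubalgebra_range_glHom t hze hzf))
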